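/- Let $\Pi=\{z\in\mathbb C:\operatorname{Re}z>0\}$ and let $H^\infty(\Pi)$ be the Banach space of bounded holomorphic functions on $\Pi$ with the supremum norm. Let $\beta\ge 0$ and $h\in\mathbb R$. On $H^\infty(\Pi)$ consider the bounded operators $$\mathcal L^{\uparrow}_\beta f(z)=\frac1{(1+z)^{2\beta}}\,f\Big(\frac z{1+z}\Big),\qquad \mathcal L^{\downarrow}_\beta f(z)=f(1+z),\qquad \mathcal L_{\beta,h}=e^{-\beta h}\mathcal L^{\uparrow}_\beta+e^{\beta h}\mathcal L^{\downarrow}_\beta$$ (principal branch of the power). Write $\sigma$ for the spectrum, $r$ for the spectral radius, and $r_{ess}(\mathcal A)=\sup\{|\mu| : \mu-\mathcal A \text{ is not a Fredholm operator}\}$ for the essential spectral radius. With $\mathcal S_\beta f(z)=z^{-2\beta}f(1/z)$ put $$\mathcal M_{\beta,\tau}=\tau\,[1-\tau\mathcal L^{\downarrow}_\beta]^{-1}\mathcal L^{\downarrow}_\beta\mathcal S_\beta ,$$ where $\mathcal L^{\downarrow}_\beta\mathcal S_\beta f(z)=(1+z)^{-2\beta}f(1/(1+z))$ is a bounded operator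 on $H^\infty(\Pi)$, and $$\Omega_{\beta,h}=\Big\{\tfrac1z:\ z\in\mathbb C\setminus\{0\},\ \tfrac1z\notin\sigma(e^{-\beta h}\mathcal L^{\uparrow}_\beta)\cup\sigma(e^{\beta h}\mathcal L^{\downarrow}_\beta),\ 1\in\sigma(\mathcal M_{\beta,ze^{\beta h}}\mathcal M_{\beta,ze^{-\beta h}})\Big\}.$$ Then: 1. $r_{ess}(\mathcal L_{\beta,h})\le e^{|\beta h|}\le r(\mathcal L_{\beta,h})$. 2. $\sigma(\mathcal L_{\beta,h})\cap\{\mu\in\mathbb C:|\mu|>e^{|\beta h|}\}=\Omega_{\beta,h}$, and this set consists of isolated points of $\sigma(\mathcal L_{\beta,h})$ that are eigenvalues of finite algebraic multiplicity (that is, $\bigcup_n\ker(\mathcal L_{\beta,h}-\mu)^n$ is finite-dimensional for every $\mu$ in it). 3. If $r(\mathcal L_{\beta,h})>r_{ess}(\mathcal L_{\beta,h})$, then $r(\mathcal L_{\beta,h})$ is an eigenvalue of $\mathcal L_{\beta,h}$. -/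

import Mathlib

open scoped NNReal ENNReal BoundedContinuousFunction

noncomputable section

namespace FareyChain

/-! ### Spectral notions for a bounded operator on a complex normed space -/

section Spectral

variable {X : Type*} [NormedAddCommGroup X] [NormedSpace ℂ X]

/-- The essential spectrum of a bounded operator `A`: all complex `μ` such that `μ - A` is not a
Fredholm operator. -/
def essSpectrum (A : X →L[ℂ] X) : Set ℂ :=
  {μ | ¬ ContinuousLinearMap.IsFredholm (algebraMap ℂ (X →L[ℂ] X) μ - A)}

/-- The essential spectral radius: the supremum of `|μ|` over the essential spectrum. -/
def essSpectralRadius (A : X →L[ℂ] X) : ℝ≥0∞ :=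
  ⨆ μ ∈ essSpectrum A, (‖μ‖₊ : ℝ≥0∞)

/-- `μ` is an eigenvalue of `A`: there is `f ≠ 0` with `A f = μ f`. -/
def IsEigenvalue (A : X →L[ℂ] X) (μ : ℂ) : Prop :=
  Module.End.HasEigenvalue (A : Module.End ℂ X) μ

/-- `μ` is an eigenvalue of `A`, is an isolated point of the spectrum of `A`, and has finite
algebraic multiplicity, i.e. the root space `⋃ₙ ker (A - μ)ⁿ` is finite-dimensional. -/
structure IsIsolatedEigenvalueOfFiniteMultiplicity (A : X →L[ℂ] X) (μ : ℂ) : Prop where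
  isEigenvalue : IsEigenvalue A μ
  isolated : ∃ ε > 0, ∀ ν ∈ spectrum ℂ A, ν ≠ μ → ε ≤ dist ν μ
  finite_multiplicity :
    FiniteDimensional ℂ (Module.End.maxGenEigenspace (A : Module.End ℂ X) μ)

end Spectral

/-! ### The space `H^∞(Π)` -/

/-- The open right half plane `Π`. -/
def rightHalfPlane : Set ℂ := {z | 0 < z.re}

/-- The space `H^∞(Π)` of bounded holomorphic functions on the right half plane, as a subspace of
the space of bounded continuous functions on it; the norm is the supremum norm. -/
def HInf : Submodule ℂ (rightHalfPlane →ᵇ ℂ) where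
  carrier := {f | ∃ F : ℂ → ℂ, DifferentiableOn ℂ F rightHalfPlane ∧
    ∀ z : rightHalfPlane, f z = F z}
  add_mem' := by
    rintro f g ⟨F, hF, hf⟩ ⟨G, hG, hg⟩
    exact ⟨fun z => F z + G z, hF.add hG, fun z => by simp [hf, hg]⟩
  zero_mem' := ⟨fun _ => 0, differentiableOn_const _, fun _ => rfl⟩
  smul_mem' := by
    rintro c f ⟨F, hF, hf⟩
    exact ⟨fun z => c * F z, hF.const_mul c, fun z => by simp [hf]⟩

/-- A holomorphic function on `Π` that is bounded there, as an element of `H^∞(Π)`. -/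
def HInf.mk (F : ℂ → ℂ) (hF : DifferentiableOn ℂ F rightHalfPlane) (C : ℝ)
    (hC : ∀ z ∈ rightHalfPlane, ‖F z‖ ≤ C) : HInf :=
  ⟨BoundedContinuousFunction.ofNormedAddCommGroup (fun z : rightHalfPlane => F z)
      (continuousOn_iff_continuous_domRestrict.mp hF.continuousOn) C (fun z => hC z z.2),
    F, hF, fun _ => rfl⟩

/-- The function `z ↦ w(z) f(φ(z))` for `w, f ∈ H^∞(Π)` and a holomorphic self-map `φ` of `Π`. -/
def weightedCompFun (w : HInf) (φ : ℂ → ℂ) (hφ : DifferentiableOn ℂ φ rightHalfPlane)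
    (hm : Set.MapsTo φ rightHalfPlane rightHalfPlane) (f : HInf) : HInf :=
  ⟨w.1 * f.1.compContinuous
      ⟨hm.restrict φ _ _, hφ.continuousOn.mapsToRestrict hm⟩, by
    obtain ⟨W, hW, hw⟩ := w.2
    obtain ⟨F, hF, hf⟩ := f.2
    refine ⟨fun z => W z * F (φ z), hW.mul (hF.comp hφ hm), fun z => ?_⟩
    simp only [BoundedContinuousFunction.mul_apply, hw,
      BoundedContinuousFunction.compContinuous_apply, ContinuousMap.coe_mk, hf]
    rfl⟩

/-- The weighted composition operator `C_{w,φ} f (z) = w(z) f(φ(z))` on `H^∞(Π)`. -/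
def weightedComp (w : HInf) (φ : ℂ → ℂ) (hφ : DifferentiableOn ℂ φ rightHalfPlane)
    (hm : Set.MapsTo φ rightHalfPlane rightHalfPlane) : HInf →L[ℂ] HInf :=
  LinearMap.mkContinuous
    { toFun := weightedCompFun w φ hφ hm
      map_add' := fun f g => by
        ext z
        exact mul_add _ _ _
      map_smul' := fun c f => by
        ext z
        exact mul_left_comm _ _ _ }
    ‖w‖
    (fun f => by
      refine (norm_mul_le w.1 _).trans ?_
      refine mul_le_mul_of_nonneg_left ?_ (norm_nonneg _)
      exact (BoundedContinuousFunction.norm_le (norm_nonneg f.1)).mpr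
        (fun z => f.1.norm_coe_le_norm _))

theorem weightedComp_apply (w : HInf) (φ : ℂ → ℂ) (hφ : DifferentiableOn ℂ φ rightHalfPlane)
    (hm : Set.MapsTo φ rightHalfPlane rightHalfPlane) (f : HInf) (z : rightHalfPlane) :
    (weightedComp w φ hφ hm f).1 z = w.1 z * f.1 ⟨φ z, hm z.2⟩ := rfl

/-! ### The transfer operators -/

theorem one_add_ne_zero {z : ℂ} (hz : z ∈ rightHalfPlane) : 1 + z ≠ 0 := by
  intro h
  have h1 : (1 + z).re = 0 := by rw [h]; rfl
  have hz' : 0 < z.re := hz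
  simp at h1
  linarith

theorem one_add_mem {z : ℂ} (hz : z ∈ rightHalfPlane) : 1 + z ∈ rightHalfPlane := by
  have hz' : 0 < z.re := hz
  change 0 < (1 + z).re
  simp
  linarith

theorem inv_mem {z : ℂ} (hz : z ∈ rightHalfPlane) : 1 / z ∈ rightHalfPlane := by
  have hz' : 0 < z.re := hz
  have h0 : z ≠ 0 := by rintro rfl; simp at hz'
  change 0 < (1 / z).re
  rw [one_div, Complex.inv_re]
  exact div_pos hz' (Complex.normSq_pos.mpr h0)

theorem upMap_mem {z : ℂ} (hz : z ∈ rightHalfPlane) : z / (1 + z) ∈ rightHalfPlane := by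
  have h0 : z ≠ 0 := by
    rintro rfl
    exact lt_irrefl (0 : ℝ) hz
  have h1 : 1 + z ≠ 0 := one_add_ne_zero hz
  have h2 : z / (1 + z) = 1 / (1 + 1 / z) := by
    have h3 : 1 + 1 / z = (1 + z) / z := by field_simp; ring
    rw [h3, one_div_div]
  rw [h2]
  exact inv_mem (one_add_mem (inv_mem hz))

theorem mapsTo_up : Set.MapsTo (fun z => z / (1 + z)) rightHalfPlane rightHalfPlane :=
  fun _ hz => upMap_mem hz

theorem mapsTo_down : Set.MapsTo (fun z => 1 + z) rightHalfPlane rightHalfPlane :=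
  fun _ hz => one_add_mem hz

theorem mapsTo_downFlip : Set.MapsTo (fun z => 1 / (1 + z)) rightHalfPlane rightHalfPlane :=
  fun _ hz => inv_mem (one_add_mem hz)

/-- The weight `1 / (1 + z)^{2β}` (principal branch; `Re (1 + z) > 0`), an element of `H^∞(Π)`
since `β ≥ 0`. -/
def weight (β : ℝ≥0) : HInf :=
  HInf.mk (fun z => 1 / (1 + z) ^ ((2 * (β : ℝ) : ℝ) : ℂ))
    (by
      intro z hz
      have hs : 1 + z ∈ Complex.slitPlane := Or.inl (one_add_mem hz)
      refine DifferentiableAt.differentiableWithinAt ?_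
      refine DifferentiableAt.div (differentiableAt_const _) ?_ ?_
      · exact ((differentiableAt_const _).add differentiableAt_id).cpow
          (differentiableAt_const _) hs
      · rw [← norm_ne_zero_iff, Complex.norm_cpow_real]
        exact (Real.rpow_pos_of_pos (norm_pos_iff.mpr (one_add_ne_zero hz)) _).ne')
    1
    (by
      intro z hz
      have hz' : 0 < z.re := hz
      have h1 : 1 ≤ ‖1 + z‖ := by
        refine le_trans ?_ (Complex.re_le_norm (1 + z))
        simp
        linarith
      rw [norm_div, norm_one, Complex.norm_cpow_real]
      have h2 : (1 : ℝ) ≤ ‖1 + z‖ ^ (2 * (β : ℝ)) :=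
        Real.one_le_rpow h1 (by positivity)
      exact (div_le_one (by linarith)).mpr h2)

/-- The spin-up operator `L↑_β f (z) = (1 + z)^{-2β} f(z / (1 + z))`. -/
def Lup (β : ℝ≥0) : HInf →L[ℂ] HInf :=
  weightedComp (weight β) (fun z => z / (1 + z))
    (differentiableOn_id.div ((differentiableOn_const _).add differentiableOn_id)
      (fun _ hz => one_add_ne_zero hz))
    mapsTo_up

/-- The spin-down operator `L↓_β f (z) = f(1 + z)`; it does not depend on `β`. -/
def Ldown : HInf →L[ℂ] HInf :=
  weightedComp (HInf.mk (fun _ => 1) (differentiableOn_const _) 1 (fun _ _ => by simp))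
    (fun z => 1 + z)
    ((differentiableOn_const _).add differentiableOn_id)
    mapsTo_down

/-- The transfer operator `L_{β,h} = e^{-βh} L↑_β + e^{βh} L↓_β`. -/
def L (β : ℝ≥0) (h : ℝ) : HInf →L[ℂ] HInf :=
  (Real.exp (-(β * h)) : ℂ) • Lup β + (Real.exp (β * h) : ℂ) • Ldown

/-- The spin flip `S_β f (z) = z^{-2β} f(1 / z)`, on arbitrary functions. It does not map
`H^∞(Π)` into itself for `β > 0`. -/
def spinFlip (β : ℝ≥0) (F : ℂ → ℂ) (z : ℂ) : ℂ :=
  1 / z ^ ((2 * (β : ℝ) : ℝ) : ℂ) * F (1 / z)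

/-- The product `L↓_β S_β`, that is, `f ↦ (1 + z)^{-2β} f(1 / (1 + z))`, which is a bounded
operator on `H^∞(Π)`. -/
def LdownFlip (β : ℝ≥0) : HInf →L[ℂ] HInf :=
  weightedComp (weight β) (fun z => 1 / (1 + z))
    ((differentiableOn_const _).div ((differentiableOn_const _).add differentiableOn_id)
      (fun _ hz => one_add_ne_zero hz))
    mapsTo_downFlip

theorem LdownFlip_apply (β : ℝ≥0) (f : HInf) (F : ℂ → ℂ)
    (hF : ∀ z : rightHalfPlane, f.1 z = F z) (z : rightHalfPlane) :
    (LdownFlip β f).1 z = spinFlip β F (1 + z) := by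
  have h := hF ⟨1 / (1 + (z : ℂ)), inv_mem (one_add_mem z.2)⟩
  rw [LdownFlip, weightedComp_apply, h]
  rfl

/-- The cluster operator `M_{β,τ} = M↓_{β,τ} S_β = τ (1 - τ L↓_β)⁻¹ L↓_β S_β`, where
`M↓_{β,τ} = τ L↓_β (1 - τ L↓_β)⁻¹`. (`Ring.inverse` is the two-sided inverse of an
invertible element.) -/
def M (β : ℝ≥0) (τ : ℂ) : HInf →L[ℂ] HInf :=
  τ • (Ring.inverse (1 - τ • Ldown) * LdownFlip β)

/-- The set `Ω_{β,h}` of all `1 / z`, where `z ≠ 0`, `1 / z` lies in the spectrum of neither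
`e^{-βh} L↑_β` nor `e^{βh} L↓_β`, and `1` lies in the spectrum of
`M_{β, z e^{βh}} M_{β, z e^{-βh}}`. -/
def Omega (β : ℝ≥0) (h : ℝ) : Set ℂ :=
  {μ | ∃ z : ℂ, z ≠ 0 ∧ μ = 1 / z ∧
    1 / z ∉ spectrum ℂ ((Real.exp (-(β * h)) : ℂ) • Lup β) ∧
    1 / z ∉ spectrum ℂ ((Real.exp (β * h) : ℂ) • Ldown) ∧
    (1 : ℂ) ∈ spectrum ℂ
      (M β (z * Real.exp (β * h)) * M β (z * Real.exp (-(β * h))))}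

end FareyChain

end

/-!
The operator is a sum `L = A + B` with `A = e^{-βh} L↑` and `B = e^{βh} L↓`, both of norm at most
`ρ = e^{|βh|}`, and the product `L↑L↓` is a weighted composition operator whose symbol maps `Π` into
a compact part of `Π`, so that it is a norm limit of operators of finite rank. The factorization
`1 - t(A + B) = (1 - tA)(1 - tB) - t²AB` and a Fredholm determinant that is holomorphic for
`|t| < 1/ρ` (`exists_analytic_determinant`) give the Fredholm property, and hence the bound for the
essential spectral radius, the isolation of the eigenvalues and their finite multiplicity
(`isIsolatedEigenvalue_of_mem_spectrum`).

The norms of the iterates of `L` are dominated by the values of `Lⁿ1` on the positive axis. This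
yields `ρ ≤ r(L)` and shows that the resolvent is largest on the positive axis, so that `r(L)`
belongs to the spectrum (`spectralRadius_mem_spectrum`); if it exceeds the essential spectral
radius, it is a boundary point of the spectrum at which `μ - L` is Fredholm, hence an eigenvalue.

For the description of the spectrum by the cluster operators, write an eigenfunction of `L` as
`F = f + S g` with `f = zbL↓F` and `S g = zaL↑F`, where `a = e^{-βh}`, `b = e^{βh}`, `z = 1/μ`. Then
`f = M_{zb} g` and `g = M_{za} f`. Conversely such a pair gives the eigenfunction `f + S g`, which is
bounded because solutions of these equations decay like `|1 + v|^{-2β}` (`exists_norm_le_rpow`).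
It remains to exclude points `μ = 1/z` of `Ω` in the disc `|μ| ≤ ρ`. On the positive axis they are
excluded because `(0, ρ]` is covered by the spectra of `A` and `B` (`ofReal_mem_spectrum_or`). Off the
positive axis one uses the energy form `⟨G, H⟩ = ∫_Π G' conj(H') (Re v)^{2β} dA`. It is invariant
under `S`, because in the coordinate `log v` the spin flip becomes the reflection at `0`
(`energy_spinFlip`), and `⟨L↓G, G⟩ ≥ 0` by a shift of the contour (`exists_energy_shift_eq`).
Hence `⟨F, F⟩ = z(b⟨L↓F, F⟩ + a⟨L↓SF, SF⟩)`, where all brackets are nonnegative. If `z` is not on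
the positive axis, all of them vanish, and so does `F` (`IsClusterPair.eq_zero_of_pos`). The form
needs `β > 0`; for `β = 0` the derivatives of `f` and `g` solve the equations for `β = 1`.
-/

open scoped NNReal ENNReal BoundedContinuousFunction

noncomputable section

namespace FareyChain

/-! ### Perturbation by operators that are norm limits of finite rank operators -/

section FiniteRank

open Filter Topology Metric

variable {X : Type*} [NormedAddCommGroup X] [NormedSpace ℂ X]

/-- An operator that is a limit, in operator norm, of operators of finite rank. The finite rank
approximants come with a factorization through some `ℂⁿ`. -/
def FiniteRankApproximable (K : X →L[ℂ] X) : Prop :=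
  ∀ ε > 0, ∃ (n : ℕ) (Φ : X →L[ℂ] (Fin n → ℂ)) (V : (Fin n → ℂ) →L[ℂ] X), ‖K - V ∘L Φ‖ ≤ ε

theorem FiniteRankApproximable.mul_left {K : X →L[ℂ] X} (hK : FiniteRankApproximable K)
    (A : X →L[ℂ] X) : FiniteRankApproximable (A * K) := by
  intro ε hε
  obtain ⟨n, Φ, V, h⟩ := hK (ε / (‖A‖ + 1)) (by positivity)
  refine ⟨n, Φ, A ∘L V, ?_⟩
  have h1 : A * K - (A ∘L V) ∘L Φ = A * (K - V ∘L Φ) := by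
    ext x; simp
  rw [h1]
  calc ‖A * (K - V ∘L Φ)‖ ≤ ‖A‖ * (ε / (‖A‖ + 1)) :=
        (norm_mul_le _ _).trans (by gcongr)
    _ ≤ (‖A‖ + 1) * (ε / (‖A‖ + 1)) := by gcongr; linarith
    _ = ε := by field_simp

theorem FiniteRankApproximable.mul_right {K : X →L[ℂ] X} (hK : FiniteRankApproximable K)
    (A : X →L[ℂ] X) : FiniteRankApproximable (K * A) := by
  intro ε hε
  obtain ⟨n, Φ, V, h⟩ := hK (ε / (‖A‖ + 1)) (by positivity)
  refine ⟨n, Φ ∘L A, V, ?_⟩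
  have h1 : K * A - V ∘L (Φ ∘L A) = (K - V ∘L Φ) * A := by
    ext x; simp
  rw [h1]
  calc ‖(K - V ∘L Φ) * A‖ ≤ (ε / (‖A‖ + 1)) * ‖A‖ :=
        (norm_mul_le _ _).trans (by gcongr)
    _ ≤ (ε / (‖A‖ + 1)) * (‖A‖ + 1) := by gcongr; linarith
    _ = ε := by field_simp

/-- An operator `G - VΦ`, where `G` is invertible and `VΦ` factors through `ℂⁿ`, is controlled by
the determinant `d` of the matrix `m` of `1 - Φ G⁻¹ V`: the operator `d G⁻¹ + G⁻¹ V adj(m) Φ G⁻¹`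
is `d` times its inverse. -/
theorem adjugate_mul_sub {G Gi : X →L[ℂ] X} (h1 : G * Gi = 1) (h2 : Gi * G = 1) {n : ℕ}
    (Φ : X →L[ℂ] (Fin n → ℂ)) (V : (Fin n → ℂ) →L[ℂ] X) (m : Matrix (Fin n) (Fin n) ℂ)
    (hm : ∀ c, m.mulVec c = c - Φ (Gi (V c))) (J : (Fin n → ℂ) →L[ℂ] (Fin n → ℂ))
    (hJ : ∀ c, J c = m.adjugate.mulVec c) :
    (m.det • Gi + Gi ∘L V ∘L J ∘L Φ ∘L Gi) * (G - V ∘L Φ) = m.det • 1 ∧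
      (G - V ∘L Φ) * (m.det • Gi + Gi ∘L V ∘L J ∘L Φ ∘L Gi) = m.det • 1 := by
  have e1 : ∀ x, G (Gi x) = x := fun x => congrArg (fun T : X →L[ℂ] X => T x) h1
  have e2 : ∀ x, Gi (G x) = x := fun x => congrArg (fun T : X →L[ℂ] X => T x) h2
  have e3 : ∀ c, J c - J (Φ (Gi (V c))) = m.det • c := by
    intro c
    rw [← map_sub, ← hm, hJ, Matrix.mulVec_mulVec, Matrix.adjugate_mul, Matrix.smul_mulVec,
      Matrix.one_mulVec]
  have e4 : ∀ c, J c - Φ (Gi (V (J c))) = m.det • c := by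
    intro c
    rw [← hm, hJ, Matrix.mulVec_mulVec, Matrix.mul_adjugate, Matrix.smul_mulVec,
      Matrix.one_mulVec]
  constructor
  · ext x
    have := congrArg (fun c => Gi (V c)) (e3 (Φ x))
    simp only [map_sub, map_smul] at this
    simp only [mul_apply_eq_comp, add_apply,
      smul_apply, sub_apply,
      ContinuousLinearMap.comp_apply, map_sub, e2, one_apply_eq_self]
    linear_combination (norm := module) this
  · ext x
    have := congrArg (fun c => V c) (e4 (Φ (Gi x)))
    simp only [map_sub, map_smul] at this
    simp only [mul_apply_eq_comp, add_apply,
      smul_apply, sub_apply,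
      ContinuousLinearMap.comp_apply, map_add, map_smul, e1, one_apply_eq_self]
    linear_combination (norm := module) this

theorem isFredholm_sub_of_isUnit {G Gi : X →L[ℂ] X} (h1 : G * Gi = 1) (h2 : Gi * G = 1) {n : ℕ}
    (Φ : X →L[ℂ] (Fin n → ℂ)) (V : (Fin n → ℂ) →L[ℂ] X) :
    ContinuousLinearMap.IsFredholm (G - V ∘L Φ) := by
  have e1 : ∀ x, G (Gi x) = x := fun x => congrArg (fun T : X →L[ℂ] X => T x) h1
  have e2 : ∀ x, Gi (G x) = x := fun x => congrArg (fun T : X →L[ℂ] X => T x) h2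
  refine ContinuousLinearMap.IsFredholm.of_isQuasiInverse (v := Gi) ⟨?_, ?_⟩
  · refine LinearMap.FiniteRangeSetoid.equiv_iff_hasFiniteRange.mpr ?_
    have : ((Gi : X →ₗ[ℂ] X) ∘ₗ ((G - V ∘L Φ : X →L[ℂ] X) : X →ₗ[ℂ] X) - LinearMap.id)
        = -(((Gi : X →ₗ[ℂ] X) ∘ₗ (V : (Fin n → ℂ) →ₗ[ℂ] X)) ∘ₗ (Φ : X →ₗ[ℂ] (Fin n → ℂ))) := by
      ext x; simp [e2]
    rw [this]
    exact (LinearMap.HasFiniteRange.of_finite_dom.comp_right _).neg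
  · refine LinearMap.FiniteRangeSetoid.equiv_iff_hasFiniteRange.mpr ?_
    have : (((G - V ∘L Φ : X →L[ℂ] X) : X →ₗ[ℂ] X) ∘ₗ (Gi : X →ₗ[ℂ] X) - LinearMap.id)
        = -((V : (Fin n → ℂ) →ₗ[ℂ] X) ∘ₗ ((Φ : X →ₗ[ℂ] (Fin n → ℂ)) ∘ₗ (Gi : X →ₗ[ℂ] X))) := by
      ext x; simp [e1]
    rw [this]
    exact (LinearMap.HasFiniteRange.of_finite_dom.comp_right _).neg

variable [CompleteSpace X]

theorem FiniteRankApproximable.isCompactOperator {K : X →L[ℂ] X}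
    (hK : FiniteRankApproximable K) : IsCompactOperator K := by
  have h : ∀ k : ℕ, ∃ F : X →L[ℂ] X, IsCompactOperator F ∧ ‖K - F‖ ≤ 1 / ((k : ℝ) + 1) := by
    intro k
    obtain ⟨n, Φ, V, h⟩ := hK (1 / ((k : ℝ) + 1)) (by positivity)
    refine ⟨V ∘L Φ, ?_, h⟩
    exact (IsCompactOperator.comp_clm (isCompactOperator_of_locallyCompactSpace_rng V) Φ)
  choose F hF hKF using h
  refine isCompactOperator_of_tendsto (l := atTop) (F := F) ?_ (Eventually.of_forall hF)
  rw [tendsto_iff_norm_sub_tendsto_zero]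
  refine squeeze_zero (fun _ => norm_nonneg _) (fun k => ?_)
    (tendsto_one_div_add_atTop_nhds_zero_nat (𝕜 := ℝ))
  rw [norm_sub_rev]
  exact hKF k

theorem isUnit_one_sub_smul {A : X →L[ℂ] X} {ρ : ℝ} (hA : ‖A‖ ≤ ρ) {t : ℂ} (ht : ‖t‖ * ρ < 1) :
    IsUnit (1 - t • A) := by
  refine isUnit_one_sub_of_norm_lt_one ?_
  rw [norm_smul]
  exact lt_of_le_of_lt (by gcongr) ht

theorem norm_inverse_one_sub_smul_le {A : X →L[ℂ] X} {ρ : ℝ} (hA : ‖A‖ ≤ ρ) {t : ℂ}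
    (ht : ‖t‖ * ρ < 1) : ‖Ring.inverse (1 - t • A)‖ ≤ (1 - ‖t‖ * ρ)⁻¹ := by
  refine ContinuousLinearMap.opNorm_le_bound _ (inv_nonneg.mpr (by linarith)) fun y => ?_
  have h1 : (1 - t • A) (Ring.inverse (1 - t • A) y) = y := by
    have := Ring.mul_inverse_cancel _ (isUnit_one_sub_smul hA ht)
    exact congrArg (fun T : X →L[ℂ] X => T y) this
  set x := Ring.inverse (1 - t • A) y
  have h2 : x = y + t • A x := by
    rw [← h1]; simp
  have h3 : ‖x‖ ≤ ‖y‖ + ‖t‖ * ρ * ‖x‖ := by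
    calc ‖x‖ = ‖y + t • A x‖ := by rw [← h2]
      _ ≤ ‖y‖ + ‖t‖ * (ρ * ‖x‖) := by
        refine (norm_add_le _ _).trans ?_
        rw [norm_smul]
        gcongr
        exact (A.le_opNorm x).trans (by gcongr)
      _ = _ := by ring
  rw [inv_mul_eq_div, le_div_iff₀ (by linarith)]
  linarith

/-- Analytic Fredholm theory for the pencil `1 - t(A + B)`: on the disc of radius `r` there is a
holomorphic determinant `d`, with `d 0 = 1`, and a continuous operator function `Q` such that
`Q t = d t • (1 - t(A + B))⁻¹`. The reason is the factorization
`1 - t(A + B) = (1 - tA)(1 - tB) - t² AB`, in which `AB` is nearly of finite rank. -/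
theorem exists_analytic_determinant {A B : X →L[ℂ] X} {ρ : ℝ} (hA : ‖A‖ ≤ ρ) (hB : ‖B‖ ≤ ρ)
    (hAB : FiniteRankApproximable (A * B)) {r : ℝ} (hr : r * ρ < 1) :
    ∃ (d : ℂ → ℂ) (Q : ℂ → X →L[ℂ] X), DifferentiableOn ℂ d (ball 0 r) ∧ d 0 = 1 ∧
      ContinuousOn Q (ball 0 r) ∧ ∀ t ∈ ball (0 : ℂ) r,
        Q t * (1 - t • (A + B)) = d t • 1 ∧ (1 - t • (A + B)) * Q t = d t • 1 ∧
        (d t = 0 → ∃ x ≠ 0, (1 - t • (A + B)) x = 0) ∧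
        ContinuousLinearMap.IsFredholm (1 - t • (A + B)) := by
  have hρ : 0 ≤ ρ := (norm_nonneg A).trans hA
  have hs : 0 < 1 - r * ρ := by linarith
  obtain ⟨n, Φ, V, hE⟩ := hAB ((1 - r * ρ) ^ 2 / (r ^ 2 + 1)) (by positivity)
  set E := A * B - V ∘L Φ with hEdef
  let N : ℂ → X →L[ℂ] X := fun t => (1 - t • A) * (1 - t • B) - t ^ 2 • E
  have hN : ∀ t ∈ ball (0 : ℂ) r, IsUnit (N t) := by
    intro t ht
    have ht' : ‖t‖ < r := by simpa using ht
    have htρ : ‖t‖ * ρ ≤ r * ρ := by gcongr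
    have hu1 := isUnit_one_sub_smul hA (t := t) (by linarith)
    have hu2 := isUnit_one_sub_smul hB (t := t) (by linarith)
    have hn1 := norm_inverse_one_sub_smul_le hA (t := t) (by linarith)
    have hn2 := norm_inverse_one_sub_smul_le hB (t := t) (by linarith)
    set RA := Ring.inverse (1 - t • A)
    set RB := Ring.inverse (1 - t • B)
    have hfac : N t = (1 - t • A) * (1 - t ^ 2 • (RA * E * RB)) * (1 - t • B) := by
      have e1 : (1 - t • A) * RA = 1 := Ring.mul_inverse_cancel _ hu1
      have e2 : RB * (1 - t • B) = 1 := Ring.inverse_mul_cancel _ hu2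
      have : (1 - t • A) * (t ^ 2 • (RA * E * RB)) * (1 - t • B) = t ^ 2 • E := by
        rw [mul_smul_comm, smul_mul_assoc]
        congr 1
        calc (1 - t • A) * (RA * E * RB) * (1 - t • B)
            = ((1 - t • A) * RA) * E * (RB * (1 - t • B)) := by noncomm_ring
          _ = E := by rw [e1, e2, one_mul, mul_one]
      rw [mul_sub (1 - t • A), sub_mul _ _ (1 - t • B), this, mul_one]
    rw [hfac]
    refine (hu1.mul ?_).mul hu2
    refine isUnit_one_sub_of_norm_lt_one ?_
    have hb : (1 - ‖t‖ * ρ)⁻¹ ≤ (1 - r * ρ)⁻¹ := inv_anti₀ hs (by linarith)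
    have hr0 : 0 ≤ ‖t‖ := norm_nonneg t
    calc ‖t ^ 2 • (RA * E * RB)‖ ≤ ‖t‖ ^ 2 * (‖RA‖ * ‖E‖ * ‖RB‖) := by
          rw [norm_smul, norm_pow]
          gcongr
          exact (norm_mul_le _ _).trans (by gcongr; exact norm_mul_le _ _)
      _ ≤ r ^ 2 * ((1 - r * ρ)⁻¹ * ((1 - r * ρ) ^ 2 / (r ^ 2 + 1)) * (1 - r * ρ)⁻¹) := by
          gcongr
          · exact hn1.trans hb
          · exact hn2.trans hb
      _ = r ^ 2 / (r ^ 2 + 1) := by field_simp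
      _ < 1 := by
          rw [div_lt_one (by positivity)]; linarith
  have hfact : ∀ t : ℂ, 1 - t • (A + B) = N t - (t ^ 2 • V) ∘L Φ := by
    intro t
    have h0 : A * B = E + V ∘L Φ := by rw [hEdef]; abel
    have h1 : (1 - t • A) * (1 - t • B) = 1 - t • (A + B) + t ^ 2 • (A * B) := by
      simp only [mul_sub, sub_mul, mul_one, one_mul, smul_mul_assoc, mul_smul_comm]
      module
    simp only [N]
    rw [h1, h0, ContinuousLinearMap.smul_comp]
    module
  let Gi : ℂ → X →L[ℂ] X := fun t => Ring.inverse (N t)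
  have hGiD : DifferentiableOn ℂ Gi (ball 0 r) := by
    intro t ht
    have hd : DifferentiableAt ℂ N t := by
      simp only [N]
      fun_prop
    exact ((differentiableAt_inverse (hN t ht)).comp t hd).differentiableWithinAt
  let m : ℂ → Matrix (Fin n) (Fin n) ℂ := fun t =>
    LinearMap.toMatrix' (LinearMap.id -
      ((Φ ∘L Gi t ∘L (t ^ 2 • V) : (Fin n → ℂ) →L[ℂ] (Fin n → ℂ)) : (Fin n → ℂ) →ₗ[ℂ] _))
  have hm : ∀ t c, (m t).mulVec c = c - Φ (Gi t ((t ^ 2 • V) c)) := by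
    intro t c
    rw [← Matrix.toLin'_apply]
    simp only [m, Matrix.toLin'_toMatrix']
    rfl
  have hmD : ∀ i j, DifferentiableOn ℂ (fun t => m t i j) (ball 0 r) := by
    intro i j
    have : (fun t => m t i j) = fun t => (1 : Matrix (Fin n) (Fin n) ℂ) i j -
        t ^ 2 * (Φ (Gi t (V (Pi.single j 1)))) i := by
      funext t
      simp only [m, LinearMap.toMatrix'_apply, LinearMap.sub_apply, LinearMap.id_apply,
        ContinuousLinearMap.coe_coe, ContinuousLinearMap.comp_apply,
        smul_apply, map_smul, Pi.sub_apply, Pi.smul_apply, smul_eq_mul]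
      congr 1
      simp [Matrix.one_apply, Pi.single_apply]
    rw [this]
    have hev : DifferentiableOn ℂ (fun t => (Φ (Gi t (V (Pi.single j 1)))) i) (ball 0 r) := by
      have h1 : DifferentiableOn ℂ (fun t => Gi t (V (Pi.single j 1))) (ball 0 r) :=
        hGiD.clm_apply (differentiableOn_const _)
      have h2 : DifferentiableOn ℂ (fun t => Φ (Gi t (V (Pi.single j 1)))) (ball 0 r) :=
        Φ.differentiable.comp_differentiableOn h1
      exact differentiableOn_pi.mp h2 i
    exact (differentiableOn_const _).sub ((differentiableOn_id.pow 2).mul hev)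
  have hmC : ContinuousOn m (ball 0 r) :=
    continuousOn_pi.mpr fun i => continuousOn_pi.mpr fun j => (hmD i j).continuousOn
  let ι : Matrix (Fin n) (Fin n) ℂ →ₗ[ℂ] ((Fin n → ℂ) →L[ℂ] (Fin n → ℂ)) :=
    (LinearMap.toContinuousLinearMap (𝕜 := ℂ) (E := Fin n → ℂ) (F' := Fin n → ℂ)).toLinearMap ∘ₗ
      (Matrix.toLin' (R := ℂ) (m := Fin n) (n := Fin n)).toLinearMap
  have hι : Continuous ι := LinearMap.continuous_of_finiteDimensional _
  let J : ℂ → (Fin n → ℂ) →L[ℂ] (Fin n → ℂ) := fun t => ι (m t).adjugate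
  have hJ : ∀ t c, J t c = (m t).adjugate.mulVec c := fun t c => rfl
  have hJC : ContinuousOn J (ball 0 r) :=
    (hι.comp (continuous_id.matrix_adjugate)).comp_continuousOn hmC
  have hdC : ContinuousOn (fun t => (m t).det) (ball 0 r) :=
    (continuous_id.matrix_det).comp_continuousOn hmC
  refine ⟨fun t => (m t).det,
    fun t => (m t).det • Gi t + Gi t ∘L (t ^ 2 • V) ∘L J t ∘L Φ ∘L Gi t, ?_, ?_, ?_, ?_⟩
  · simp only [Matrix.det_apply]
    refine DifferentiableOn.fun_sum fun σ _ => ?_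
    refine DifferentiableOn.const_smul ?_ _
    exact DifferentiableOn.fun_finsetProd fun i _ => hmD _ _
  · have : m 0 = 1 := by
      ext i j
      simp [m, LinearMap.toMatrix'_apply, Matrix.one_apply]
    simp [this]
  · have hGiC := hGiD.continuousOn
    have hV : ContinuousOn (fun t : ℂ => t ^ 2 • V) (ball 0 r) := by fun_prop
    exact (hdC.smul hGiC).add (hGiC.clm_comp (hV.clm_comp (hJC.clm_comp
      (continuousOn_const.clm_comp hGiC))))
  · intro t ht
    have i1 : N t * Gi t = 1 := Ring.mul_inverse_cancel _ (hN t ht)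
    have i2 : Gi t * N t = 1 := Ring.inverse_mul_cancel _ (hN t ht)
    have hadj := adjugate_mul_sub i1 i2 Φ (t ^ 2 • V) (m t) (hm t) (J t) (hJ t)
    rw [hfact t]
    refine ⟨hadj.1, hadj.2, fun hd => ?_, isFredholm_sub_of_isUnit i1 i2 Φ (t ^ 2 • V)⟩
    obtain ⟨c, hc, hmc⟩ := Matrix.exists_mulVec_eq_zero_iff.mpr hd
    have hc2 : c = Φ (Gi t ((t ^ 2 • V) c)) := by
      rw [hm] at hmc
      exact sub_eq_zero.mp hmc
    refine ⟨Gi t ((t ^ 2 • V) c), fun h0 => hc ?_, ?_⟩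
    · rw [hc2, h0, map_zero]
    · have : N t (Gi t ((t ^ 2 • V) c)) = (t ^ 2 • V) c :=
        congrArg (fun T : X →L[ℂ] X => T _) i1
      rw [sub_apply, this, ContinuousLinearMap.comp_apply, ← hc2, sub_self]

end FiniteRank

/-! ### Isolated eigenvalues of finite multiplicity -/

section FiniteMultiplicity

open Filter Topology Metric

variable {X : Type*} [NormedAddCommGroup X] [NormedSpace ℂ X]

theorem algebraMap_sub_eq_smul {L : X →L[ℂ] X} {μ : ℂ} (hμ : μ ≠ 0) :
    algebraMap ℂ (X →L[ℂ] X) μ - L = μ • (1 - μ⁻¹ • L) := by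
  rw [smul_sub, smul_smul, mul_inv_cancel₀ hμ, one_smul, Algebra.algebraMap_eq_smul_one]

theorem isUnit_one_sub_inv_smul_iff {L : X →L[ℂ] X} {μ : ℂ} (hμ : μ ≠ 0) :
    IsUnit (1 - μ⁻¹ • L) ↔ μ ∉ spectrum ℂ L := by
  rw [spectrum.notMem_iff, algebraMap_sub_eq_smul hμ]
  exact (isUnit_smul_iff (Units.mk0 μ hμ) (1 - μ⁻¹ • L)).symm

theorem isEigenvalue_iff {L : X →L[ℂ] X} {μ : ℂ} :
    IsEigenvalue L μ ↔ ∃ x ≠ 0, L x = μ • x := by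
  constructor
  · intro h
    obtain ⟨x, hx⟩ := h.exists_hasEigenvector
    exact ⟨x, hx.2, hx.apply_eq_smul⟩
  · rintro ⟨x, hx, h⟩
    exact Module.End.hasEigenvalue_of_hasEigenvector (x := x)
      ⟨Module.End.mem_eigenspace_iff.mpr h, hx⟩

theorem isFredholm_smul {T : X →L[ℂ] X} (hT : ContinuousLinearMap.IsFredholm T) {c : ℂ}
    (hc : c ≠ 0) : ContinuousLinearMap.IsFredholm (c • T) := by
  obtain ⟨v, hv⟩ := hT.exists_isQuasiInverse
  refine ContinuousLinearMap.IsFredholm.of_isQuasiInverse (v := c⁻¹ • v) ?_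
  obtain ⟨h1, h2⟩ := hv
  have e1 : ((c⁻¹ • v : X →L[ℂ] X) : X →ₗ[ℂ] X) ∘ₗ ((c • T : X →L[ℂ] X) : X →ₗ[ℂ] X)
      = (v : X →ₗ[ℂ] X) ∘ₗ (T : X →ₗ[ℂ] X) := by
    ext x; simp [smul_smul, hc]
  have e2 : ((c • T : X →L[ℂ] X) : X →ₗ[ℂ] X) ∘ₗ ((c⁻¹ • v : X →L[ℂ] X) : X →ₗ[ℂ] X)
      = (T : X →ₗ[ℂ] X) ∘ₗ (v : X →ₗ[ℂ] X) := by
    ext x; simp [smul_smul, hc]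
  refine ⟨?_, ?_⟩
  · unfold LinearMap.IsLeftQuasiInverse at *
    rw [e1]; exact h1
  · unfold LinearMap.IsRightQuasiInverse LinearMap.IsLeftQuasiInverse at *
    rw [e2]; exact h2

theorem finiteDimensional_ker_pow {V : Type*} [AddCommGroup V] [Module ℂ V] (T : Module.End ℂ V)
    (hT : FiniteDimensional ℂ (LinearMap.ker T)) (m : ℕ) :
    FiniteDimensional ℂ (LinearMap.ker (T ^ m)) := by
  induction m with
  | zero =>
    rw [pow_zero, Module.End.one_eq_id, LinearMap.ker_id]
    infer_instance
  | succ m ih =>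
    rw [← Submodule.fg_iff_finiteDimensional] at *
    refine Submodule.fg_of_fg_map_of_fg_inf_ker T ?_ ?_
    · refine Submodule.FG.of_le ih ?_
      rintro _ ⟨x, hx, rfl⟩
      rw [SetLike.mem_coe, LinearMap.mem_ker] at hx
      rw [LinearMap.mem_ker, ← Module.End.mul_apply, ← pow_succ]
      exact hx
    · exact Submodule.FG.of_le hT inf_le_right

variable [CompleteSpace X]

/-- A point `μ` outside the closed disc of radius `ρ` is either in the resolvent set of `A + B` or
an isolated eigenvalue of finite multiplicity. The root vectors are bounded in length by the order
`m` of the zero `t₀ = 1/μ` of the determinant `d`: with `T = 1 - t₀L`, the vector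
`x = ∑ s^{n-1-k} Tᵏy` satisfies `(T - s)x = -sⁿy` if `Tⁿy = 0`, while `d(t)x = Q(t)(1 - tL)x`
for `s = (t - t₀)/t`; comparing powers of `s` gives `T^{n-1}y = 0` whenever `n > m`. -/
theorem isIsolatedEigenvalue_of_mem_spectrum {A B : X →L[ℂ] X} {ρ : ℝ} (hA : ‖A‖ ≤ ρ)
    (hB : ‖B‖ ≤ ρ) (hAB : FiniteRankApproximable (A * B)) {μ : ℂ} (hμρ : ρ < ‖μ‖) :
    ContinuousLinearMap.IsFredholm (algebraMap ℂ (X →L[ℂ] X) μ - (A + B)) ∧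
      (μ ∈ spectrum ℂ (A + B) → IsIsolatedEigenvalueOfFiniteMultiplicity (A + B) μ) := by
  have hρ : 0 ≤ ρ := (norm_nonneg A).trans hA
  have hμ0 : 0 < ‖μ‖ := hρ.trans_lt hμρ
  have hμ : μ ≠ 0 := norm_pos_iff.mp hμ0
  set L := A + B with hL
  set t₀ := μ⁻¹ with ht₀
  have ht₀0 : t₀ ≠ 0 := inv_ne_zero hμ
  -- any radius `r` with `|t₀| < r` and `rρ < 1` will do
  obtain ⟨r, hr1, hr2⟩ : ∃ r, ‖t₀‖ < r ∧ r * ρ < 1 := by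
    refine ⟨2 / (ρ + ‖μ‖), ?_, ?_⟩
    · rw [ht₀, norm_inv, inv_eq_one_div, div_lt_div_iff₀ hμ0 (by linarith)]
      linarith
    · rw [div_mul_eq_mul_div, div_lt_one (by linarith)]
      linarith
  obtain ⟨d, Q, hd, hd0, hQ, hdQ⟩ := exists_analytic_determinant hA hB hAB hr2
  rw [← hL] at hdQ
  have hr0 : 0 < r := (norm_nonneg _).trans_lt hr1
  have htb : t₀ ∈ ball (0 : ℂ) r := by simpa using hr1
  obtain ⟨-, -, hker, hfred⟩ := hdQ t₀ htb
  refine ⟨?_, fun hspec => ?_⟩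
  · rw [algebraMap_sub_eq_smul hμ]
    exact isFredholm_smul hfred hμ
  have hunit : ∀ t ∈ ball (0 : ℂ) r, d t ≠ 0 → IsUnit (1 - t • L) := by
    intro t ht hdt
    obtain ⟨h1, h2, -, -⟩ := hdQ t ht
    refine isUnit_iff_exists.mpr ⟨(d t)⁻¹ • Q t, ?_, ?_⟩
    · rw [mul_smul_comm, h2, smul_smul, inv_mul_cancel₀ hdt, one_smul]
    · rw [smul_mul_assoc, h1, smul_smul, inv_mul_cancel₀ hdt, one_smul]
  have hdt₀ : d t₀ = 0 := by
    by_contra h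
    exact (isUnit_one_sub_inv_smul_iff hμ).mp (hunit t₀ htb h) hspec
  have hdan : AnalyticOnNhd ℂ d (ball 0 r) := hd.analyticOnNhd isOpen_ball
  have hnz : ¬ ∀ᶠ t in 𝓝 t₀, d t = 0 := by
    intro h
    have := hdan.eqOn_zero_of_preconnected_of_eventuallyEq_zero
      (convex_ball (0 : ℂ) r).isPreconnected htb h (mem_ball_self hr0)
    rw [hd0] at this
    exact one_ne_zero this
  refine ⟨?_, ?_, ?_⟩
  · obtain ⟨x, hx, hx0⟩ := hker hdt₀
    refine isEigenvalue_iff.mpr ⟨x, hx, ?_⟩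
    rw [sub_apply, smul_apply, one_apply_eq_self, sub_eq_zero] at hx0
    conv_rhs => rw [hx0]
    rw [smul_smul, ht₀, mul_inv_cancel₀ hμ, one_smul]
  · have h1 : ∀ᶠ t in 𝓝[≠] t₀, d t ≠ 0 :=
      ((hdan t₀ htb).eventually_eq_zero_or_eventually_ne_zero).resolve_left hnz
    have h2 : ∀ᶠ t in 𝓝 t₀, t ∈ ball (0 : ℂ) r ∧ (t ≠ t₀ → d t ≠ 0) :=
      (isOpen_ball.eventually_mem htb).and (eventually_nhdsWithin_iff.mp h1)
    have h3 : ∀ᶠ ν in 𝓝 μ, ν⁻¹ ∈ ball (0 : ℂ) r ∧ (ν⁻¹ ≠ t₀ → d ν⁻¹ ≠ 0) :=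
      (continuousAt_inv₀ hμ).eventually h2
    have h4 : ∀ᶠ ν in 𝓝 μ, ν ≠ 0 := isOpen_ne.eventually_mem hμ
    obtain ⟨ε, hε, hball⟩ := Metric.eventually_nhds_iff.mp (h3.and h4)
    refine ⟨ε, hε, fun ν hν hne => ?_⟩
    by_contra hlt
    obtain ⟨⟨hb, hdν⟩, hν0⟩ := hball (not_le.mp hlt)
    exact (isUnit_one_sub_inv_smul_iff hν0).mp
      (hunit _ hb (hdν fun h => hne (inv_injective h))) hν
  · obtain ⟨m, g, hg, hg0, hdg⟩ :=
      ((hdan t₀ htb).exists_eventuallyEq_pow_smul_nonzero_iff).mpr hnz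
    let T : X →L[ℂ] X := 1 - t₀ • L
    have hstep : ∀ n, m < n → ∀ y, (T ^ n) y = 0 → (T ^ (n - 1)) y = 0 := by
      intro n hn y hy
      let s : ℂ → ℂ := fun t => (t - t₀) / t
      let x : ℂ → X := fun t => ∑ k ∈ Finset.range n, s t ^ (n - 1 - k) • (T ^ k) y
      have hx : ∀ t, t ≠ 0 → (1 - t • L) (x t) = -((t / t₀) * s t ^ n) • y := by
        intro t ht
        have h1 : (1 : X →L[ℂ] X) - t • L = (t / t₀) • (T - s t • 1) := by
          simp only [T, s]
          match_scalars <;> field_simp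
          ring_nf
        have h2 : (T - s t • 1) * (∑ k ∈ Finset.range n, s t ^ (n - 1 - k) • (T ^ k))
            = T ^ n - s t ^ n • 1 := by
          have hc : Commute T (s t • (1 : X →L[ℂ] X)) := (Commute.one_right T).smul_right _
          have := hc.mul_geom_sum₂ n
          rw [smul_pow, one_pow] at this
          rw [← this]
          congr 1
          refine Finset.sum_congr rfl fun k _ => ?_
          rw [smul_pow, one_pow, mul_smul_comm, mul_one]
        have h3 : x t = (∑ k ∈ Finset.range n, s t ^ (n - 1 - k) • (T ^ k)) y := by
          simp [x]
        rw [h1, h3, smul_apply, ← mul_apply_eq_comp, h2, sub_apply, hy, smul_apply,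
          one_apply_eq_self, zero_sub, smul_neg, smul_smul, neg_smul]
      have hev : ∀ᶠ t in 𝓝[≠] t₀,
          (t ^ m * g t) • x t = -((t / t₀) * s t ^ (n - m)) • Q t y := by
        have e1 : ∀ᶠ t in 𝓝[≠] t₀, d t = (t - t₀) ^ m • g t := hdg.filter_mono nhdsWithin_le_nhds
        have e2 : ∀ᶠ t in 𝓝[≠] t₀, t ∈ ball (0 : ℂ) r :=
          (isOpen_ball.eventually_mem htb).filter_mono nhdsWithin_le_nhds
        have e3 : ∀ᶠ t in 𝓝[≠] t₀, t ≠ 0 :=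
          (isOpen_ne.eventually_mem ht₀0).filter_mono nhdsWithin_le_nhds
        filter_upwards [e1, e2, e3, self_mem_nhdsWithin] with t h1 h2 h3 h4
        have hs : s t ≠ 0 := div_ne_zero (sub_ne_zero.mpr h4) h3
        have h5 : d t • x t = -((t / t₀) * s t ^ n) • Q t y := by
          rw [← map_smul, ← hx t h3, ← mul_apply_eq_comp, (hdQ t h2).1, smul_apply,
            one_apply_eq_self]
        have h6 : t - t₀ = s t * t := by simp only [s]; field_simp
        have h7 : s t ^ n = s t ^ m * s t ^ (n - m) := by
          rw [← pow_add]; congr 1; omega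
        rw [h1, h6, h7] at h5
        refine smul_right_injective X (pow_ne_zero m hs) ?_
        simp only [smul_smul]
        convert h5 using 2
        · rw [smul_eq_mul]; ring_nf
        · ring
      have hst : ContinuousAt s t₀ := (continuousAt_id.sub continuousAt_const).div continuousAt_id ht₀0
      have hs0 : s t₀ = 0 := by simp [s]
      have hxc : ContinuousAt x t₀ := by
        refine tendsto_finsetSum _ fun k _ => ?_
        exact ((hst.pow _).smul continuousAt_const)
      have hQc : ContinuousAt (fun t => Q t y) t₀ :=
        ((hQ.continuousAt (isOpen_ball.mem_nhds htb)).clm_apply continuousAt_const)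
      have hl : Tendsto (fun t => (t ^ m * g t) • x t) (𝓝[≠] t₀) (𝓝 ((t₀ ^ m * g t₀) • x t₀)) :=
        (((continuousAt_id.pow m).mul hg.continuousAt).smul hxc).mono_left nhdsWithin_le_nhds
      have hrr : Tendsto (fun t => -((t / t₀) * s t ^ (n - m)) • Q t y) (𝓝[≠] t₀)
          (𝓝 (-((t₀ / t₀) * s t₀ ^ (n - m)) • Q t₀ y)) :=
        (((continuousAt_id.div_const t₀).mul (hst.pow _)).neg.smul hQc).mono_left
          nhdsWithin_le_nhds
      have heq := tendsto_nhds_unique (hl.congr' hev) hrr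
      rw [hs0, zero_pow (by omega), mul_zero, neg_zero, zero_smul] at heq
      have hx0 : x t₀ = 0 := (smul_eq_zero.mp heq).resolve_left
        (mul_ne_zero (pow_ne_zero m ht₀0) hg0)
      have hx1 : x t₀ = (T ^ (n - 1)) y := by
        simp only [x, hs0]
        rw [Finset.sum_eq_single (n - 1)]
        · simp
        · intro k hk hkn
          rw [zero_pow (by rw [Finset.mem_range] at hk; omega), zero_smul]
        · intro h; rw [Finset.mem_range] at h; omega
      rw [← hx1, hx0]
    have hdown : ∀ j y, (T ^ (m + j)) y = 0 → (T ^ m) y = 0 := by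
      intro j
      induction j with
      | zero => intro y hy; exact hy
      | succ j ih =>
        intro y hy
        refine ih y ?_
        have := hstep (m + (j + 1)) (by omega) y hy
        exact this
    have hfin := finiteDimensional_ker_pow (T : Module.End ℂ X) hfred.finite_ker m
    have hTL : (L : Module.End ℂ X) - μ • 1 = (-μ) • (T : Module.End ℂ X) := by
      ext x
      simp [T, smul_sub, smul_smul, ht₀, hμ]
      abel
    have hcoe : ∀ n, ((T : Module.End ℂ X) ^ n) = ((T ^ n : X →L[ℂ] X) : Module.End ℂ X) :=
      fun n => by ext x; simp
    refine Submodule.finiteDimensional_of_le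
      (S₂ := LinearMap.ker ((T : Module.End ℂ X) ^ m)) fun y hy => ?_
    obtain ⟨k, hk⟩ := Module.End.mem_maxGenEigenspace _ _ _ |>.mp hy
    rw [hTL, smul_pow, LinearMap.smul_apply] at hk
    have hk' : (T ^ k) y = 0 := by
      have := (smul_eq_zero.mp hk).resolve_left (pow_ne_zero k (neg_ne_zero.mpr hμ))
      rwa [hcoe] at this
    have hk2 : (T ^ (m + k)) y = 0 := by
      rw [pow_add, mul_apply_eq_comp, hk', map_zero]
    rw [LinearMap.mem_ker, hcoe]
    exact hdown k y hk2

end FiniteMultiplicity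

/-! ### Functions in `H^∞(Π)` and the action of the operators on values -/

section Values

open Filter Topology Metric

theorem isOpen_rightHalfPlane : IsOpen rightHalfPlane :=
  isOpen_lt continuous_const Complex.continuous_re

theorem ne_zero_of_mem {z : ℂ} (hz : z ∈ rightHalfPlane) : z ≠ 0 := by
  rintro rfl
  exact lt_irrefl (0 : ℝ) hz

theorem one_mem_rightHalfPlane : (1 : ℂ) ∈ rightHalfPlane := by
  change 0 < (1 : ℂ).re
  simp

theorem ofReal_mem {x : ℝ} (hx : 0 < x) : (x : ℂ) ∈ rightHalfPlane := by
  change 0 < (x : ℂ).re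
  simpa using hx

theorem mem_slitPlane_of_mem {z : ℂ} (hz : z ∈ rightHalfPlane) : z ∈ Complex.slitPlane :=
  Or.inl hz

/-- The value at `z` of `f ∈ H^∞(Π)`, extended by `0` outside `Π`. -/
def ev (f : HInf) (z : ℂ) : ℂ := by
  classical
  exact if h : z ∈ rightHalfPlane then f.1 ⟨z, h⟩ else 0

theorem ev_of_mem (f : HInf) {z : ℂ} (hz : z ∈ rightHalfPlane) : ev f z = f.1 ⟨z, hz⟩ := by
  simp [ev, hz]

theorem ev_of_notMem (f : HInf) {z : ℂ} (hz : z ∉ rightHalfPlane) : ev f z = 0 := by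
  simp [ev, hz]

theorem ev_differentiableOn (f : HInf) : DifferentiableOn ℂ (ev f) rightHalfPlane := by
  obtain ⟨F, hF, hf⟩ := f.2
  exact hF.congr fun z hz => by rw [ev_of_mem f hz, hf]

theorem norm_ev_le (f : HInf) (z : ℂ) : ‖ev f z‖ ≤ ‖f‖ := by
  by_cases hz : z ∈ rightHalfPlane
  · rw [ev_of_mem f hz]
    exact f.1.norm_coe_le_norm _
  · rw [ev_of_notMem f hz, norm_zero]
    exact norm_nonneg f

theorem norm_le_of_ev {f : HInf} {C : ℝ} (hC : 0 ≤ C)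
    (h : ∀ z ∈ rightHalfPlane, ‖ev f z‖ ≤ C) : ‖f‖ ≤ C :=
  (BoundedContinuousFunction.norm_le hC).mpr fun z => by
    have := h z z.2
    rwa [ev_of_mem f z.2] at this

theorem ev_ext {f g : HInf} (h : ∀ z ∈ rightHalfPlane, ev f z = ev g z) : f = g := by
  refine Subtype.ext (BoundedContinuousFunction.ext fun z => ?_)
  have := h z z.2
  rwa [ev_of_mem f z.2, ev_of_mem g z.2] at this

theorem ev_mk {F : ℂ → ℂ} {hF : DifferentiableOn ℂ F rightHalfPlane} {C : ℝ}
    {hC : ∀ z ∈ rightHalfPlane, ‖F z‖ ≤ C} {z : ℂ} (hz : z ∈ rightHalfPlane) :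
    ev (HInf.mk F hF C hC) z = F z := by
  rw [ev_of_mem _ hz]; rfl

@[simp] theorem ev_zero (z : ℂ) : ev 0 z = 0 := by
  by_cases hz : z ∈ rightHalfPlane
  · rw [ev_of_mem _ hz]; rfl
  · simp [ev_of_notMem _ hz]

@[simp] theorem ev_add (f g : HInf) (z : ℂ) : ev (f + g) z = ev f z + ev g z := by
  by_cases hz : z ∈ rightHalfPlane
  · simp only [ev_of_mem _ hz]; rfl
  · simp [ev_of_notMem _ hz]

@[simp] theorem ev_sub (f g : HInf) (z : ℂ) : ev (f - g) z = ev f z - ev g z := by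
  by_cases hz : z ∈ rightHalfPlane
  · simp only [ev_of_mem _ hz]; rfl
  · simp [ev_of_notMem _ hz]

@[simp] theorem ev_smul (c : ℂ) (f : HInf) (z : ℂ) : ev (c • f) z = c * ev f z := by
  by_cases hz : z ∈ rightHalfPlane
  · simp only [ev_of_mem _ hz]; rfl
  · simp [ev_of_notMem _ hz]

@[simp] theorem ev_sum {ι : Type*} (s : Finset ι) (f : ι → HInf) (z : ℂ) :
    ev (∑ i ∈ s, f i) z = ∑ i ∈ s, ev (f i) z := by
  classical
  induction s using Finset.induction_on with
  | empty => simp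
  | insert i s hi ih => rw [Finset.sum_insert hi, Finset.sum_insert hi, ev_add, ih]

instance : Nontrivial HInf := by
  refine ⟨HInf.mk (fun _ => 1) (differentiableOn_const _) 1 (fun _ _ => by simp), 0, fun h => ?_⟩
  have := congrArg (fun f => ev f 1) h
  simp [ev_mk one_mem_rightHalfPlane] at this

/-- `H^∞(Π)` is complete: a uniform limit of holomorphic functions is holomorphic. -/
instance : CompleteSpace HInf := by
  have hcl : IsClosed (HInf : Set (rightHalfPlane →ᵇ ℂ)) := by
    refine IsSeqClosed.isClosed fun f g hf hg => ?_
    classical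
    refine ⟨fun z => if h : z ∈ rightHalfPlane then g ⟨z, h⟩ else 0, ?_, fun z => by simp⟩
    refine TendstoLocallyUniformlyOn.differentiableOn (φ := atTop)
      (F := fun n z => ev ⟨f n, hf n⟩ z) ?_
      (Eventually.of_forall fun n => ev_differentiableOn _) isOpen_rightHalfPlane
    refine TendstoUniformlyOn.tendstoLocallyUniformlyOn ?_
    rw [Metric.tendstoUniformlyOn_iff]
    intro ε hε
    filter_upwards [Metric.tendsto_nhds.mp hg ε hε] with n hn z hz
    rw [ev_of_mem _ hz, dif_pos hz, dist_comm]
    exact (BoundedContinuousFunction.dist_coe_le_dist _).trans_lt hn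
  exact hcl.completeSpace_coe

theorem ev_weightedComp (w : HInf) (φ : ℂ → ℂ) (hφ : DifferentiableOn ℂ φ rightHalfPlane)
    (hm : Set.MapsTo φ rightHalfPlane rightHalfPlane) (f : HInf) {z : ℂ}
    (hz : z ∈ rightHalfPlane) : ev (weightedComp w φ hφ hm f) z = ev w z * ev f (φ z) := by
  rw [ev_of_mem _ hz, weightedComp_apply w φ hφ hm f ⟨z, hz⟩, ev_of_mem w hz, ev_of_mem f (hm hz)]

theorem norm_weightedComp_le (w : HInf) (φ : ℂ → ℂ) (hφ : DifferentiableOn ℂ φ rightHalfPlane)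
    (hm : Set.MapsTo φ rightHalfPlane rightHalfPlane) : ‖weightedComp w φ hφ hm‖ ≤ ‖w‖ :=
  LinearMap.mkContinuous_norm_le _ (norm_nonneg _) _

theorem ev_weight (β : ℝ≥0) {z : ℂ} (hz : z ∈ rightHalfPlane) :
    ev (weight β) z = 1 / (1 + z) ^ ((2 * (β : ℝ) : ℝ) : ℂ) := ev_mk hz

theorem ev_Lup (β : ℝ≥0) (f : HInf) {z : ℂ} (hz : z ∈ rightHalfPlane) :
    ev (Lup β f) z = 1 / (1 + z) ^ ((2 * (β : ℝ) : ℝ) : ℂ) * ev f (z / (1 + z)) := by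
  rw [Lup, ev_weightedComp _ _ _ _ _ hz, ev_weight β hz]

theorem ev_Ldown (f : HInf) {z : ℂ} (hz : z ∈ rightHalfPlane) :
    ev (Ldown f) z = ev f (1 + z) := by
  rw [Ldown, ev_weightedComp _ _ _ _ _ hz, ev_mk hz, one_mul]

theorem ev_LdownFlip (β : ℝ≥0) (f : HInf) {z : ℂ} (hz : z ∈ rightHalfPlane) :
    ev (LdownFlip β f) z = 1 / (1 + z) ^ ((2 * (β : ℝ) : ℝ) : ℂ) * ev f (1 / (1 + z)) := by
  rw [LdownFlip, ev_weightedComp _ _ _ _ _ hz, ev_weight β hz]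

theorem ev_L (β : ℝ≥0) (h : ℝ) (f : HInf) {z : ℂ} (hz : z ∈ rightHalfPlane) :
    ev (L β h f) z = Real.exp (-(β * h)) *
      (1 / (1 + z) ^ ((2 * (β : ℝ) : ℝ) : ℂ) * ev f (z / (1 + z))) +
      Real.exp (β * h) * ev f (1 + z) := by
  rw [L, add_apply, ev_add, smul_apply, smul_apply, ev_smul, ev_smul, ev_Lup β f hz, ev_Ldown f hz]

theorem one_le_norm_one_add {z : ℂ} (hz : z ∈ rightHalfPlane) : 1 ≤ ‖1 + z‖ := by
  have hz' : 0 < z.re := hz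
  refine le_trans ?_ (Complex.re_le_norm (1 + z))
  simp only [Complex.add_re, Complex.one_re]
  linarith

theorem norm_weight_le (β : ℝ≥0) : ‖weight β‖ ≤ 1 := by
  refine norm_le_of_ev zero_le_one fun z hz => ?_
  rw [ev_weight β hz, norm_div, norm_one, Complex.norm_cpow_real]
  exact div_le_one_of_le₀ (Real.one_le_rpow (one_le_norm_one_add hz) (by positivity))
    (by positivity)

theorem norm_Lup_le (β : ℝ≥0) : ‖Lup β‖ ≤ 1 :=
  (norm_weightedComp_le _ _ _ _).trans (norm_weight_le β)

theorem norm_Ldown_le : ‖Ldown‖ ≤ 1 :=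
  (norm_weightedComp_le _ _ _ _).trans
    (norm_le_of_ev zero_le_one fun z hz => by rw [ev_mk hz, norm_one])

end Values

/-! ### Weighted composition operators with relatively compact image -/

section Taylor

open Filter Topology Metric

theorem iteratedDeriv_ev_linear (k : ℕ) {c : ℂ} (hc : c ∈ rightHalfPlane) :
    (∀ f g : HInf, iteratedDeriv k (ev (f + g)) c
      = iteratedDeriv k (ev f) c + iteratedDeriv k (ev g) c) ∧
    (∀ (a : ℂ) (f : HInf), iteratedDeriv k (ev (a • f)) c = a * iteratedDeriv k (ev f) c) := by
  have han : ∀ f : HInf, ContDiffAt ℂ k (ev f) c := fun f =>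
    ((ev_differentiableOn f).analyticAt (isOpen_rightHalfPlane.mem_nhds hc)).contDiffAt
  constructor
  · intro f g
    have : ev (f + g) = ev f + ev g := by funext z; simp
    rw [this, iteratedDeriv_add (han f) (han g)]
  · intro a f
    have : ev (a • f) = fun z => a * ev f z := by funext z; simp
    rw [this, iteratedDeriv_const_mul _ (han f)]

theorem norm_iteratedDeriv_ev_le (f : HInf) (k : ℕ) {c : ℂ} {R : ℝ} (hR : 0 < R)
    (hcR : closedBall c R ⊆ rightHalfPlane) :
    ‖iteratedDeriv k (ev f) c‖ ≤ k.factorial * ‖f‖ / R ^ k := by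
  refine Complex.norm_iteratedDeriv_le_of_forall_mem_sphere_norm_le k hR ?_
    (fun z _ => norm_ev_le f z)
  refine DifferentiableOn.diffContOnCl ?_
  refine (ev_differentiableOn f).mono ?_
  rw [closure_ball c hR.ne']
  exact hcR

/-- The `k`-th Taylor coefficient at `c`, as a bounded functional on `H^∞(Π)`. -/
def taylorCoeff (c : ℂ) (R : ℝ) (hR : 0 < R) (hcR : closedBall c R ⊆ rightHalfPlane) (k : ℕ) :
    HInf →L[ℂ] ℂ :=
  LinearMap.mkContinuous
    { toFun := fun f => (k.factorial : ℂ)⁻¹ * iteratedDeriv k (ev f) c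
      map_add' := fun f g => by
        rw [(iteratedDeriv_ev_linear k (hcR (mem_closedBall_self hR.le))).1, mul_add]
      map_smul' := fun a f => by
        rw [(iteratedDeriv_ev_linear k (hcR (mem_closedBall_self hR.le))).2]
        simp only [RingHom.id_apply, smul_eq_mul]; ring }
    ((R ^ k)⁻¹) (fun f => by
      have h := norm_iteratedDeriv_ev_le f k hR hcR
      have hk : (0 : ℝ) < k.factorial := by positivity
      simp only [LinearMap.coe_mk, AddHom.coe_mk, norm_mul, norm_inv, Complex.norm_natCast]
      rw [inv_mul_le_iff₀ hk]
      calc _ ≤ _ := h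
        _ = _ := by ring)

theorem taylorCoeff_apply (c : ℂ) (R : ℝ) (hR : 0 < R) (hcR : closedBall c R ⊆ rightHalfPlane)
    (k : ℕ) (f : HInf) :
    taylorCoeff c R hR hcR k f = (k.factorial : ℂ)⁻¹ * iteratedDeriv k (ev f) c := rfl

theorem norm_taylorCoeff_le {c : ℂ} {R : ℝ} (hR : 0 < R) (hcR : closedBall c R ⊆ rightHalfPlane)
    (k : ℕ) (f : HInf) : ‖taylorCoeff c R hR hcR k f‖ ≤ (R ^ k)⁻¹ * ‖f‖ :=
  ((taylorCoeff c R hR hcR k).le_opNorm f).trans (mul_le_mul_of_nonneg_right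
    (LinearMap.mkContinuous_norm_le _ (by positivity) _) (norm_nonneg f))

theorem hasSum_taylorCoeff {c : ℂ} {R : ℝ} (hR : 0 < R) (hcR : closedBall c R ⊆ rightHalfPlane)
    (f : HInf) {z : ℂ} (hz : z ∈ ball c R) :
    HasSum (fun k => taylorCoeff c R hR hcR k f * (z - c) ^ k) (ev f z) := by
  have := Complex.hasSum_taylorSeries_on_ball (r := R)
    ((ev_differentiableOn f).mono (ball_subset_closedBall.trans hcR)) hz
  refine this.congr_fun fun k => ?_
  rw [taylorCoeff_apply, smul_eq_mul, smul_eq_mul]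
  ring

/-- A weighted composition operator whose symbol maps `Π` into a closed disc inside `Π` is a limit
of operators of finite rank: truncate the Taylor series at the centre of the disc. -/
theorem finiteRankApproximable_weightedComp (w : HInf) (φ : ℂ → ℂ)
    (hφ : DifferentiableOn ℂ φ rightHalfPlane) (hm : Set.MapsTo φ rightHalfPlane rightHalfPlane)
    {c : ℂ} {r R : ℝ} (hr0 : 0 ≤ r) (hrR : r < R) (hcR : closedBall c R ⊆ rightHalfPlane)
    (hφr : ∀ z ∈ rightHalfPlane, ‖φ z - c‖ ≤ r) :
    FiniteRankApproximable (weightedComp w φ hφ hm) := by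
  intro ε hε
  have hR : 0 < R := hr0.trans_lt hrR
  have hq1 : r / R < 1 := (div_lt_one hR).mpr hrR
  have hq0 : 0 ≤ r / R := by positivity
  obtain ⟨n, hn⟩ : ∃ n : ℕ, ‖w‖ * ((r / R) ^ n / (1 - r / R)) ≤ ε := by
    have h1 : Tendsto (fun n : ℕ => ‖w‖ * ((r / R) ^ n / (1 - r / R))) atTop
        (𝓝 (‖w‖ * (0 / (1 - r / R)))) :=
      ((tendsto_pow_atTop_nhds_zero_of_lt_one hq0 hq1).div_const _).const_mul _
    rw [zero_div, mul_zero] at h1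
    exact (h1.eventually_le_const hε).exists
  let e : ℕ → HInf := fun k => HInf.mk (fun z => ev w z * (φ z - c) ^ k)
    ((ev_differentiableOn w).mul ((hφ.sub_const c).pow k)) (‖w‖ * r ^ k) (fun z hz => by
      rw [norm_mul, norm_pow]
      gcongr
      · exact norm_ev_le w z
      · exact hφr z hz)
  let Φ : HInf →L[ℂ] (Fin n → ℂ) := ContinuousLinearMap.pi fun k => taylorCoeff c R hR hcR k
  let V : (Fin n → ℂ) →L[ℂ] HInf :=
    ∑ k : Fin n, (ContinuousLinearMap.proj (R := ℂ) (φ := fun _ : Fin n => ℂ) k).smulRight (e k)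
  refine ⟨n, Φ, V, ContinuousLinearMap.opNorm_le_bound _ hε.le fun f => ?_⟩
  refine norm_le_of_ev (by positivity) fun z hz => ?_
  have h1 : ev (V (Φ f)) z
      = ev w z * ∑ k ∈ Finset.range n, taylorCoeff c R hR hcR k f * (φ z - c) ^ k := by
    simp only [V, Φ, sum_apply, ContinuousLinearMap.smulRight_apply,
      ContinuousLinearMap.proj_apply, ContinuousLinearMap.coe_pi', ev_sum, ev_smul, e, ev_mk hz]
    rw [Finset.mul_sum, ← Fin.sum_univ_eq_sum_range
      (fun k => ev w z * (taylorCoeff c R hR hcR k f * (φ z - c) ^ k)) n]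
    exact Finset.sum_congr rfl fun k _ => by ring
  have hb : φ z ∈ ball c R := by
    rw [mem_ball, dist_eq_norm]
    exact (hφr z hz).trans_lt hrR
  have h2 := norm_sub_le_of_geometric_bound_of_hasSum (r := r / R) (C := ‖f‖) hq1 (fun k => by
    rw [norm_mul, norm_pow, div_pow]
    calc ‖taylorCoeff c R hR hcR k f‖ * ‖φ z - c‖ ^ k ≤ ((R ^ k)⁻¹ * ‖f‖) * r ^ k := by
          gcongr
          · exact norm_taylorCoeff_le hR hcR k f
          · exact hφr z hz
      _ = ‖f‖ * (r ^ k / R ^ k) := by ring) (hasSum_taylorCoeff hR hcR f hb) n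
  rw [sub_apply, ev_sub, ev_weightedComp _ _ _ _ _ hz, ContinuousLinearMap.comp_apply, h1,
    ← mul_sub, norm_mul, norm_sub_rev]
  calc _ ≤ ‖w‖ * (‖f‖ * (r / R) ^ n / (1 - r / R)) := by
        gcongr
        exact norm_ev_le w z
    _ = ‖w‖ * ((r / R) ^ n / (1 - r / R)) * ‖f‖ := by ring
    _ ≤ ε * ‖f‖ := by gcongr

theorem closedBall_subset_rightHalfPlane {c R : ℝ} (h : R < c) :
    closedBall (c : ℂ) R ⊆ rightHalfPlane := by
  intro z hz
  have h1 : |(z - c).re| ≤ R :=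
    (Complex.abs_re_le_norm _).trans (by rwa [mem_closedBall, dist_eq_norm] at hz)
  rw [Complex.sub_re, Complex.ofReal_re, abs_le] at h1
  change 0 < z.re
  linarith [h1.1]

/-- `1 / (1 + z)` lies in the disc with diameter `[0, 1]`. -/
theorem norm_inv_one_add_sub_half_le {z : ℂ} (hz : z ∈ rightHalfPlane) :
    ‖1 / (1 + z) - 1 / 2‖ ≤ 1 / 2 := by
  have h0 := one_add_ne_zero hz
  have hz' : 0 < z.re := hz
  have : 1 / (1 + z) - 1 / 2 = (1 - z) / (2 * (1 + z)) := by field_simp; ring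
  rw [this, norm_div, norm_mul, Complex.norm_ofNat,
    div_le_div_iff₀ (by positivity) (by norm_num), one_mul]
  have h1 : ‖1 - z‖ ≤ ‖1 + z‖ := by
    rw [← abs_of_nonneg (norm_nonneg (1 - z)), ← abs_of_nonneg (norm_nonneg (1 + z)), ← sq_le_sq,
      Complex.sq_norm, Complex.sq_norm, Complex.normSq_apply, Complex.normSq_apply]
    simp only [Complex.sub_re, Complex.add_re, Complex.one_re, Complex.sub_im, Complex.add_im,
      Complex.one_im]
    nlinarith
  linarith

/-- Principal powers are multiplicative on `Π`, where arguments lie in `(-π/2, π/2)`. -/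
theorem mul_cpow_of_mem {z w : ℂ} (hz : z ∈ rightHalfPlane) (hw : w ∈ rightHalfPlane) (s : ℂ) :
    (z * w) ^ s = z ^ s * w ^ s := by
  have hz0 := ne_zero_of_mem hz
  have hw0 := ne_zero_of_mem hw
  have h1 := abs_lt.mp (Complex.abs_arg_lt_pi_div_two_iff.mpr (Or.inl hz))
  have h2 := abs_lt.mp (Complex.abs_arg_lt_pi_div_two_iff.mpr (Or.inl hw))
  rw [Complex.cpow_def_of_ne_zero (mul_ne_zero hz0 hw0), Complex.cpow_def_of_ne_zero hz0,
    Complex.cpow_def_of_ne_zero hw0,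
    (Complex.log_mul_eq_add_log_iff hz0 hw0).mpr ⟨by linarith, by linarith⟩, add_mul,
    Complex.exp_add]

theorem inv_cpow_of_mem {z : ℂ} (hz : z ∈ rightHalfPlane) (s : ℂ) :
    (1 / z) ^ s = 1 / z ^ s := by
  have h := abs_lt.mp (Complex.abs_arg_lt_pi_div_two_iff.mpr (Or.inl hz))
  rw [one_div, one_div, Complex.inv_cpow _ _ (by linarith [h.2, Real.pi_pos])]

theorem cpow_ne_zero_of_mem {z : ℂ} (hz : z ∈ rightHalfPlane) (s : ℂ) : z ^ s ≠ 0 := by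
  rw [Complex.cpow_def_of_ne_zero (ne_zero_of_mem hz)]
  exact Complex.exp_ne_zero _

end Taylor

/-! ### Compactness of the mixed products -/

section Mixed

open Metric

/-- `L↑ L↓ f (z) = (1 + z)^{-2β} f(1 + z / (1 + z))`. -/
theorem finiteRankApproximable_Lup_mul_Ldown (β : ℝ≥0) :
    FiniteRankApproximable (Lup β * Ldown) := by
  have hd : DifferentiableOn ℂ (fun z : ℂ => 1 + z / (1 + z)) rightHalfPlane :=
    (differentiableOn_const _).add (differentiableOn_id.div
      ((differentiableOn_const _).add differentiableOn_id) fun _ hz => one_add_ne_zero hz)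
  have hm : Set.MapsTo (fun z : ℂ => 1 + z / (1 + z)) rightHalfPlane rightHalfPlane :=
    fun z hz => one_add_mem (upMap_mem hz)
  have h := finiteRankApproximable_weightedComp (weight β) _ hd hm (c := ((3 / 2 : ℝ) : ℂ))
    (r := 1 / 2) (R := 1) (by norm_num) (by norm_num)
    (closedBall_subset_rightHalfPlane (by norm_num)) (fun z hz => by
      have h0 := one_add_ne_zero hz
      have : 1 + z / (1 + z) - ((3 / 2 : ℝ) : ℂ) = -(1 / (1 + z) - 1 / 2) := by
        push_cast; field_simp; ring
      rw [this, norm_neg]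
      exact norm_inv_one_add_sub_half_le hz)
  convert h using 1
  ext1 f
  refine ev_ext fun z hz => ?_
  rw [mul_apply_eq_comp, ev_Lup β _ hz, ev_Ldown _ (upMap_mem hz), ev_weightedComp _ _ hd hm _ hz,
    ev_weight β hz]

/-- `L↓S L↓ f (z) = (1 + z)^{-2β} f(1 + 1 / (1 + z))`. -/
theorem finiteRankApproximable_LdownFlip_mul_Ldown (β : ℝ≥0) :
    FiniteRankApproximable (LdownFlip β * Ldown) := by
  have hd : DifferentiableOn ℂ (fun z : ℂ => 1 + 1 / (1 + z)) rightHalfPlane :=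
    (differentiableOn_const _).add ((differentiableOn_const _).div
      ((differentiableOn_const _).add differentiableOn_id) fun _ hz => one_add_ne_zero hz)
  have hm : Set.MapsTo (fun z : ℂ => 1 + 1 / (1 + z)) rightHalfPlane rightHalfPlane :=
    fun z hz => one_add_mem (inv_mem (one_add_mem hz))
  have h := finiteRankApproximable_weightedComp (weight β) _ hd hm (c := ((3 / 2 : ℝ) : ℂ))
    (r := 1 / 2) (R := 1) (by norm_num) (by norm_num)
    (closedBall_subset_rightHalfPlane (by norm_num)) (fun z hz => by
      have : 1 + 1 / (1 + z) - ((3 / 2 : ℝ) : ℂ) = 1 / (1 + z) - 1 / 2 := by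
        push_cast; ring
      rw [this]
      exact norm_inv_one_add_sub_half_le hz)
  convert h using 1
  ext1 f
  refine ev_ext fun z hz => ?_
  rw [mul_apply_eq_comp, ev_LdownFlip β _ hz, ev_Ldown _ (inv_mem (one_add_mem hz)),
    ev_weightedComp _ _ hd hm _ hz, ev_weight β hz]

/-- `(L↓S)² f (z) = (2 + z)^{-2β} f((1 + z) / (2 + z))`, and the image of `Π` under
`z ↦ (1 + z) / (2 + z)` is the disc with diameter `(1/2, 1)`. -/
theorem finiteRankApproximable_LdownFlip_sq (β : ℝ≥0) :
    FiniteRankApproximable (LdownFlip β * LdownFlip β) := by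
  have hd : DifferentiableOn ℂ (fun z : ℂ => 1 / (1 + 1 / (1 + z))) rightHalfPlane :=
    (differentiableOn_const _).div ((differentiableOn_const _).add ((differentiableOn_const _).div
      ((differentiableOn_const _).add differentiableOn_id) fun _ hz => one_add_ne_zero hz))
      fun z hz => one_add_ne_zero (inv_mem (one_add_mem hz))
  have hm : Set.MapsTo (fun z : ℂ => 1 / (1 + 1 / (1 + z))) rightHalfPlane rightHalfPlane :=
    fun z hz => inv_mem (one_add_mem (inv_mem (one_add_mem hz)))
  have h := finiteRankApproximable_weightedComp (LdownFlip β (weight β)) _ hd hm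
    (c := ((3 / 4 : ℝ) : ℂ))
    (r := 1 / 4) (R := 1 / 2) (by norm_num) (by norm_num)
    (closedBall_subset_rightHalfPlane (by norm_num)) (fun z hz => by
      have h0 := one_add_ne_zero hz
      have h1 : 1 + (1 + z) ≠ 0 := one_add_ne_zero (one_add_mem hz)
      have h2 : (2 + z) ≠ 0 := by convert h1 using 1; ring
      have hz' : 0 < z.re := hz
      have e1 : 1 / (1 + 1 / (1 + z)) = (1 + z) / (2 + z) := by
        rw [div_eq_div_iff (one_add_ne_zero (inv_mem (one_add_mem hz))) h2]
        field_simp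
        ring
      have e2 : 1 / (1 + 1 / (1 + z)) - ((3 / 4 : ℝ) : ℂ) = (z - 2) / (4 * (2 + z)) := by
        rw [e1]; push_cast; field_simp; ring
      rw [e2, norm_div, norm_mul, Complex.norm_ofNat,
        div_le_div_iff₀ (by positivity) (by norm_num), one_mul]
      have h1 : ‖z - 2‖ ≤ ‖2 + z‖ := by
        rw [← abs_of_nonneg (norm_nonneg (z - 2)), ← abs_of_nonneg (norm_nonneg (2 + z)),
          ← sq_le_sq, Complex.sq_norm, Complex.sq_norm, Complex.normSq_apply,
          Complex.normSq_apply]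
        simp only [Complex.sub_re, Complex.add_re, Complex.re_ofNat, Complex.sub_im,
          Complex.add_im, Complex.im_ofNat]
        nlinarith
      linarith)
  convert h using 1
  ext1 f
  refine ev_ext fun z hz => ?_
  have hz1 := inv_mem (one_add_mem hz)
  rw [mul_apply_eq_comp, ev_LdownFlip β _ hz, ev_LdownFlip β _ hz1,
    ev_weightedComp _ _ hd hm _ hz, ev_LdownFlip β _ hz, ev_weight β hz1, mul_assoc]

end Mixed

/-! ### The spectral radius of a positive operator -/

section SpectralRadius

open Filter Topology Metric

theorem hasSum_inverse_one_sub_smul {A : Type*} [NormedRing A] [NormedAlgebra ℂ A]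
    [CompleteSpace A] (a : A) {t : ℂ} (ht : (‖t‖₊ : ℝ≥0∞) < (spectralRadius ℂ a)⁻¹) :
    HasSum (fun n : ℕ => t ^ n • a ^ n) (Ring.inverse (1 - t • a)) := by
  obtain ⟨r, h1, h2⟩ := ENNReal.lt_iff_exists_nnreal_btwn.mp ht
  have hr : 0 < r := lt_of_le_of_lt (by positivity) (ENNReal.coe_lt_coe.mp h1)
  have H₁ := (spectrum.differentiableOn_inverse_one_sub_smul h2).hasFPowerSeriesOnBall hr
  have H₂ := (spectrum.hasFPowerSeriesOnBall_inverse_one_sub_smul ℂ a).exchange_radius H₁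
  have := H₂.hasSum (y := t) (by rwa [mem_eball_zero_iff])
  simpa using this

/-- The Neumann series turns a domination of powers into a domination of the resolvent. -/
theorem norm_map_inverse_one_sub_smul_le {A : Type*} [NormedRing A] [NormedAlgebra ℂ A]
    [CompleteSpace A] (a : A) {t : ℂ} (ht : (‖t‖₊ : ℝ≥0∞) < (spectralRadius ℂ a)⁻¹)
    (φ ψ : A →L[ℂ] ℂ) {N : ℝ} {c : ℕ → ℝ} (hφ : ∀ n, ‖φ (a ^ n)‖ ≤ N * c n)
    (hψ : ∀ n, ψ (a ^ n) = c n) :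
    ‖φ (Ring.inverse (1 - t • a))‖ ≤ N * (ψ (Ring.inverse (1 - (‖t‖ : ℂ) • a))).re := by
  have ht' : (‖(‖t‖ : ℂ)‖₊ : ℝ≥0∞) < (spectralRadius ℂ a)⁻¹ := by
    rwa [Complex.nnnorm_real, nnnorm_norm]
  have h1 := (hasSum_inverse_one_sub_smul a ht).mapL φ
  have h2 := (hasSum_inverse_one_sub_smul a ht').mapL ψ
  have h3 : HasSum (fun n : ℕ => ‖t‖ ^ n * c n) (ψ (Ring.inverse (1 - (‖t‖ : ℂ) • a))).re := by
    convert Complex.hasSum_re h2 using 2 with n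
    rw [map_smul, hψ, smul_eq_mul, ← Complex.ofReal_pow, ← Complex.ofReal_mul, Complex.ofReal_re]
  rw [← h1.tsum_eq]
  refine tsum_of_norm_bounded (h3.mul_left N) fun n => ?_
  rw [map_smul, smul_eq_mul, norm_mul, norm_pow]
  calc _ ≤ ‖t‖ ^ n * (N * c n) := mul_le_mul_of_nonneg_left (hφ n) (by positivity)
    _ = _ := by ring

theorem norm_map_inverse_one_sub_smul_apply_le {X : Type*} [NormedAddCommGroup X]
    [NormedSpace ℂ X] [CompleteSpace X] (T : X →L[ℂ] X) {t : ℂ}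
    (ht : (‖t‖₊ : ℝ≥0∞) < (spectralRadius ℂ T)⁻¹) (φ ψ : X →L[ℂ] ℂ) (x y : X) {N : ℝ}
    {c : ℕ → ℝ} (hφ : ∀ n, ‖φ ((T ^ n) x)‖ ≤ N * c n) (hψ : ∀ n, ψ ((T ^ n) y) = c n) :
    ‖φ (Ring.inverse (1 - t • T) x)‖ ≤ N * (ψ (Ring.inverse (1 - (‖t‖ : ℂ) • T) y)).re :=
  norm_map_inverse_one_sub_smul_le T ht
    (φ ∘L ContinuousLinearMap.apply ℂ X x) (ψ ∘L ContinuousLinearMap.apply ℂ X y) hφ hψ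

/-- If the resolvent is dominated by its values on the positive axis, then the spectral radius
belongs to the spectrum. -/
theorem spectralRadius_mem_spectrum {A : Type*} [NormedRing A] [NormedAlgebra ℂ A]
    [CompleteSpace A] [Nontrivial A] (a : A) (hpos : 0 < spectralRadius ℂ a)
    (hdom : ∀ t : ℂ, (‖t‖₊ : ℝ≥0∞) < (spectralRadius ℂ a)⁻¹ →
      ‖Ring.inverse (1 - t • a)‖ ≤ ‖Ring.inverse (1 - (‖t‖ : ℂ) • a)‖) :
    ((spectralRadius ℂ a).toReal : ℂ) ∈ spectrum ℂ a := by
  obtain ⟨l, hl, hlr⟩ := spectrum.exists_nnnorm_eq_spectralRadius a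
  have hr : (spectralRadius ℂ a).toReal = ‖l‖ := by
    rw [← hlr]; simp
  have hl0 : l ≠ 0 := by
    rintro rfl
    rw [← hlr] at hpos
    simp at hpos
  have hln : 0 < ‖l‖ := norm_pos_iff.mpr hl0
  rw [hr]
  by_contra hns
  have key : ∀ μ : ℂ, μ ≠ 0 → (IsUnit (1 - μ⁻¹ • a) ↔ μ ∉ spectrum ℂ a) := by
    intro μ hμ
    have : algebraMap ℂ A μ - a = μ • (1 - μ⁻¹ • a) := by
      rw [smul_sub, smul_smul, mul_inv_cancel₀ hμ, one_smul, Algebra.algebraMap_eq_smul_one]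
    rw [spectrum.notMem_iff, this]
    exact (isUnit_smul_iff (Units.mk0 μ hμ) (1 - μ⁻¹ • a)).symm
  have hu := (key (‖l‖ : ℂ) (by simpa using hl0)).mpr hns
  let R : ℂ → A := fun t => Ring.inverse (1 - t • a)
  have hRc : ContinuousAt R ((‖l‖ : ℂ)⁻¹) := by
    have h1 : ContinuousAt Ring.inverse (1 - (‖l‖ : ℂ)⁻¹ • a) :=
      (differentiableAt_inverse (𝕜 := ℂ) hu).continuousAt
    exact ContinuousAt.comp (f := fun t : ℂ => 1 - t • a) h1 (by fun_prop)
  let q : ℕ → ℝ := fun k => 1 - 1 / ((k : ℝ) + 1)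
  have hq : Tendsto q atTop (𝓝 1) := by
    have := (tendsto_one_div_add_atTop_nhds_zero_nat (𝕜 := ℝ)).const_sub 1
    rwa [sub_zero] at this
  have hq0 : ∀ k, 0 ≤ q k := fun k => by
    simp only [q, sub_nonneg]
    rw [div_le_one (by positivity)]
    linarith [(Nat.cast_nonneg k : (0 : ℝ) ≤ k)]
  have hq1 : ∀ k, q k < 1 := fun k => by
    simp only [q]
    have : (0 : ℝ) < 1 / ((k : ℝ) + 1) := by positivity
    linarith
  have hcont : Tendsto (fun k => ‖R ((q k : ℂ) * (‖l‖ : ℂ)⁻¹)‖) atTop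
      (𝓝 ‖R ((‖l‖ : ℂ)⁻¹)‖) := by
    refine (hRc.tendsto.comp ?_).norm
    have h2 : Tendsto (fun k => ((q k : ℝ) : ℂ) * (‖l‖ : ℂ)⁻¹) atTop
        (𝓝 (((1 : ℝ) : ℂ) * (‖l‖ : ℂ)⁻¹)) :=
      ((Complex.continuous_ofReal.tendsto 1).comp hq).mul_const _
    simpa using h2
  set C := ‖R ((‖l‖ : ℂ)⁻¹)‖ with hC
  have h3 : ∀ᶠ k in atTop, ‖R ((q k : ℂ) * (‖l‖ : ℂ)⁻¹)‖ < C + 1 :=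
    hcont.eventually_lt_const (by linarith)
  have h4 : ∀ᶠ k in atTop, (1 - q k) * ‖l‖⁻¹ * ((C + 1) * ‖a‖) < 1 := by
    have : Tendsto (fun k => (1 - q k) * ‖l‖⁻¹ * ((C + 1) * ‖a‖)) atTop
        (𝓝 ((1 - 1) * ‖l‖⁻¹ * ((C + 1) * ‖a‖))) :=
      ((hq.const_sub 1).mul_const _).mul_const _
    rw [sub_self, zero_mul, zero_mul] at this
    exact this.eventually_lt_const one_pos
  obtain ⟨k, hk3, hk4⟩ := (h3.and h4).exists
  -- the resolvent at the points `q k / l` is bounded, so `1 - l⁻¹a` is invertible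
  set t : ℂ := (q k : ℂ) * l⁻¹ with ht
  have htn : ‖t‖ = q k * ‖l‖⁻¹ := by
    rw [ht, norm_mul, norm_inv, Complex.norm_real, Real.norm_of_nonneg (hq0 k)]
  have htr : (‖t‖₊ : ℝ≥0∞) < (spectralRadius ℂ a)⁻¹ := by
    rw [← hlr, ← ENNReal.coe_inv (nnnorm_ne_zero_iff.mpr hl0), ENNReal.coe_lt_coe,
      ← NNReal.coe_lt_coe, NNReal.coe_inv, coe_nnnorm, coe_nnnorm, htn]
    exact mul_lt_of_lt_one_left (by positivity) (hq1 k)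
  have hut : IsUnit (1 - t • a) := spectrum.isUnit_one_sub_smul_of_lt_inv_radius htr
  have hRt : ‖R t‖ ≤ C + 1 := by
    refine (hdom t htr).trans (le_of_lt ?_)
    rw [htn]
    push_cast
    exact hk3
  have hfac : 1 - l⁻¹ • a = (1 - t • a) * (1 - (l⁻¹ - t) • (R t * a)) := by
    have h5 : (1 - t • a) * R t = 1 := Ring.mul_inverse_cancel _ hut
    rw [mul_sub, mul_one, mul_smul_comm, ← mul_assoc, h5, one_mul]
    module
  refine (key l hl0).mp ?_ hl
  rw [hfac]
  refine hut.mul (isUnit_one_sub_of_norm_lt_one ?_)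
  have h6 : ‖l⁻¹ - t‖ = (1 - q k) * ‖l‖⁻¹ := by
    have : l⁻¹ - t = ((1 - q k : ℝ) : ℂ) * l⁻¹ := by rw [ht]; push_cast; ring
    rw [this, norm_mul, norm_inv, Complex.norm_real,
      Real.norm_of_nonneg (by linarith [hq1 k])]
  calc ‖(l⁻¹ - t) • (R t * a)‖ ≤ ‖l⁻¹ - t‖ * (‖R t‖ * ‖a‖) := by
        rw [norm_smul]
        gcongr
        exact norm_mul_le _ _
    _ ≤ (1 - q k) * ‖l‖⁻¹ * ((C + 1) * ‖a‖) := by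
        rw [h6]
        have := (hq1 k).le
        gcongr
    _ < 1 := hk4

/-- A boundary point of the spectrum at which the operator is Fredholm is an eigenvalue: otherwise
the operator would be bounded below there, and so would, uniformly, its invertible neighbours. -/
theorem isEigenvalue_of_isFredholm_of_boundary {X : Type*} [NormedAddCommGroup X]
    [NormedSpace ℂ X] [CompleteSpace X] {T : X →L[ℂ] X} {μ : ℂ} (hμ : μ ∈ spectrum ℂ T)
    (hF : ContinuousLinearMap.IsFredholm (algebraMap ℂ (X →L[ℂ] X) μ - T))
    (hbd : ∀ ε > 0, ∃ ν ∉ spectrum ℂ T, ‖ν - μ‖ < ε) : IsEigenvalue T μ := by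
  by_contra hne
  have happ : ∀ ν x, (algebraMap ℂ (X →L[ℂ] X) ν - T) x = ν • x - T x := by
    intro ν x
    rw [sub_apply, Algebra.algebraMap_eq_smul_one, smul_apply, one_apply_eq_self]
  have hinj : Function.Injective (algebraMap ℂ (X →L[ℂ] X) μ - T) := by
    refine (injective_iff_map_eq_zero _).mpr fun x hx => ?_
    by_contra hx0
    refine hne (isEigenvalue_iff.mpr ⟨x, hx0, ?_⟩)
    rw [happ, sub_eq_zero] at hx
    exact hx.symm
  obtain ⟨K, hK⟩ := ContinuousLinearMap.antilipschitz_of_injective_of_isClosed_range _ hinj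
    (by rw [← ContinuousLinearMap.coe_coe, ← LinearMap.coe_range]; exact hF.isClosed_range)
  have hb : ∀ x, ‖x‖ ≤ K * ‖μ • x - T x‖ := by
    intro x
    have := hK.le_mul_dist x 0
    simpa [dist_eq_norm, happ] using this
  obtain ⟨ν, hν, hνμ⟩ := hbd (1 / (4 * ((K : ℝ) + 1))) (by positivity)
  have hK0 : (0 : ℝ) ≤ K := K.2
  have hKν : K * ‖ν - μ‖ ≤ 1 / 4 := by
    have h1 : ((K : ℝ) + 1) * ‖ν - μ‖ ≤ ((K : ℝ) + 1) * (1 / (4 * ((K : ℝ) + 1))) := by gcongr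
    have h2 : ((K : ℝ) + 1) * (1 / (4 * ((K : ℝ) + 1))) = 1 / 4 := by field_simp
    nlinarith [norm_nonneg (ν - μ)]
  have hu := spectrum.notMem_iff.mp hν
  have hbν : ∀ x, ‖x‖ ≤ 2 * K * ‖ν • x - T x‖ := by
    intro x
    have h1 : μ • x - T x = (ν • x - T x) - (ν - μ) • x := by module
    have h2 : ‖μ • x - T x‖ ≤ ‖ν • x - T x‖ + ‖ν - μ‖ * ‖x‖ := by
      rw [h1, ← norm_smul]
      exact norm_sub_le _ _
    have h3 : ‖x‖ ≤ K * ‖ν • x - T x‖ + K * ‖ν - μ‖ * ‖x‖ := by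
      calc ‖x‖ ≤ K * ‖μ • x - T x‖ := hb x
        _ ≤ K * (‖ν • x - T x‖ + ‖ν - μ‖ * ‖x‖) := by gcongr
        _ = _ := by ring
    nlinarith [norm_nonneg x]
  set S := algebraMap ℂ (X →L[ℂ] X) ν - T with hS
  have h5 : S * Ring.inverse S = 1 := Ring.mul_inverse_cancel _ hu
  have hRn : ‖Ring.inverse S‖ ≤ 2 * K := by
    refine ContinuousLinearMap.opNorm_le_bound _ (by positivity) fun y => ?_
    have h6 : S (Ring.inverse S y) = y := congrArg (fun T : X →L[ℂ] X => T y) h5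
    have := hbν (Ring.inverse S y)
    rwa [← happ, h6] at this
  refine hμ ?_
  have hfac : algebraMap ℂ (X →L[ℂ] X) μ - T = S * (1 - (ν - μ) • Ring.inverse S) := by
    rw [mul_sub, mul_one, mul_smul_comm, h5, hS, Algebra.algebraMap_eq_smul_one,
      Algebra.algebraMap_eq_smul_one]
    module
  rw [spectrum.mem_resolventSet_iff, hfac]
  refine hu.mul (isUnit_one_sub_of_norm_lt_one ?_)
  rw [norm_smul]
  calc ‖ν - μ‖ * ‖Ring.inverse S‖ ≤ ‖ν - μ‖ * (2 * K) := by gcongr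
    _ < 1 := by linarith

theorem isEigenvalue_spectralRadius {X : Type*} [NormedAddCommGroup X] [NormedSpace ℂ X]
    [CompleteSpace X] [Nontrivial X] {T : X →L[ℂ] X} (hT : ((spectralRadius ℂ T).toReal : ℂ) ∈ spectrum ℂ T)
    (hr : essSpectralRadius T < spectralRadius ℂ T) :
    IsEigenvalue T ((spectralRadius ℂ T).toReal : ℂ) := by
  have htop : spectralRadius ℂ T ≠ ∞ :=
    ((spectrum.spectralRadius_le_nnnorm (𝕜 := ℂ) T).trans_lt ENNReal.coe_lt_top).ne
  refine isEigenvalue_of_isFredholm_of_boundary hT ?_ ?_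
  · by_contra hF
    refine hr.not_ge ?_
    have h1 : ((spectralRadius ℂ T).toReal : ℂ) ∈ essSpectrum T := hF
    refine le_trans (le_of_eq ?_) (le_iSup₂ (f := fun (μ : ℂ) _ => (‖μ‖₊ : ℝ≥0∞)) _ h1)
    rw [← enorm_eq_nnnorm, ← ofReal_norm, Complex.norm_real,
      Real.norm_of_nonneg ENNReal.toReal_nonneg, ENNReal.ofReal_toReal htop]
  · intro ε hε
    refine ⟨(((spectralRadius ℂ T).toReal + ε / 2 : ℝ) : ℂ), ?_, ?_⟩
    · intro hmem
      have h1 := le_iSup₂ (f := fun (μ : ℂ) (_ : μ ∈ spectrum ℂ T) => (‖μ‖₊ : ℝ≥0∞)) _ hmem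
      have h2 := ENNReal.toReal_mono htop h1
      simp only [ENNReal.coe_toReal, coe_nnnorm, Complex.norm_real, Real.norm_eq_abs] at h2
      have h3 := le_abs_self ((spectralRadius ℂ T).toReal + ε / 2)
      change _ ≤ (spectralRadius ℂ T).toReal at h2
      linarith
    · rw [← Complex.ofReal_sub, Complex.norm_real, add_sub_cancel_left, Real.norm_eq_abs,
        abs_of_pos (by positivity)]
      linarith

end SpectralRadius

/-! ### Positivity of the transfer operator -/

section Positivity

open Filter Topology Metric

/-- The function `x ↦ (Lⁿ 1)(x)` on the positive axis. -/
def iterateOne (β : ℝ≥0) (h : ℝ) : ℕ → ℝ → ℝ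
  | 0 => fun _ => 1
  | n + 1 => fun x => Real.exp (-(β * h)) *
      (((1 + x) ^ (2 * (β : ℝ)))⁻¹ * iterateOne β h n (x / (1 + x))) +
      Real.exp (β * h) * iterateOne β h n (1 + x)

theorem iterateOne_nonneg (β : ℝ≥0) (h : ℝ) (n : ℕ) : ∀ x : ℝ, 0 < x → 0 ≤ iterateOne β h n x := by
  induction n with
  | zero => intro x _; exact zero_le_one
  | succ n ih =>
    intro x hx
    have h1 := ih (x / (1 + x)) (by positivity)
    have h2 := ih (1 + x) (by positivity)
    simp only [iterateOne]
    positivity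

theorem div_one_add_le_div_one_add {x y : ℝ} (hx : 0 < x) (hxy : x ≤ y) :
    x / (1 + x) ≤ y / (1 + y) := by
  rw [div_le_div_iff₀ (by linarith) (by linarith)]
  nlinarith

theorem iterateOne_antitone (β : ℝ≥0) (h : ℝ) (n : ℕ) :
    ∀ x y : ℝ, 0 < x → x ≤ y → iterateOne β h n y ≤ iterateOne β h n x := by
  induction n with
  | zero => intro x y _ _; exact le_rfl
  | succ n ih =>
    intro x y hx hxy
    have hy : 0 < y := hx.trans_le hxy
    have h1 := ih _ _ (by positivity) (div_one_add_le_div_one_add hx hxy)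
    have h2 := ih (1 + x) (1 + y) (by positivity) (by linarith)
    have h3 := iterateOne_nonneg β h n (y / (1 + y)) (by positivity)
    simp only [iterateOne]
    gcongr

/-- The constant function `1`. -/
def one : HInf := HInf.mk (fun _ => 1) (differentiableOn_const _) 1 (fun _ _ => by simp)

theorem ev_one {z : ℂ} (hz : z ∈ rightHalfPlane) : ev one z = 1 := ev_mk hz

theorem norm_one_le : ‖one‖ ≤ 1 :=
  norm_le_of_ev zero_le_one fun z hz => by rw [ev_one hz, norm_one]

theorem ev_L_pow_one (β : ℝ≥0) (h : ℝ) (n : ℕ) :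
    ∀ x : ℝ, 0 < x → ev ((L β h ^ n) one) x = iterateOne β h n x := by
  induction n with
  | zero =>
    intro x hx
    rw [pow_zero, one_apply_eq_self, ev_one (ofReal_mem hx)]
    simp [iterateOne]
  | succ n ih =>
    intro x hx
    rw [pow_succ', mul_apply_eq_comp, ev_L β h _ (ofReal_mem hx)]
    have h1 : (x : ℂ) / (1 + x) = ((x / (1 + x) : ℝ) : ℂ) := by push_cast; rfl
    have h2 : (1 : ℂ) + x = ((1 + x : ℝ) : ℂ) := by push_cast; rfl
    have h3 : ((1 : ℂ) + x) ^ ((2 * (β : ℝ) : ℝ) : ℂ) = (((1 + x) ^ (2 * (β : ℝ)) : ℝ) : ℂ) := by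
      rw [h2, Complex.ofReal_cpow (by positivity)]
    rw [h3, h1, ih _ (by positivity), h2, ih _ (by positivity)]
    simp only [iterateOne]
    push_cast
    ring

/-- The weights of the words in `L↑`, `L↓` are largest on the real axis, and `Lⁿ1` decreases. -/
theorem norm_ev_L_pow_le (β : ℝ≥0) (h : ℝ) (f : HInf) {N : ℝ} (hN : 0 ≤ N)
    (hf : ∀ z ∈ rightHalfPlane, ‖ev f z‖ ≤ N) (n : ℕ) :
    ∀ z ∈ rightHalfPlane, ‖ev ((L β h ^ n) f) z‖ ≤ N * iterateOne β h n z.re := by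
  induction n with
  | zero =>
    intro z hz
    rw [pow_zero, one_apply_eq_self]
    simpa only [iterateOne, mul_one] using hf z hz
  | succ n ih =>
    intro z hz
    have hz' : 0 < z.re := hz
    have hone : 1 + z.re ≤ ‖1 + z‖ := by
      simpa using Complex.re_le_norm (1 + z)
    have hup := upMap_mem hz
    have hre : z.re / (1 + z.re) ≤ (z / (1 + z)).re := by
      have e1 : z / (1 + z) = 1 - (1 + z)⁻¹ := by
        field_simp [one_add_ne_zero hz]; ring
      have e2 : z.re / (1 + z.re) = 1 - (1 + z.re)⁻¹ := by
        field_simp; ring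
      have e3 : ((1 + z)⁻¹).re ≤ (1 + z.re)⁻¹ := by
        refine (Complex.re_le_norm _).trans ?_
        rw [norm_inv]
        gcongr
      rw [e1, e2, Complex.sub_re, Complex.one_re]
      linarith
    have h1 : ‖ev ((L β h ^ n) f) (z / (1 + z))‖
        ≤ N * iterateOne β h n (z.re / (1 + z.re)) :=
      (ih _ hup).trans (by
        gcongr
        exact iterateOne_antitone β h n _ _ (by positivity) hre)
    have h2 : ‖ev ((L β h ^ n) f) (1 + z)‖ ≤ N * iterateOne β h n (1 + z.re) := by
      have := ih _ (one_add_mem hz)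
      simpa using this
    have h3 := iterateOne_nonneg β h n (z.re / (1 + z.re)) (by positivity)
    rw [pow_succ', mul_apply_eq_comp, ev_L β h _ hz]
    refine (norm_add_le _ _).trans ?_
    simp only [norm_mul, norm_div, norm_one, Complex.norm_cpow_real, Complex.norm_real,
      Real.norm_eq_abs, abs_of_pos (Real.exp_pos _), iterateOne]
    rw [one_div]
    calc _ ≤ Real.exp (-(β * h)) * (((1 + z.re) ^ (2 * (β : ℝ)))⁻¹ *
          (N * iterateOne β h n (z.re / (1 + z.re)))) +
          Real.exp (β * h) * (N * iterateOne β h n (1 + z.re)) := by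
          gcongr
      _ = _ := by ring

theorem exp_pow_le_iterateOne (β : ℝ≥0) (h : ℝ) (n : ℕ) :
    ∀ x : ℝ, 0 < x → Real.exp (β * h) ^ n ≤ iterateOne β h n x := by
  induction n with
  | zero => intro x _; simp [iterateOne]
  | succ n ih =>
    intro x hx
    have h1 := iterateOne_nonneg β h n (x / (1 + x)) (by positivity)
    have h2 := ih (1 + x) (by positivity)
    simp only [iterateOne]
    have h3 : 0 ≤ Real.exp (-(β * h)) *
      (((1 + x) ^ (2 * (β : ℝ)))⁻¹ * iterateOne β h n (x / (1 + x))) := by positivity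
    rw [pow_succ']
    have h4 := mul_le_mul_of_nonneg_left h2 (Real.exp_pos (β * h)).le
    linarith

theorem exp_neg_pow_le_iterateOne (β : ℝ≥0) (h : ℝ) (n : ℕ) :
    ∀ x : ℝ, 0 < x →
      Real.exp (-(β * h)) ^ n * ((1 + n * x) ^ (2 * (β : ℝ)))⁻¹ ≤ iterateOne β h n x := by
  induction n with
  | zero => intro x _; simp [iterateOne]
  | succ n ih =>
    intro x hx
    have h1 := ih (x / (1 + x)) (by positivity)
    have h2 := iterateOne_nonneg β h n (1 + x) (by positivity)
    simp only [iterateOne]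
    have h3 : 0 ≤ Real.exp (β * h) * iterateOne β h n (1 + x) := by positivity
    have h5 : ((1 + ((n + 1 : ℕ) : ℝ) * x) ^ (2 * (β : ℝ)))⁻¹
        = ((1 + x) ^ (2 * (β : ℝ)))⁻¹ * ((1 + n * (x / (1 + x))) ^ (2 * (β : ℝ)))⁻¹ := by
      rw [← mul_inv, ← Real.mul_rpow (by positivity) (by positivity)]
      congr 2
      push_cast
      field_simp
      ring
    calc _ = Real.exp (-(β * h)) * (((1 + x) ^ (2 * (β : ℝ)))⁻¹ * (Real.exp (-(β * h)) ^ n *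
          ((1 + n * (x / (1 + x))) ^ (2 * (β : ℝ)))⁻¹)) := by rw [h5, pow_succ']; ring
      _ ≤ Real.exp (-(β * h)) * (((1 + x) ^ (2 * (β : ℝ)))⁻¹ *
          iterateOne β h n (x / (1 + x))) := by gcongr
      _ ≤ _ := by linarith

theorem iterateOne_le_norm (β : ℝ≥0) (h : ℝ) (n : ℕ) {x : ℝ} (hx : 0 < x) :
    iterateOne β h n x ≤ ‖L β h ^ n‖ := by
  calc iterateOne β h n x ≤ ‖ev ((L β h ^ n) one) x‖ := by
        rw [ev_L_pow_one β h n x hx, Complex.norm_real]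
        exact le_abs_self _
    _ ≤ ‖(L β h ^ n) one‖ := norm_ev_le _ _
    _ ≤ ‖L β h ^ n‖ * ‖one‖ := ContinuousLinearMap.le_opNorm _ _
    _ ≤ ‖L β h ^ n‖ * 1 := by gcongr; exact norm_one_le
    _ = _ := mul_one _

theorem exp_abs_pow_le_norm (β : ℝ≥0) (h : ℝ) (n : ℕ) :
    Real.exp |β * h| ^ n ≤ ‖L β h ^ n‖ := by
  rcases le_total 0 (β * h) with hs | hs
  · rw [abs_of_nonneg hs]
    exact (exp_pow_le_iterateOne β h n 1 one_pos).trans (iterateOne_le_norm β h n one_pos)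
  · rw [abs_of_nonpos hs]
    -- here the lower bound is only attained as `x → 0`
    have hlim : Tendsto (fun x : ℝ =>
        Real.exp (-(β * h)) ^ n * ((1 + n * x) ^ (2 * (β : ℝ)))⁻¹) (𝓝[>] 0)
        (𝓝 (Real.exp (-(β * h)) ^ n * ((1 + n * (0 : ℝ)) ^ (2 * (β : ℝ)))⁻¹)) := by
      refine Tendsto.mono_left ?_ nhdsWithin_le_nhds
      refine Tendsto.const_mul _ (Tendsto.inv₀ ?_ (by simp))
      refine Tendsto.rpow_const ?_ (Or.inl (by simp))
      exact (continuous_const.add (continuous_const.mul continuous_id)).tendsto 0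
    rw [mul_zero, add_zero, Real.one_rpow, inv_one, mul_one] at hlim
    refine le_of_tendsto hlim ?_
    filter_upwards [self_mem_nhdsWithin] with x hx
    exact (exp_neg_pow_le_iterateOne β h n x hx).trans (iterateOne_le_norm β h n hx)

theorem exp_abs_le_spectralRadius (β : ℝ≥0) (h : ℝ) :
    ENNReal.ofReal (Real.exp |β * h|) ≤ spectralRadius ℂ (L β h) := by
  refine ge_of_tendsto (spectrum.pow_norm_pow_one_div_tendsto_nhds_spectralRadius (L β h)) ?_
  filter_upwards [eventually_gt_atTop 0] with n hn
  refine ENNReal.ofReal_le_ofReal ?_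
  have h1 := Real.rpow_le_rpow (by positivity) (exp_abs_pow_le_norm β h n)
    (by positivity : (0 : ℝ) ≤ 1 / n)
  rwa [← Real.rpow_natCast, ← Real.rpow_mul (Real.exp_pos _).le, mul_one_div_cancel
    (by exact_mod_cast hn.ne'), Real.rpow_one] at h1

/-- Evaluation at `z`, as a bounded functional on `H^∞(Π)`. -/
def evCLM (z : ℂ) : HInf →L[ℂ] ℂ :=
  LinearMap.mkContinuous
    { toFun := fun f => ev f z
      map_add' := fun f g => ev_add f g z
      map_smul' := fun c f => ev_smul c f z }
    1 (fun f => (norm_ev_le f z).trans (one_mul ‖f‖).ge)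

theorem re_ev_le_norm (A : HInf →L[ℂ] HInf) (z : ℂ) : (ev (A one) z).re ≤ ‖A‖ :=
  calc (ev (A one) z).re ≤ ‖ev (A one) z‖ := Complex.re_le_norm _
    _ ≤ ‖A one‖ := norm_ev_le _ _
    _ ≤ ‖A‖ * ‖one‖ := A.le_opNorm one
    _ ≤ ‖A‖ * 1 := mul_le_mul_of_nonneg_left norm_one_le (ContinuousLinearMap.opNorm_nonneg A)
    _ = ‖A‖ := mul_one _

theorem norm_ev_inverse_one_sub_smul_L_le (β : ℝ≥0) (h : ℝ) {t : ℂ}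
    (ht : (‖t‖₊ : ℝ≥0∞) < (spectralRadius ℂ (L β h))⁻¹) (f : HInf) {N : ℝ} (hN : 0 ≤ N)
    (hf : ∀ z ∈ rightHalfPlane, ‖ev f z‖ ≤ N) {z : ℂ} (hz : z ∈ rightHalfPlane) :
    ‖ev (Ring.inverse (1 - t • L β h) f) z‖ ≤
      N * (ev (Ring.inverse (1 - (‖t‖ : ℂ) • L β h) one) z.re).re :=
  norm_map_inverse_one_sub_smul_apply_le (L β h) ht (evCLM z) (evCLM z.re) f one
    (c := fun n => iterateOne β h n z.re)
    (fun n => norm_ev_L_pow_le β h f hN hf n z hz)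
    (fun n => ev_L_pow_one β h n z.re hz)

theorem norm_inverse_one_sub_smul_L_le (β : ℝ≥0) (h : ℝ) {t : ℂ}
    (ht : (‖t‖₊ : ℝ≥0∞) < (spectralRadius ℂ (L β h))⁻¹) :
    ‖Ring.inverse (1 - t • L β h)‖ ≤ ‖Ring.inverse (1 - (‖t‖ : ℂ) • L β h)‖ := by
  refine ContinuousLinearMap.opNorm_le_bound _ (ContinuousLinearMap.opNorm_nonneg _) fun f => ?_
  refine norm_le_of_ev (mul_nonneg (ContinuousLinearMap.opNorm_nonneg _) (norm_nonneg f))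
    fun z hz => ?_
  refine (norm_ev_inverse_one_sub_smul_L_le β h ht f (norm_nonneg f)
    (fun w _ => norm_ev_le f w) hz).trans ?_
  rw [mul_comm]
  exact mul_le_mul_of_nonneg_right (re_ev_le_norm _ _) (norm_nonneg f)

theorem spectralRadius_L_mem_spectrum (β : ℝ≥0) (h : ℝ) :
    ((spectralRadius ℂ (L β h)).toReal : ℂ) ∈ spectrum ℂ (L β h) := by
  refine spectralRadius_mem_spectrum (L β h) ?_ fun t ht => norm_inverse_one_sub_smul_L_le β h ht
  exact (ENNReal.ofReal_pos.mpr (Real.exp_pos _)).trans_le (exp_abs_le_spectralRadius β h)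

theorem isEigenvalue_spectralRadius_L (β : ℝ≥0) (h : ℝ)
    (hr : essSpectralRadius (L β h) < spectralRadius ℂ (L β h)) :
    IsEigenvalue (L β h) ((spectralRadius ℂ (L β h)).toReal : ℂ) :=
  isEigenvalue_spectralRadius (spectralRadius_L_mem_spectrum β h) hr

end Positivity

/-! ### Positive numbers in the spectra of the two summands -/

section ApproximateEigenvectors

open Filter Topology Metric

theorem mem_spectrum_of_approx {X : Type*} [NormedAddCommGroup X] [NormedSpace ℂ X]
    {T : X →L[ℂ] X} {μ : ℂ} (h : ∀ ε > 0, ∃ x ≠ 0, ‖μ • x - T x‖ ≤ ε * ‖x‖) :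
    μ ∈ spectrum ℂ T := by
  by_contra hn
  have hu := spectrum.notMem_iff.mp hn
  set S := algebraMap ℂ (X →L[ℂ] X) μ - T with hS
  have h1 : Ring.inverse S * S = 1 := Ring.inverse_mul_cancel _ hu
  set R := Ring.inverse S
  have happ : ∀ x, S x = μ • x - T x := fun x => by
    rw [hS, sub_apply, Algebra.algebraMap_eq_smul_one, smul_apply, one_apply_eq_self]
  obtain ⟨x, hx, hxε⟩ := h (1 / (2 * (‖R‖ + 1))) (by positivity)
  have hx0 : 0 < ‖x‖ := norm_pos_iff.mpr hx
  have h2 : R (S x) = x := congrArg (fun T : X →L[ℂ] X => T x) h1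
  have h3 : ‖x‖ ≤ ‖R‖ * (1 / (2 * (‖R‖ + 1)) * ‖x‖) := by
    conv_lhs => rw [← h2]
    refine (R.le_opNorm _).trans ?_
    rw [happ]
    gcongr
  have h4 : ‖R‖ * (1 / (2 * (‖R‖ + 1)) * ‖x‖) ≤ (‖R‖ + 1) * (1 / (2 * (‖R‖ + 1)) * ‖x‖) := by
    gcongr; linarith
  have h5 : (‖R‖ + 1) * (1 / (2 * (‖R‖ + 1)) * ‖x‖) = ‖x‖ / 2 := by field_simp
  linarith

theorem mem_spectrum_of_apply_eq {X : Type*} [NormedAddCommGroup X] [NormedSpace ℂ X]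
    {T : X →L[ℂ] X} {μ : ℂ} {x : X} (hx : x ≠ 0) (h : T x = μ • x) : μ ∈ spectrum ℂ T :=
  mem_spectrum_of_approx fun ε hε => ⟨x, hx, by
    rw [h, sub_self, norm_zero]; positivity⟩

theorem mul_mem_spectrum_smul {X : Type*} [NormedAddCommGroup X] [NormedSpace ℂ X]
    {T : X →L[ℂ] X} {μ a : ℂ} (ha : a ≠ 0) (h : μ ∈ spectrum ℂ T) :
    a * μ ∈ spectrum ℂ (a • T) :=
  (spectrum.smul_mem_smul_iff (r := Units.mk0 a ha)).mpr h

/-- The functions `e^{-cz}` are eigenvectors of `L↓`. -/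
theorem ofReal_mem_spectrum_Ldown {μ : ℝ} (h0 : 0 < μ) (h1 : μ ≤ 1) :
    (μ : ℂ) ∈ spectrum ℂ Ldown := by
  have hc : 0 ≤ -Real.log μ := by
    have := Real.log_nonpos h0.le h1
    linarith
  set c := -Real.log μ with hcdef
  let x : HInf := HInf.mk (fun z => Complex.exp (-(c * z))) (by fun_prop) 1 fun z hz => by
    have hz' : 0 < z.re := hz
    rw [Complex.norm_exp, Real.exp_le_one_iff]
    simp only [Complex.neg_re, Complex.re_ofReal_mul]
    nlinarith
  have hx : ∀ z ∈ rightHalfPlane, ev x z = Complex.exp (-(c * z)) := fun z hz => ev_mk hz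
  refine mem_spectrum_of_apply_eq (x := x) ?_ ?_
  · intro h
    have := hx 1 one_mem_rightHalfPlane
    rw [h, ev_zero] at this
    exact Complex.exp_ne_zero _ this.symm
  · refine ev_ext fun z hz => ?_
    rw [ev_Ldown x hz, ev_smul, hx _ (one_add_mem hz), hx _ hz]
    have : (μ : ℂ) = Complex.exp (-c) := by
      rw [hcdef, ← Complex.ofReal_neg, neg_neg, ← Complex.ofReal_exp, Real.exp_log h0]
    rw [this, ← Complex.exp_add]
    congr 1
    ring

theorem norm_le_norm_add_ofReal {z : ℂ} (hz : 0 ≤ z.re) {x : ℝ} (hx : 0 ≤ x) :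
    ‖z‖ ≤ ‖z + x‖ := by
  rw [Complex.norm_def, Complex.norm_def]
  refine Real.sqrt_le_sqrt ?_
  simp only [Complex.normSq_apply, Complex.add_re, Complex.add_im, Complex.ofReal_re,
    Complex.ofReal_im, add_zero]
  nlinarith [mul_nonneg hz hx]

theorem le_norm_add_ofReal {z : ℂ} (hz : 0 ≤ z.re) (x : ℝ) : x ≤ ‖z + x‖ := by
  refine le_trans ?_ (Complex.re_le_norm (z + x))
  simpa using hz

theorem add_mem_rightHalfPlane {z w : ℂ} (hz : z ∈ rightHalfPlane) (hw : 0 ≤ w.re) :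
    z + w ∈ rightHalfPlane := by
  have hz' : 0 < z.re := hz
  change 0 < (z + w).re
  rw [Complex.add_re]
  linarith

/-- The mean value theorem on the segment from `z + ε` to `z + ε + εz`, on which `‖w‖` is at least
`‖z‖` and at least `ε`. -/
theorem norm_cpow_sub_cpow_le {s ε : ℝ} (hs : 0 ≤ s) (hε : 0 < ε) {z : ℂ}
    (hz : z ∈ rightHalfPlane) :
    ‖(z + ε) ^ (-(s : ℂ)) - (z + ε + ε * z) ^ (-(s : ℂ))‖ ≤ s * ε * ε ^ (-s) := by
  have hz' : 0 < z.re := hz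
  let φ : ℝ → ℂ := fun t => (z + ε + t * (ε * z)) ^ (-(s : ℂ))
  have hmem : ∀ t ∈ Set.Icc (0 : ℝ) 1, z + ε + t * (ε * z) ∈ rightHalfPlane := by
    intro t ht
    refine add_mem_rightHalfPlane (add_mem_rightHalfPlane hz (by simpa using hε.le)) ?_
    rw [Complex.re_ofReal_mul, Complex.re_ofReal_mul]
    have := ht.1
    positivity
  have hd : ∀ t ∈ Set.Icc (0 : ℝ) 1, HasDerivWithinAt φ
      (-(s : ℂ) * (z + ε + t * (ε * z)) ^ (-(s : ℂ) - 1) * (ε * z)) (Set.Icc 0 1) t := by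
    intro t ht
    have h1 : HasDerivAt (fun w : ℂ => z + ε + w * (ε * z)) (ε * z) (t : ℂ) := by
      simpa using ((hasDerivAt_id (t : ℂ)).mul_const (ε * z : ℂ)).const_add (z + ε : ℂ)
    exact (h1.cpow_const (mem_slitPlane_of_mem (hmem t ht))).comp_ofReal.hasDerivWithinAt
  have hb : ∀ t ∈ Set.Icc (0 : ℝ) 1,
      ‖-(s : ℂ) * (z + ε + t * (ε * z)) ^ (-(s : ℂ) - 1) * (ε * z)‖ ≤ s * ε * ε ^ (-s) := by
    intro t ht
    have hw := hmem t ht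
    set w : ℂ := z + ε + t * (ε * z) with hwdef
    have e0 : w = (z * (1 + t * ε : ℝ)) + (ε : ℝ) := by
      rw [hwdef]; push_cast; ring
    have hre : 0 ≤ (z * (1 + t * ε : ℝ)).re := by
      rw [Complex.re_mul_ofReal]
      have := ht.1
      positivity
    have h1 : ε ≤ ‖w‖ := by rw [e0]; exact le_norm_add_ofReal hre ε
    have h2 : ‖z‖ ≤ ‖w‖ := by
      rw [e0]
      refine le_trans ?_ (norm_le_norm_add_ofReal hre hε.le)
      have h3 : 0 ≤ t * ε := mul_nonneg ht.1 hε.le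
      rw [norm_mul, Complex.norm_real, Real.norm_of_nonneg (by positivity)]
      nlinarith [norm_nonneg z]
    have hw0 : 0 < ‖w‖ := hε.trans_le h1
    have e1 : ‖w ^ (-(s : ℂ) - 1)‖ = ‖w‖ ^ (-s) / ‖w‖ := by
      have : (-(s : ℂ) - 1) = ((-s - 1 : ℝ) : ℂ) := by push_cast; ring
      rw [this, Complex.norm_cpow_real, Real.rpow_sub_one hw0.ne']
    rw [norm_mul, norm_mul, norm_mul, norm_neg, e1, Complex.norm_real, Complex.norm_real,
      Real.norm_of_nonneg hs, Real.norm_of_nonneg hε.le]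
    have h3 : ‖w‖ ^ (-s) ≤ ε ^ (-s) := Real.rpow_le_rpow_of_nonpos hε h1 (by linarith)
    calc s * (‖w‖ ^ (-s) / ‖w‖) * (ε * ‖z‖) = s * ε * ‖w‖ ^ (-s) * (‖z‖ / ‖w‖) := by ring
      _ ≤ s * ε * ε ^ (-s) * 1 := by
        gcongr
        exact (div_le_one hw0).mpr h2
      _ = _ := mul_one _
  have := (convex_Icc (0 : ℝ) 1).norm_image_sub_le_of_norm_hasDerivWithin_le hd hb
    (Set.right_mem_Icc.mpr zero_le_one) (Set.left_mem_Icc.mpr zero_le_one)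
  simpa [φ] using this

/-- Every `λ = e^{-c}` in `(0, 1]` is an approximate eigenvalue of `L↑_β`. The function
`z^{-2β} e^{-c/z}` satisfies the eigenvalue equation; it is unbounded, and `(z + ε)^{-2β} e^{-c/z}`
takes its place. -/
theorem ofReal_mem_spectrum_Lup (β : ℝ≥0) {μ : ℝ} (h0 : 0 < μ) (h1 : μ ≤ 1) :
    (μ : ℂ) ∈ spectrum ℂ (Lup β) := by
  have hc : 0 ≤ -Real.log μ := by
    have := Real.log_nonpos h0.le h1
    linarith
  set c := -Real.log μ with hcdef
  have hμ : (μ : ℂ) = Complex.exp (-c) := by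
    rw [hcdef, ← Complex.ofReal_neg, neg_neg, ← Complex.ofReal_exp, Real.exp_log h0]
  set s : ℝ := 2 * (β : ℝ) with hs
  have hs0 : 0 ≤ s := by positivity
  have hexp : ∀ z ∈ rightHalfPlane, ‖Complex.exp (-(c * (1 / z)))‖ ≤ 1 := by
    intro z hz
    have hz' : 0 < (1 / z).re := inv_mem hz
    rw [Complex.norm_exp, Real.exp_le_one_iff, Complex.neg_re, Complex.re_ofReal_mul]
    nlinarith
  refine mem_spectrum_of_approx fun δ hδ => ?_
  obtain ⟨ε, hε, hε1, hεδ⟩ : ∃ ε : ℝ, 0 < ε ∧ ε ≤ 1 ∧ s * ε ≤ δ * (2 ^ (-s) * μ) := by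
    refine ⟨min 1 (δ * (2 ^ (-s) * μ) / (s + 1)), by positivity, min_le_left _ _, ?_⟩
    calc s * min 1 (δ * (2 ^ (-s) * μ) / (s + 1))
        ≤ (s + 1) * (δ * (2 ^ (-s) * μ) / (s + 1)) :=
          mul_le_mul (by linarith) (min_le_right _ _) (by positivity) (by positivity)
      _ = _ := by field_simp
  have hsh : ∀ z ∈ rightHalfPlane, z + ε ∈ rightHalfPlane := fun z hz =>
    add_mem_rightHalfPlane hz (by simpa using hε.le)
  let x : HInf := HInf.mk (fun z => (z + ε) ^ (-(s : ℂ)) * Complex.exp (-(c * (1 / z))))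
    (by
      intro z hz
      have e1 : DifferentiableAt ℂ (fun z : ℂ => (z + ε) ^ (-(s : ℂ))) z :=
        (by fun_prop : DifferentiableAt ℂ (fun z : ℂ => z + ε) z).cpow (by fun_prop)
          (mem_slitPlane_of_mem (hsh z hz))
      have e2 : DifferentiableAt ℂ (fun z : ℂ => 1 / z) z :=
        (differentiableAt_const _).div differentiableAt_id (ne_zero_of_mem hz)
      exact (e1.mul (e2.const_mul (c : ℂ)).neg.cexp).differentiableWithinAt)
    (ε ^ (-s)) fun z hz => by
      have hz' : 0 < z.re := hz
      have e : (-(s : ℂ)) = ((-s : ℝ) : ℂ) := by push_cast; ring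
      rw [norm_mul, e, Complex.norm_cpow_real]
      calc _ ≤ ε ^ (-s) * 1 := by
            gcongr ?_ * ?_
            · exact Real.rpow_le_rpow_of_nonpos hε (le_norm_add_ofReal hz'.le ε) (by linarith)
            · exact hexp z hz
        _ = _ := mul_one _
  have hx : ∀ z ∈ rightHalfPlane,
      ev x z = (z + ε) ^ (-(s : ℂ)) * Complex.exp (-(c * (1 / z))) := fun z hz => ev_mk hz
  -- a lower bound for the norm, from a point near `0` on the circle `Re (1/z) = 1`
  have hlow : 2 ^ (-s) * μ * ε ^ (-s) ≤ ‖x‖ := by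
    have hw : (1 + Complex.I / ε) ∈ rightHalfPlane := by
      change 0 < (1 + Complex.I / ε).re
      simp
    have hwn : ε⁻¹ ≤ ‖1 + Complex.I / ε‖ := by
      refine le_trans ?_ (Complex.abs_im_le_norm _)
      simp [abs_of_pos hε]
    set w := 1 + Complex.I / ε with hwdef
    have hwre : w.re = 1 := by simp [hwdef]
    have hz := inv_mem hw
    refine le_trans ?_ (norm_ev_le x (1 / w))
    have e : (-(s : ℂ)) = ((-s : ℝ) : ℂ) := by push_cast; ring
    rw [hx _ hz, one_div_one_div, norm_mul, e, Complex.norm_cpow_real, Complex.norm_exp,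
      Complex.neg_re, Complex.re_ofReal_mul, hwre, mul_one, hcdef, neg_neg, Real.exp_log h0]
    have h3 : ‖1 / w + (ε : ℂ)‖ ≤ 2 * ε := by
      refine (norm_add_le _ _).trans ?_
      rw [norm_div, norm_one, Complex.norm_real, Real.norm_of_nonneg hε.le, one_div]
      have := inv_anti₀ (inv_pos.mpr hε) hwn
      rw [inv_inv] at this
      linarith
    have h4 : (2 * ε) ^ (-s) ≤ ‖1 / w + (ε : ℂ)‖ ^ (-s) :=
      Real.rpow_le_rpow_of_nonpos (norm_pos_iff.mpr (ne_zero_of_mem (hsh _ hz))) h3 (by linarith)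
    rw [Real.mul_rpow (by norm_num) hε.le] at h4
    calc 2 ^ (-s) * μ * ε ^ (-s) = 2 ^ (-s) * ε ^ (-s) * μ := by ring
      _ ≤ _ := by gcongr
  have hpos : 0 < 2 ^ (-s) * μ * ε ^ (-s) := by positivity
  refine ⟨x, fun h => ?_, ?_⟩
  · rw [h, norm_zero] at hlow
    linarith
  · have key : ‖(μ : ℂ) • x - Lup β x‖ ≤ s * ε * ε ^ (-s) := by
      refine norm_le_of_ev (by positivity) fun z hz => ?_
      have h1z := one_add_mem hz
      have hup := upMap_mem hz
      rw [ev_sub, ev_smul, ev_Lup β x hz, hx z hz, hx _ hup, ← hs]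
      have e1 : (z + ε + ε * z) ^ (-(s : ℂ))
          = 1 / (1 + z) ^ (s : ℂ) * (z / (1 + z) + ε) ^ (-(s : ℂ)) := by
        rw [one_div, ← Complex.cpow_neg, ← mul_cpow_of_mem h1z (hsh _ hup)]
        congr 1
        field_simp [ne_zero_of_mem h1z]
        ring
      have e2 : Complex.exp (-(c * (1 / (z / (1 + z)))))
          = μ * Complex.exp (-(c * (1 / z))) := by
        rw [hμ, ← Complex.exp_add]
        congr 1
        field_simp [ne_zero_of_mem hz, ne_zero_of_mem h1z]
        ring
      have e3 : (μ : ℂ) * ((z + ε) ^ (-(s : ℂ)) * Complex.exp (-(c * (1 / z)))) -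
          1 / (1 + z) ^ (s : ℂ) * ((z / (1 + z) + ε) ^ (-(s : ℂ)) *
            Complex.exp (-(c * (1 / (z / (1 + z))))))
          = μ * Complex.exp (-(c * (1 / z))) *
            ((z + ε) ^ (-(s : ℂ)) - (z + ε + ε * z) ^ (-(s : ℂ))) := by
        rw [e1, e2]; ring
      rw [e3, norm_mul, norm_mul, Complex.norm_real, Real.norm_of_nonneg h0.le]
      calc _ ≤ 1 * 1 * (s * ε * ε ^ (-s)) := by
            gcongr
            · exact hexp z hz
            · exact norm_cpow_sub_cpow_le hs0 hε hz
        _ = _ := by ring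
    refine key.trans ?_
    calc s * ε * ε ^ (-s) ≤ δ * (2 ^ (-s) * μ) * ε ^ (-s) := by gcongr
      _ = δ * (2 ^ (-s) * μ * ε ^ (-s)) := by ring
      _ ≤ δ * ‖x‖ := mul_le_mul_of_nonneg_left hlow hδ.le

/-- The interval `(0, e^{|βh|}]` is covered by the spectra of the two summands of `L_{β,h}`. -/
theorem ofReal_mem_spectrum_or (β : ℝ≥0) (h : ℝ) {μ : ℝ} (h0 : 0 < μ)
    (h1 : μ ≤ Real.exp |β * h|) :
    (μ : ℂ) ∈ spectrum ℂ ((Real.exp (-(β * h)) : ℂ) • Lup β) ∨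
      (μ : ℂ) ∈ spectrum ℂ ((Real.exp (β * h) : ℂ) • Ldown) := by
  have key : ∀ y : ℝ, μ ≤ Real.exp y → (μ : ℂ) = (Real.exp y : ℂ) * ((μ / Real.exp y : ℝ) : ℂ) ∧
      0 < μ / Real.exp y ∧ μ / Real.exp y ≤ 1 := fun y hy =>
    ⟨by rw [← Complex.ofReal_mul, mul_div_cancel₀ _ (Real.exp_pos y).ne'],
      div_pos h0 (Real.exp_pos y), (div_le_one (Real.exp_pos y)).mpr hy⟩
  have hne : ∀ y : ℝ, (Real.exp y : ℂ) ≠ 0 := fun y =>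
    Complex.ofReal_ne_zero.mpr (Real.exp_pos y).ne'
  rcases le_total 0 (β * h) with hs | hs
  · rw [abs_of_nonneg hs] at h1
    obtain ⟨e1, e2, e3⟩ := key _ h1
    right
    rw [e1]
    exact mul_mem_spectrum_smul (hne _) (ofReal_mem_spectrum_Ldown e2 e3)
  · rw [abs_of_nonpos hs] at h1
    obtain ⟨e1, e2, e3⟩ := key _ h1
    left
    rw [e1]
    exact mul_mem_spectrum_smul (hne _) (ofReal_mem_spectrum_Lup β e2 e3)

end ApproximateEigenvectors

/-! ### The cluster operators and coupled pairs -/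

section Cluster

open Filter Topology Metric

section Abstract

variable {X : Type*} [NormedAddCommGroup X] [NormedSpace ℂ X] {D E : X →L[ℂ] X} {τ₁ τ₂ : ℂ}

theorem inverse_apply_eq_iff {S : X →L[ℂ] X} (hS : IsUnit S) {x y : X} :
    Ring.inverse S y = x ↔ S x = y := by
  have h1 : ∀ x, Ring.inverse S (S x) = x := fun x =>
    congrArg (fun T : X →L[ℂ] X => T x) (Ring.inverse_mul_cancel S hS)
  have h2 : ∀ x, S (Ring.inverse S x) = x := fun x =>
    congrArg (fun T : X →L[ℂ] X => T x) (Ring.mul_inverse_cancel S hS)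
  exact ⟨fun h => by rw [← h, h2], fun h => by rw [← h, h1]⟩

theorem smul_inverse_mul_apply_eq_iff {τ : ℂ} (h : IsUnit (1 - τ • D)) {x y : X} :
    (τ • (Ring.inverse (1 - τ • D) * E)) y = x ↔ x = τ • (D x + E y) := by
  rw [smul_apply, mul_apply_eq_comp, ← map_smul, inverse_apply_eq_iff h, sub_apply, smul_apply,
    one_apply_eq_self, sub_eq_iff_eq_add, smul_add, add_comm]

theorem exists_norm_sub_le_isUnit [CompleteSpace X] {τ : ℂ} (h : IsUnit (1 - τ • D)) :
    ∃ ε > 0, ∀ D' : X →L[ℂ] X, ‖D' - D‖ ≤ ε → IsUnit (1 - τ • D') := by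
  have hc : ContinuousAt (fun D' : X →L[ℂ] X => 1 - τ • D') D := by fun_prop
  have h1 : ∀ᶠ D' in 𝓝 D, IsUnit (1 - τ • D') :=
    hc.eventually (Units.isOpen.eventually_mem h)
  obtain ⟨ε, hε, hb⟩ := Metric.eventually_nhds_iff.mp h1
  refine ⟨ε / 2, by positivity, fun D' hD' => hb ?_⟩
  rw [dist_eq_norm]
  linarith

theorem one_mem_spectrum_of_pair (h₁ : IsUnit (1 - τ₁ • D)) (h₂ : IsUnit (1 - τ₂ • D)) {f g : X}
    (hf0 : f ≠ 0) (hf : f = τ₁ • (D f + E g)) (hg : g = τ₂ • (D g + E f)) :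
    (1 : ℂ) ∈ spectrum ℂ ((τ₁ • (Ring.inverse (1 - τ₁ • D) * E)) *
      (τ₂ • (Ring.inverse (1 - τ₂ • D) * E))) := by
  refine mem_spectrum_of_apply_eq hf0 ?_
  rw [mul_apply_eq_comp, (smul_inverse_mul_apply_eq_iff h₂).mpr hg,
    (smul_inverse_mul_apply_eq_iff h₁).mpr hf, one_smul]

/-- If `E²` and `ED` are compact, then `1` belongs to the spectrum of the product of
`τᵢ(1 - τᵢD)⁻¹E` only if it is an eigenvalue, because the product equals
`τ₁τ₂(1 - τ₁D)⁻¹(E² + τ₂ED(1 - τ₂D)⁻¹E)`. -/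
theorem exists_pair_of_one_mem_spectrum [CompleteSpace X] (hEE : FiniteRankApproximable (E * E))
    (hED : FiniteRankApproximable (E * D))
    (h : (1 : ℂ) ∈ spectrum ℂ ((τ₁ • (Ring.inverse (1 - τ₁ • D) * E)) *
      (τ₂ • (Ring.inverse (1 - τ₂ • D) * E)))) :
    IsUnit (1 - τ₁ • D) ∧ IsUnit (1 - τ₂ • D) ∧
      ∃ f g : X, f ≠ 0 ∧ f = τ₁ • (D f + E g) ∧ g = τ₂ • (D g + E f) := by
  have hzero : (1 : ℂ) ∉ spectrum ℂ (0 : X →L[ℂ] X) := by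
    rw [spectrum.notMem_iff, sub_zero, map_one]
    exact isUnit_one
  have h₁ : IsUnit (1 - τ₁ • D) := by
    by_contra hn
    rw [Ring.inverse_non_unit _ hn, zero_mul, smul_zero, zero_mul] at h
    exact hzero h
  have h₂ : IsUnit (1 - τ₂ • D) := by
    by_contra hn
    rw [Ring.inverse_non_unit (1 - τ₂ • D) hn, zero_mul, smul_zero, mul_zero] at h
    exact hzero h
  refine ⟨h₁, h₂, ?_⟩
  set R₁ := Ring.inverse (1 - τ₁ • D) with hR₁
  set R₂ := Ring.inverse (1 - τ₂ • D) with hR₂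
  have hK : IsCompactOperator ((τ₁ • (R₁ * E)) * (τ₂ • (R₂ * E))) := by
    have e0 : R₂ = 1 + τ₂ • (D * R₂) := by
      have := Ring.mul_inverse_cancel _ h₂
      rw [← hR₂, sub_mul, one_mul, smul_mul_assoc, sub_eq_iff_eq_add] at this
      exact this
    have e1 : (τ₁ • (R₁ * E)) * (τ₂ • (R₂ * E))
        = (τ₁ * τ₂) • (R₁ * (E * E)) + (τ₁ * τ₂ * τ₂) • (R₁ * ((E * D) * (R₂ * E))) := by
      conv_lhs => rw [e0]
      simp only [smul_mul_assoc, mul_smul_comm, mul_add, add_mul, one_mul, mul_assoc]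
      module
    rw [e1]
    exact ((hEE.mul_left R₁).isCompactOperator.smul _).add
      (((hED.mul_right _).mul_left R₁).isCompactOperator.smul _)
  obtain ⟨f, hf0, hf⟩ := isEigenvalue_iff.mp
    ((hK.hasEigenvalue_iff_mem_spectrum one_ne_zero).mpr h)
  rw [one_smul, mul_apply_eq_comp] at hf
  exact ⟨f, (τ₂ • (R₂ * E)) f, hf0, (smul_inverse_mul_apply_eq_iff h₁).mp hf,
    (smul_inverse_mul_apply_eq_iff h₂).mp rfl⟩

end Abstract

/-- The coupled equations `f = τ₁(L↓f + L↓S g)`, `g = τ₂(L↓g + L↓S f)`, which express that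
`f = M_{τ₁} g` and `g = M_{τ₂} f`. -/
def IsClusterPair (β : ℝ≥0) (τ₁ τ₂ : ℂ) (f g : HInf) : Prop :=
  f = τ₁ • (Ldown f + LdownFlip β g) ∧ g = τ₂ • (Ldown g + LdownFlip β f)

theorem one_mem_spectrum_M_mul_M {β : ℝ≥0} {τ₁ τ₂ : ℂ} (h₁ : IsUnit (1 - τ₁ • Ldown))
    (h₂ : IsUnit (1 - τ₂ • Ldown)) {f g : HInf} (hf0 : f ≠ 0)
    (h : IsClusterPair β τ₁ τ₂ f g) : (1 : ℂ) ∈ spectrum ℂ (M β τ₁ * M β τ₂) :=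
  one_mem_spectrum_of_pair h₁ h₂ hf0 h.1 h.2

theorem exists_isClusterPair {β : ℝ≥0} {τ₁ τ₂ : ℂ}
    (h : (1 : ℂ) ∈ spectrum ℂ (M β τ₁ * M β τ₂)) :
    IsUnit (1 - τ₁ • Ldown) ∧ IsUnit (1 - τ₂ • Ldown) ∧
      ∃ f g : HInf, f ≠ 0 ∧ IsClusterPair β τ₁ τ₂ f g :=
  exists_pair_of_one_mem_spectrum (finiteRankApproximable_LdownFlip_sq β)
    (finiteRankApproximable_LdownFlip_mul_Ldown β) h

theorem ev_smul_add (β : ℝ≥0) (τ : ℂ) (f g : HInf) {z : ℂ} (hz : z ∈ rightHalfPlane) :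
    ev (τ • (Ldown f + LdownFlip β g)) z
      = τ * (ev f (1 + z) + 1 / (1 + z) ^ ((2 * (β : ℝ) : ℝ) : ℂ) * ev g (1 / (1 + z))) := by
  rw [ev_smul, ev_add, ev_Ldown f hz, ev_LdownFlip β g hz]

/-- A function on `Π` that vanishes on `1 + Π` vanishes. -/
theorem eq_zero_of_Ldown_eq_zero {f : HInf} (h : Ldown f = 0) : f = 0 := by
  have han : AnalyticOnNhd ℂ (ev f) rightHalfPlane :=
    (ev_differentiableOn f).analyticOnNhd isOpen_rightHalfPlane
  have h2 : (2 : ℂ) ∈ rightHalfPlane := by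
    change 0 < (2 : ℂ).re
    simp
  have hev : ∀ᶠ z in 𝓝 (2 : ℂ), ev f z = 0 := by
    have : {z : ℂ | 1 < z.re} ∈ 𝓝 (2 : ℂ) :=
      (isOpen_lt continuous_const Complex.continuous_re).mem_nhds (by simp)
    filter_upwards [this] with z hz
    have hz1 : z - 1 ∈ rightHalfPlane := by
      change 0 < (z - 1).re
      simpa using hz
    have := ev_Ldown f hz1
    rw [h, ev_zero, add_sub_cancel] at this
    exact this.symm
  have hconv : Convex ℝ rightHalfPlane := convex_halfSpace_re_gt 0
  exact ev_ext fun z hz => by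
    rw [ev_zero]
    exact han.eqOn_zero_of_preconnected_of_eventuallyEq_zero hconv.isPreconnected h2 hev hz

/-- An eigenfunction `F = zaL↑F + zbL↓F` of `aL↑ + bL↓` splits into `f = zbL↓F` and
`S g = zaL↑F`, and `f` and `g` solve the coupled equations. -/
theorem exists_isClusterPair_of_eigenfunction {β : ℝ≥0} {a b z : ℂ} (hz : z ≠ 0) (hb : b ≠ 0)
    {F : HInf} (hF0 : F ≠ 0) (hF : F = z • (a • Lup β F + b • Ldown F)) :
    ∃ f g : HInf, f ≠ 0 ∧ IsClusterPair β (z * b) (z * a) f g := by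
  have hev : ∀ v ∈ rightHalfPlane, ev F v = z * (a * (1 / (1 + v) ^ ((2 * (β : ℝ) : ℝ) : ℂ) *
      ev F (v / (1 + v))) + b * ev F (1 + v)) := by
    intro v hv
    conv_lhs => rw [hF]
    rw [ev_smul, ev_add, ev_smul, ev_smul, ev_Lup β F hv, ev_Ldown F hv]
  have hf : ∀ v ∈ rightHalfPlane, ev ((z * b) • Ldown F) v = z * b * ev F (1 + v) :=
    fun v hv => by rw [ev_smul, ev_Ldown F hv]
  have hg : ∀ v ∈ rightHalfPlane, ev ((z * a) • LdownFlip β F) v =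
      z * a * (1 / (1 + v) ^ ((2 * (β : ℝ) : ℝ) : ℂ) * ev F (1 / (1 + v))) :=
    fun v hv => by rw [ev_smul, ev_LdownFlip β F hv]
  set s : ℂ := ((2 * (β : ℝ) : ℝ) : ℂ) with hs
  refine ⟨(z * b) • Ldown F, (z * a) • LdownFlip β F, fun h => hF0 ?_, ?_, ?_⟩
  · exact eq_zero_of_Ldown_eq_zero ((smul_eq_zero.mp h).resolve_left (mul_ne_zero hz hb))
  · refine ev_ext fun v hv => ?_
    have h1 := one_add_mem hv
    have h2 := inv_mem h1
    have h3 := one_add_mem h2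
    rw [ev_smul_add β _ _ _ hv, hf v hv, hf _ h1, hg _ h2, hev _ h1, ← hs]
    have e1 : 1 / (1 + 1 / (1 + v)) = (1 + v) / (1 + (1 + v)) := by
      have := ne_zero_of_mem h1
      rw [div_eq_div_iff (ne_zero_of_mem h3) (ne_zero_of_mem (one_add_mem h1))]
      field_simp
      ring
    have e2 : (1 + (1 + v)) ^ s = (1 + v) ^ s * (1 + 1 / (1 + v)) ^ s := by
      rw [← mul_cpow_of_mem h1 h3]
      congr 1
      field_simp [ne_zero_of_mem h1]
      ring
    rw [e1, e2]
    field_simp [cpow_ne_zero_of_mem h1, cpow_ne_zero_of_mem h3]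
    ring
  · refine ev_ext fun v hv => ?_
    have h1 := one_add_mem hv
    have h2 := inv_mem h1
    have h3 := one_add_mem h2
    have h4 := one_add_mem h1
    rw [ev_smul_add β _ _ _ hv, hg v hv, hg _ h1, hf _ h2, hev _ h2, ← hs]
    have e1 : (1 / (1 + v)) / (1 + 1 / (1 + v)) = 1 / (1 + (1 + v)) := by
      have := ne_zero_of_mem h1
      rw [div_eq_div_iff (ne_zero_of_mem h3) (ne_zero_of_mem h4)]
      field_simp
      ring
    have e2 : (1 + (1 + v)) ^ s = (1 + v) ^ s * (1 + 1 / (1 + v)) ^ s := by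
      rw [← mul_cpow_of_mem h1 h3]
      congr 1
      field_simp [ne_zero_of_mem h1]
      ring
    rw [e1, e2]
    field_simp [cpow_ne_zero_of_mem h1, cpow_ne_zero_of_mem h3]

end Cluster

/-! ### Decay of solutions -/

section Decay

open Filter Topology Metric

theorem norm_one_add_le {v : ℂ} (hv : v ∈ rightHalfPlane) {c : ℝ} (hc : 1 ≤ c) :
    ‖1 + v‖ ≤ ‖(c : ℂ) + v‖ := by
  have h := norm_le_norm_add_ofReal (z := 1 + v) (x := c - 1)
    (le_of_lt (one_add_mem hv)) (by linarith)
  convert h using 2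
  push_cast
  ring

theorem norm_ofReal_add_le {v : ℂ} (hv : v ∈ rightHalfPlane) {c : ℝ} (hc : 1 ≤ c) :
    ‖(c : ℂ) + v‖ ≤ c * ‖1 + v‖ := by
  have h2 : ‖(c : ℂ) + v‖ ≤ ‖(c : ℂ) + c * v‖ := by
    rw [Complex.norm_def, Complex.norm_def]
    refine Real.sqrt_le_sqrt ?_
    have hv' : 0 < v.re := hv
    simp only [Complex.normSq_apply, Complex.add_re, Complex.add_im, Complex.ofReal_re,
      Complex.ofReal_im, Complex.re_ofReal_mul, Complex.im_ofReal_mul, zero_add]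
    have e1 : c + v.re ≤ c + c * v.re := by nlinarith
    have e2 : v.im * v.im ≤ (c * v.im) * (c * v.im) := by
      have : 0 ≤ (c - 1) * (c + 1) * (v.im * v.im) :=
        mul_nonneg (mul_nonneg (by linarith) (by linarith)) (mul_self_nonneg _)
      nlinarith
    nlinarith
  refine h2.trans (le_of_eq ?_)
  have : (c : ℂ) + c * v = c * (1 + v) := by ring
  rw [this, norm_mul, Complex.norm_real, Real.norm_of_nonneg (by linarith)]

/-- The weight `((c + v) / (c + 1 + v))^s`, which conjugation with `(c + v)^s` attaches to `L↓`, is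
close to `1` for large `c`. -/
theorem exists_weight {s : ℝ} {ε : ℝ} (hε : 0 < ε) :
    ∃ (c : ℝ) (w : HInf), 1 ≤ c ∧ (∀ v ∈ rightHalfPlane, ‖ev w v - 1‖ ≤ ε) ∧
      ∀ v ∈ rightHalfPlane, ((c : ℂ) + (1 + v)) ^ (s : ℂ) * ev w v = ((c : ℂ) + v) ^ (s : ℂ) := by
  have hc : ContinuousAt (fun x : ℂ => x ^ (s : ℂ)) 1 :=
    continuousAt_id.cpow continuousAt_const (by simp)
  obtain ⟨δ, hδ, hb⟩ := Metric.continuousAt_iff.mp hc ε hε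
  obtain ⟨c, hc1, hcδ⟩ : ∃ c : ℝ, 1 ≤ c ∧ 1 / c < δ := by
    refine ⟨max 1 (2 / δ), le_max_left _ _, ?_⟩
    calc 1 / max 1 (2 / δ) ≤ 1 / (2 / δ) :=
          one_div_le_one_div_of_le (by positivity) (le_max_right _ _)
      _ = δ / 2 := by field_simp
      _ < δ := by linarith
  have hmem : ∀ v ∈ rightHalfPlane, (c : ℂ) + v ∈ rightHalfPlane := fun v hv => by
    rw [add_comm]
    exact add_mem_rightHalfPlane hv (by simp; linarith)
  have hclose : ∀ v ∈ rightHalfPlane, ‖((c : ℂ) + v) / (c + (1 + v)) - 1‖ ≤ 1 / c := by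
    intro v hv
    have h0 := ne_zero_of_mem (hmem _ (one_add_mem hv))
    have : ((c : ℂ) + v) / (c + (1 + v)) - 1 = -(1 / (c + (1 + v))) := by
      field_simp; ring
    rw [this, norm_neg, norm_div, norm_one]
    refine one_div_le_one_div_of_le (by linarith) ?_
    have := le_norm_add_ofReal (z := 1 + v) (le_of_lt (one_add_mem hv)) c
    rwa [add_comm] at this
  have hre : ∀ v ∈ rightHalfPlane, ((c : ℂ) + v) / (c + (1 + v)) ∈ rightHalfPlane := by
    intro v hv
    have h1 := hmem _ (one_add_mem hv)
    have hr : ∀ w ∈ rightHalfPlane, 1 - 1 / (1 + w) ∈ rightHalfPlane := by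
      intro w hw
      have : 1 - 1 / (1 + w) = w / (1 + w) := by
        field_simp [one_add_ne_zero hw]; ring
      rw [this]
      exact upMap_mem hw
    have := hr _ (hmem v hv)
    convert this using 1
    have h2 := ne_zero_of_mem h1
    have h3 := one_add_ne_zero (hmem v hv)
    field_simp
    ring
  have hnear : ∀ v ∈ rightHalfPlane, ‖(((c : ℂ) + v) / (c + (1 + v))) ^ (s : ℂ) - 1‖ ≤ ε := by
    intro v hv
    have := hb (x := ((c : ℂ) + v) / (c + (1 + v)))
      (by rw [dist_eq_norm]; exact (hclose v hv).trans_lt hcδ)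
    rw [dist_eq_norm, Complex.one_cpow] at this
    exact this.le
  have hdiff : DifferentiableOn ℂ (fun v => (((c : ℂ) + v) / (c + (1 + v))) ^ (s : ℂ))
      rightHalfPlane := by
    intro v hv
    have h1 : DifferentiableAt ℂ (fun v : ℂ => ((c : ℂ) + v) / (c + (1 + v))) v :=
      DifferentiableAt.div (by fun_prop) (by fun_prop)
        (ne_zero_of_mem (hmem _ (one_add_mem hv)))
    exact (h1.cpow (by fun_prop) (mem_slitPlane_of_mem (hre v hv))).differentiableWithinAt
  refine ⟨c, HInf.mk (fun v => (((c : ℂ) + v) / (c + (1 + v))) ^ (s : ℂ)) hdiff (1 + ε) ?_, hc1,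
    ?_, ?_⟩
  · intro v hv
    have e : (((c : ℂ) + v) / (c + (1 + v))) ^ (s : ℂ)
      = 1 + ((((c : ℂ) + v) / (c + (1 + v))) ^ (s : ℂ) - 1) := by ring
    rw [e]
    refine (norm_add_le _ _).trans ?_
    rw [norm_one]
    linarith [hnear v hv]
  · intro v hv
    rw [ev_mk hv]
    exact hnear v hv
  · intro v hv
    rw [ev_mk hv, ← mul_cpow_of_mem (hmem _ (one_add_mem hv)) (hre v hv)]
    congr 1
    field_simp [ne_zero_of_mem (hmem _ (one_add_mem hv))]

theorem norm_weightedComp_sub_Ldown_le {w : HInf} {ε : ℝ} (hε : 0 ≤ ε)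
    (hw : ∀ v ∈ rightHalfPlane, ‖ev w v - 1‖ ≤ ε) :
    ‖weightedComp w (fun z => 1 + z) ((differentiableOn_const _).add differentiableOn_id)
      mapsTo_down - Ldown‖ ≤ ε := by
  refine ContinuousLinearMap.opNorm_le_bound _ hε fun f => ?_
  refine norm_le_of_ev (mul_nonneg hε (norm_nonneg f)) fun z hz => ?_
  rw [sub_apply, ev_sub, ev_weightedComp _ _ _ _ _ hz, ev_Ldown f hz, ← sub_one_mul, norm_mul]
  exact mul_le_mul (hw z hz) (norm_ev_le f _) (norm_nonneg _) hε

/-- Decay of `(1 - τL↓)k` of order `s` is inherited by `k`. Conjugation of `L↓` with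
`v ↦ (c + v)^s` is, for large `c`, a small perturbation of `L↓`, so that `1 - τL↓` is invertible
on the space of functions that are `O(|1 + v|^{-s})` as well. -/
theorem exists_norm_le_rpow {τ : ℂ} (hτ : IsUnit (1 - τ • Ldown)) {s : ℝ} (hs : 0 ≤ s) {k : HInf}
    {C : ℝ} (hC : ∀ v ∈ rightHalfPlane, ‖ev (k - τ • Ldown k) v‖ ≤ C * ‖1 + v‖ ^ (-s)) :
    ∃ C', 0 ≤ C' ∧ ∀ v ∈ rightHalfPlane, ‖ev k v‖ ≤ C' * ‖1 + v‖ ^ (-s) := by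
  obtain ⟨ε, hε, hunit⟩ := exists_norm_sub_le_isUnit hτ
  obtain ⟨c, w, hc1, hw1, hw⟩ := exists_weight (s := s) hε
  have hU := hunit _ (norm_weightedComp_sub_Ldown_le hε.le hw1)
  have hmem : ∀ v ∈ rightHalfPlane, (c : ℂ) + v ∈ rightHalfPlane := fun v hv => by
    rw [add_comm]
    exact add_mem_rightHalfPlane hv (by simp; linarith)
  have hdiff : ∀ r : ℂ, DifferentiableOn ℂ (fun v => ((c : ℂ) + v) ^ r) rightHalfPlane :=
    fun r v hv => ((by fun_prop : DifferentiableAt ℂ (fun v : ℂ => (c : ℂ) + v) v).cpow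
      (by fun_prop) (mem_slitPlane_of_mem (hmem v hv))).differentiableWithinAt
  have hC0 : 0 ≤ C := by
    have h1 := (norm_nonneg _).trans (hC 1 one_mem_rightHalfPlane)
    have h2 : 0 < ‖(1 : ℂ) + 1‖ ^ (-s) := Real.rpow_pos_of_pos (by norm_num) _
    exact nonneg_of_mul_nonneg_left h1 h2
  let H : HInf := HInf.mk (fun v => ((c : ℂ) + v) ^ (s : ℂ) * ev (k - τ • Ldown k) v)
    ((hdiff s).mul (ev_differentiableOn _)) (c ^ s * C) fun v hv => by
      have hp : 0 < ‖1 + v‖ := norm_pos_iff.mpr (one_add_ne_zero hv)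
      rw [norm_mul, Complex.norm_cpow_real]
      calc _ ≤ (c * ‖1 + v‖) ^ s * (C * ‖1 + v‖ ^ (-s)) := by
            gcongr
            · exact norm_ofReal_add_le hv hc1
            · exact hC v hv
        _ = c ^ s * C * (‖1 + v‖ ^ s * ‖1 + v‖ ^ (-s)) := by
            rw [Real.mul_rpow (by linarith) hp.le]; ring
        _ = c ^ s * C := by rw [← Real.rpow_add hp, add_neg_cancel, Real.rpow_zero, mul_one]
  set D' := weightedComp w (fun z => 1 + z) ((differentiableOn_const _).add differentiableOn_id)
      mapsTo_down
  obtain ⟨K, hK⟩ : ∃ K, (1 - τ • D') K = H :=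
    ⟨_, (inverse_apply_eq_iff hU).mp rfl⟩
  have hKv : ∀ v ∈ rightHalfPlane, ev K v - τ * (ev w v * ev K (1 + v))
      = ((c : ℂ) + v) ^ (s : ℂ) * ev (k - τ • Ldown k) v := by
    intro v hv
    have := congrArg (fun x => ev x v) hK
    rw [sub_apply, one_apply_eq_self, smul_apply, ev_sub, ev_smul,
      ev_weightedComp _ _ _ _ _ hv, ev_mk hv] at this
    exact this
  have hneg : ∀ v ∈ rightHalfPlane, ‖((c : ℂ) + v) ^ (-(s : ℂ))‖ ≤ ‖1 + v‖ ^ (-s) := by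
    intro v hv
    have : (-(s : ℂ)) = ((-s : ℝ) : ℂ) := by push_cast; ring
    rw [this, Complex.norm_cpow_real]
    exact Real.rpow_le_rpow_of_nonpos (norm_pos_iff.mpr (one_add_ne_zero hv))
      (norm_one_add_le hv hc1) (by linarith)
  obtain ⟨N, hN0, hN⟩ : ∃ N, 0 ≤ N ∧ ∀ v, ‖ev K v‖ ≤ N := ⟨_, norm_nonneg K, norm_ev_le K⟩
  let k' : HInf := HInf.mk (fun v => ((c : ℂ) + v) ^ (-(s : ℂ)) * ev K v)
    ((hdiff _).mul (ev_differentiableOn _)) N fun v hv => by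
      rw [norm_mul]
      calc _ ≤ 1 * N := by
            gcongr
            · exact (hneg v hv).trans
                (Real.rpow_le_one_of_one_le_of_nonpos (one_le_norm_one_add hv) (by linarith))
            · exact hN v
        _ = N := one_mul N
  have hk' : ∀ v ∈ rightHalfPlane, ev k' v = ((c : ℂ) + v) ^ (-(s : ℂ)) * ev K v :=
    fun v hv => ev_mk hv
  have heq : (1 - τ • Ldown) k' = (1 - τ • Ldown) k := by
    refine ev_ext fun v hv => ?_
    have h1 := one_add_mem hv
    have e1 := hKv v hv
    have e2 := hw v hv
    rw [ev_sub, ev_smul] at e1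
    rw [sub_apply, sub_apply, smul_apply, smul_apply, one_apply_eq_self, one_apply_eq_self,
      ev_sub, ev_smul, ev_sub, ev_smul, ev_Ldown k' hv, hk' v hv, hk' _ h1, Complex.cpow_neg,
      Complex.cpow_neg]
    have n1 := cpow_ne_zero_of_mem (hmem v hv) s
    have n2 := cpow_ne_zero_of_mem (hmem _ h1) s
    have e3 : ev K v = ((c : ℂ) + v) ^ (s : ℂ) * (ev k v - τ * ev (Ldown k) v) +
        τ * (ev w v * ev K (1 + v)) := by rw [← e1]; ring
    rw [e3, ← e2]
    have n3 : ev w v ≠ 0 := fun h => n1 (by rw [← e2, h, mul_zero])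
    field_simp
    ring
  have hkk : k' = k := by
    have := (inverse_apply_eq_iff hτ).mpr heq
    rwa [(inverse_apply_eq_iff hτ).mpr rfl, eq_comm] at this
  refine ⟨N, hN0, fun v hv => ?_⟩
  rw [← hkk, hk' v hv, norm_mul, mul_comm]
  exact mul_le_mul (hN v) (hneg v hv) (norm_nonneg _) hN0

end Decay

/-! ### The energy form and positivity of translations -/

section Energy

open Filter Topology Metric MeasureTheory Complex
open scoped ComplexConjugate

/-- Cauchy's theorem moves the integral over a vertical line. -/
theorem integral_vertical_eq {Ψ : ℂ → ℂ} {d B : ℝ} (hd : 0 ≤ d)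
    (hΨ : ∀ ξ : ℂ, 0 ≤ ξ.re → ξ.re ≤ d → DifferentiableAt ℂ Ψ ξ)
    (hB : ∀ ξ : ℂ, 0 ≤ ξ.re → ξ.re ≤ d → ‖Ψ ξ‖ ≤ B * (1 + ξ.im ^ 2)⁻¹) :
    ∫ y : ℝ, Ψ (d + y * I) = ∫ y : ℝ, Ψ (y * I) := by
  have hint : ∀ c : ℝ, 0 ≤ c → c ≤ d → Integrable fun y : ℝ => Ψ (c + y * I) := by
    intro c h0 h1
    refine Integrable.mono' (integrable_inv_one_add_sq.const_mul B) ?_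
      (Eventually.of_forall fun y => ?_)
    · refine Continuous.aestronglyMeasurable (continuous_iff_continuousAt.mpr fun y => ?_)
      have : ContinuousAt Ψ ((fun y : ℝ => (c : ℂ) + y * I) y) :=
        (hΨ _ (by simpa using h0) (by simpa using h1)).continuousAt
      exact ContinuousAt.comp (f := fun y : ℝ => (c : ℂ) + y * I) this (by fun_prop)
    · simpa using hB (c + y * I) (by simpa using h0) (by simpa using h1)
  have hrect : ∀ T : ℝ, (∫ x : ℝ in 0..d, Ψ (x + (-T : ℝ) * I)) - (∫ x : ℝ in 0..d, Ψ (x + T * I))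
      + I * (∫ y : ℝ in -T..T, Ψ (d + y * I)) - I * (∫ y : ℝ in -T..T, Ψ (y * I)) = 0 := by
    intro T
    have := integral_boundary_rect_eq_zero_of_differentiableOn Ψ (⟨0, -T⟩ : ℂ) (⟨d, T⟩ : ℂ)
      (fun ξ hξ => (hΨ ξ (by
        have := hξ.1
        rw [Set.mem_preimage, Set.uIcc_of_le hd] at this
        exact this.1) (by
        have := hξ.1
        rw [Set.mem_preimage, Set.uIcc_of_le hd] at this
        exact this.2)).differentiableWithinAt)
    simpa only [ofReal_zero, zero_add, smul_eq_mul] using this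
  have hside : ∀ σ : ℝ, σ = 1 ∨ σ = -1 →
      Tendsto (fun T : ℝ => ∫ x : ℝ in 0..d, Ψ (x + (σ * T : ℝ) * I)) atTop (𝓝 0) := by
    intro σ hσ
    have hσ2 : σ ^ 2 = 1 := by rcases hσ with h | h <;> rw [h] <;> norm_num
    have hlim : Tendsto (fun T : ℝ => B * (1 + T ^ 2)⁻¹ * |d - 0|) atTop (𝓝 (B * 0 * |d - 0|)) := by
      refine Tendsto.mul_const _ (Tendsto.const_mul _ (Tendsto.inv_tendsto_atTop ?_))
      exact tendsto_atTop_add_const_left _ _ (tendsto_pow_atTop (by norm_num))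
    rw [mul_zero, zero_mul] at hlim
    refine squeeze_zero_norm (fun T => ?_) hlim
    refine intervalIntegral.norm_integral_le_of_norm_le_const fun x hx => ?_
    rw [Set.uIoc_of_le hd] at hx
    have := hB (x + (σ * T : ℝ) * I) (by simpa using hx.1.le) (by simpa using hx.2)
    simpa [mul_pow, hσ2] using this
  have hneg : Tendsto (fun T : ℝ => -T) atTop atBot := tendsto_neg_atTop_atBot
  have h1 := intervalIntegral_tendsto_integral (hint d hd le_rfl) hneg tendsto_id
  have h2 := intervalIntegral_tendsto_integral (hint 0 le_rfl hd) hneg tendsto_id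
  simp only [ofReal_zero, zero_add] at h2
  have h3 := (hside (-1) (Or.inr rfl)).sub (hside 1 (Or.inl rfl))
  have h4 := (h3.add (h1.const_mul I)).sub (h2.const_mul I)
  have h5 : ∀ᶠ T : ℝ in atTop, (0 : ℂ) =
      (∫ x : ℝ in 0..d, Ψ (x + (-1 * T : ℝ) * I)) - (∫ x : ℝ in 0..d, Ψ (x + (1 * T : ℝ) * I))
      + I * (∫ y : ℝ in -T..id T, Ψ (d + y * I)) - I * (∫ y : ℝ in -T..id T, Ψ (y * I)) :=
    Eventually.of_forall fun T => by
      rw [neg_one_mul, one_mul]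
      exact (hrect T).symm
  have h6 := tendsto_nhds_unique (h4.congr' (h5.mono fun _ h => h.symm)) tendsto_const_nhds
  rw [sub_zero, zero_add, ← mul_sub] at h6
  exact sub_eq_zero.mp ((mul_eq_zero.mp h6).resolve_left I_ne_zero)

/-- Positivity of translations, line by line. The function `ξ ↦ g(p + ξ) conj(g(p - conj ξ))` is
holomorphic, and on the imaginary axis it equals `|g(p + ξ)|²`. -/
theorem integral_shift_eq {g : ℂ → ℂ} {C : ℝ} (hg : DifferentiableOn ℂ g rightHalfPlane)
    (hC : ∀ v ∈ rightHalfPlane, ‖v‖ * ‖g v‖ ≤ C) {x : ℝ} (hx : 0 < x) :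
    ∫ y : ℝ, g (1 + (x + y * I)) * conj (g (x + y * I))
      = ((∫ y : ℝ, ‖g ((x + 1 / 2 : ℝ) + y * I)‖ ^ 2 : ℝ) : ℂ) := by
  set p : ℝ := x + 1 / 2 with hp
  have hC0 : 0 ≤ C := le_trans (by positivity) (hC 1 one_mem_rightHalfPlane)
  have hm1 : ∀ ξ : ℂ, 0 ≤ ξ.re → ξ.re ≤ 1 / 2 → (p : ℂ) + ξ ∈ rightHalfPlane := by
    intro ξ h0 h1
    change 0 < (p + ξ).re
    rw [add_re, ofReal_re]
    linarith
  have hm2 : ∀ ξ : ℂ, 0 ≤ ξ.re → ξ.re ≤ 1 / 2 → conj ((p : ℂ) - ξ) ∈ rightHalfPlane := by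
    intro ξ h0 h1
    change 0 < (conj ((p : ℂ) - ξ)).re
    rw [conj_re, sub_re, ofReal_re]
    linarith
  have hbound : ∀ w : ℂ, x ≤ w.re → ‖g w‖ ≤ C * (√(x ^ 2 + w.im ^ 2))⁻¹ := by
    intro w hw
    have h1 := hC w (show 0 < w.re by linarith)
    have h2 : √(x ^ 2 + w.im ^ 2) ≤ ‖w‖ := by
      rw [norm_def, normSq_apply]
      refine Real.sqrt_le_sqrt ?_
      nlinarith
    have h3 : 0 < √(x ^ 2 + w.im ^ 2) := Real.sqrt_pos.mpr (by positivity)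
    rw [← div_eq_mul_inv, le_div_iff₀ h3]
    calc ‖g w‖ * √(x ^ 2 + w.im ^ 2) ≤ ‖g w‖ * ‖w‖ := by gcongr
      _ ≤ C := by rwa [mul_comm]
  have hd : ∀ w ∈ rightHalfPlane, DifferentiableAt ℂ g w := fun w hw =>
    (hg w hw).differentiableAt (isOpen_rightHalfPlane.mem_nhds hw)
  have key := integral_vertical_eq (Ψ := fun ξ => g (p + ξ) * conj (g (conj ((p : ℂ) - ξ))))
    (d := 1 / 2) (B := C ^ 2 * (1 + (x ^ 2)⁻¹)) (by norm_num) ?_ ?_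
  · have e1 : ∀ y : ℝ, g (1 + (x + y * I)) * conj (g (x + y * I))
        = g (p + ((1 / 2 : ℝ) + y * I)) * conj (g (conj ((p : ℂ) - ((1 / 2 : ℝ) + y * I)))) := by
      intro y
      have a1 : (p : ℂ) + ((1 / 2 : ℝ) + y * I) = 1 + (x + y * I) := by
        rw [hp]; push_cast; ring
      have a2 : conj ((p : ℂ) - ((1 / 2 : ℝ) + y * I)) = x + y * I := by
        rw [hp]
        apply Complex.ext <;> simp
      rw [a1, a2]
    have e2 : ∀ y : ℝ, g (p + y * I) * conj (g (conj ((p : ℂ) - y * I)))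
        = ((‖g (p + y * I)‖ ^ 2 : ℝ) : ℂ) := by
      intro y
      have a2 : conj ((p : ℂ) - y * I) = p + y * I := by
        apply Complex.ext <;> simp
      rw [a2, mul_conj, normSq_eq_norm_sq]
    calc _ = ∫ y : ℝ, g (p + ((1 / 2 : ℝ) + y * I)) *
          conj (g (conj ((p : ℂ) - ((1 / 2 : ℝ) + y * I)))) := integral_congr_ae
            (Eventually.of_forall e1)
      _ = _ := key
      _ = ∫ y : ℝ, ((‖g (p + y * I)‖ ^ 2 : ℝ) : ℂ) := integral_congr_ae (Eventually.of_forall e2)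
      _ = _ := integral_ofReal
  · intro ξ h0 h1
    refine DifferentiableAt.mul ?_ ?_
    · exact DifferentiableAt.comp (g := g) (f := fun ξ => (p : ℂ) + ξ) ξ (hd _ (hm1 ξ h0 h1))
        (by fun_prop)
    · have h2 : DifferentiableAt ℂ (fun w => conj (g (conj w))) ((p : ℂ) - ξ) := by
        have := (hd _ (hm2 ξ h0 h1)).conj_conj
        rwa [conj_conj] at this
      exact DifferentiableAt.comp (g := fun w => conj (g (conj w))) (f := fun ξ => (p : ℂ) - ξ) ξ
        h2 (by fun_prop)
  · intro ξ h0 h1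
    have b1 := hbound (p + ξ) (by rw [add_re, ofReal_re]; linarith)
    have b2 := hbound (conj ((p : ℂ) - ξ)) (by rw [conj_re, sub_re, ofReal_re]; linarith)
    have i1 : (p + ξ).im = ξ.im := by simp
    have i2 : (conj ((p : ℂ) - ξ)).im = ξ.im := by simp
    rw [i1] at b1
    rw [i2] at b2
    rw [norm_mul, RCLike.norm_conj]
    calc _ ≤ (C * (√(x ^ 2 + ξ.im ^ 2))⁻¹) * (C * (√(x ^ 2 + ξ.im ^ 2))⁻¹) :=
          mul_le_mul b1 b2 (norm_nonneg _) (by positivity)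
      _ = C ^ 2 * (x ^ 2 + ξ.im ^ 2)⁻¹ := by
          have := Real.mul_self_sqrt (show 0 ≤ x ^ 2 + ξ.im ^ 2 by positivity)
          rw [mul_mul_mul_comm, ← mul_inv, this, sq C]
      _ ≤ C ^ 2 * ((1 + (x ^ 2)⁻¹) * (1 + ξ.im ^ 2)⁻¹) := by
          gcongr
          rw [← div_eq_mul_inv, le_div_iff₀ (by positivity), inv_mul_le_iff₀ (by positivity)]
          have : 0 < x ^ 2 := by positivity
          have e : x ^ 2 * (x ^ 2)⁻¹ = 1 := mul_inv_cancel₀ this.ne'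
          have : 0 ≤ (x ^ 2)⁻¹ * ξ.im ^ 2 := by positivity
          nlinarith
      _ = _ := by ring

/-- The density of the energy form. -/
def energyDensity (s : ℝ) (G H : ℂ → ℂ) (v : ℂ) : ℂ :=
  deriv G v * conj (deriv H v) * ((v.re ^ s : ℝ) : ℂ)

/-- The energy form `∫_Π G' conj(H') (Re v)^s dA(v)`, for `s = 2β`. -/
def energy (s : ℝ) (G H : ℂ → ℂ) : ℂ :=
  ∫ v in rightHalfPlane, energyDensity s G H v

theorem deriv_congr_of_mem {G H : ℂ → ℂ} (h : ∀ v ∈ rightHalfPlane, G v = H v) {v : ℂ}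
    (hv : v ∈ rightHalfPlane) : deriv G v = deriv H v :=
  Filter.EventuallyEq.deriv_eq
    (Filter.eventually_of_mem (isOpen_rightHalfPlane.mem_nhds hv) h)

theorem energy_congr {s : ℝ} {G H G' H' : ℂ → ℂ} (hG : ∀ v ∈ rightHalfPlane, G v = G' v)
    (hH : ∀ v ∈ rightHalfPlane, H v = H' v) : energy s G H = energy s G' H' :=
  setIntegral_congr_fun isOpen_rightHalfPlane.measurableSet fun v hv => by
    rw [energyDensity, energyDensity, deriv_congr_of_mem hG hv, deriv_congr_of_mem hH hv]

theorem energy_self_eq_ofReal (s : ℝ) (G : ℂ → ℂ) :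
    energy s G G = ((∫ v in rightHalfPlane, ‖deriv G v‖ ^ 2 * v.re ^ s : ℝ) : ℂ) := by
  rw [energy, ← integral_complex_ofReal]
  refine integral_congr_ae (Eventually.of_forall fun v => ?_)
  change energyDensity s G G v = ((‖deriv G v‖ ^ 2 * v.re ^ s : ℝ) : ℂ)
  rw [energyDensity, mul_conj, normSq_eq_norm_sq, ← ofReal_mul]

/-- The form `(G, H) ↦ ⟨G(1 + ·), H⟩` is positive for the energy form. -/
theorem exists_energy_shift_eq {s : ℝ} {G : ℂ → ℂ} {C : ℝ}
    (hG : DifferentiableOn ℂ G rightHalfPlane)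
    (hC : ∀ v ∈ rightHalfPlane, ‖v‖ * ‖deriv G v‖ ≤ C) :
    ∃ P : ℝ, 0 ≤ P ∧ energy s (fun v => G (1 + v)) G = P := by
  by_cases hint : IntegrableOn (energyDensity s (fun v => G (1 + v)) G) rightHalfPlane
  swap
  · exact ⟨0, le_rfl, by rw [energy, integral_undef hint, ofReal_zero]⟩
  have hdG : DifferentiableOn ℂ (deriv G) rightHalfPlane := hG.deriv isOpen_rightHalfPlane
  have hshift : ∀ v : ℂ, deriv (fun v => G (1 + v)) v = deriv G (1 + v) := fun v =>
    deriv_comp_const_add G 1 v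
  let φ : ℂ → ℂ := rightHalfPlane.indicator (energyDensity s (fun v => G (1 + v)) G)
  have hφ : Integrable φ := (integrable_indicator_iff isOpen_rightHalfPlane.measurableSet).mpr hint
  have hmp := volume_preserving_equiv_real_prod.symm
  have e1 : ∫ v, φ v = ∫ q : ℝ × ℝ, φ (measurableEquivRealProd.symm q) :=
    (hmp.integral_comp measurableEquivRealProd.symm.measurableEmbedding φ).symm
  have hφ2 : Integrable fun q : ℝ × ℝ => φ (measurableEquivRealProd.symm q) :=
    hmp.integrable_comp_of_integrable hφ
  have e2 : ∀ x : ℝ, ∫ y : ℝ, φ (measurableEquivRealProd.symm (x, y))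
      = ((Set.indicator (Set.Ioi 0)
        (fun x : ℝ => x ^ s * ∫ y : ℝ, ‖deriv G ((x + 1 / 2 : ℝ) + y * I)‖ ^ 2) x : ℝ) : ℂ) := by
    intro x
    have hco : ∀ y : ℝ, measurableEquivRealProd.symm (x, y) = x + y * I := fun y => by
      apply Complex.ext <;> simp
    by_cases hx : 0 < x
    · rw [Set.indicator_of_mem (show x ∈ Set.Ioi (0 : ℝ) from hx)]
      have hmem : ∀ y : ℝ, (x : ℂ) + y * I ∈ rightHalfPlane := fun y => by
        change 0 < ((x : ℂ) + y * I).re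
        simpa using hx
      have e3 : ∀ y : ℝ, φ (measurableEquivRealProd.symm (x, y))
          = deriv G (1 + (x + y * I)) * conj (deriv G (x + y * I)) * ((x ^ s : ℝ) : ℂ) := by
        intro y
        simp only [φ]
        rw [hco, Set.indicator_of_mem (hmem y), energyDensity, hshift]
        congr 4
        simp
      rw [integral_congr_ae (Eventually.of_forall e3), integral_mul_const,
        integral_shift_eq hdG hC hx, ← ofReal_mul, mul_comm]
    · rw [Set.indicator_of_notMem (show x ∉ Set.Ioi (0 : ℝ) from hx), ofReal_zero]
      have e3 : ∀ y : ℝ, φ (measurableEquivRealProd.symm (x, y)) = 0 := by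
        intro y
        simp only [φ]
        rw [hco, Set.indicator_of_notMem]
        intro h
        have : 0 < ((x : ℂ) + y * I).re := h
        simp only [add_re, ofReal_re, mul_re, I_re, mul_zero, ofReal_im, I_im, mul_one, sub_self,
          add_zero] at this
        exact hx this
      rw [integral_congr_ae (Eventually.of_forall e3), integral_zero]
  refine ⟨∫ x : ℝ, (Set.indicator (Set.Ioi 0)
        (fun x : ℝ => x ^ s * ∫ y : ℝ, ‖deriv G ((x + 1 / 2 : ℝ) + y * I)‖ ^ 2) x : ℝ),
    integral_nonneg fun x => Set.indicator_nonneg (fun x hx => mul_nonneg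
      (Real.rpow_nonneg (le_of_lt hx) _) (integral_nonneg fun y => by positivity)) x, ?_⟩
  rw [energy, ← integral_indicator isOpen_rightHalfPlane.measurableSet]
  change ∫ v, φ v = _
  rw [e1, Measure.volume_eq_prod, integral_prod _ hφ2, ← integral_complex_ofReal]
  exact integral_congr_ae (Eventually.of_forall e2)

end Energy

/-! ### Logarithmic coordinates and the symmetry under the spin flip -/

section LogCoordinates

open Filter Topology Metric MeasureTheory Complex
open scoped ComplexConjugate

/-- The strip `|Im ζ| < π/2`, which `exp` maps bijectively onto `Π`. -/
def strip : Set ℂ := {ζ | |ζ.im| < Real.pi / 2}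

theorem mem_strip_iff {ζ : ℂ} : ζ ∈ strip ↔ ζ.im ∈ Set.Ioo (-(Real.pi / 2)) (Real.pi / 2) := by
  rw [Set.mem_Ioo, ← abs_lt]
  rfl

theorem isOpen_strip : IsOpen strip :=
  isOpen_lt (continuous_abs.comp continuous_im) continuous_const

theorem exp_mem_rightHalfPlane {ζ : ℂ} (hζ : ζ ∈ strip) : exp ζ ∈ rightHalfPlane := by
  change 0 < (exp ζ).re
  rw [exp_re]
  exact mul_pos (Real.exp_pos _) (Real.cos_pos_of_mem_Ioo (mem_strip_iff.mp hζ))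

theorem neg_mem_strip {ζ : ℂ} (hζ : ζ ∈ strip) : -ζ ∈ strip := by
  change |(-ζ).im| < _
  rw [neg_im, abs_neg]
  exact hζ

theorem log_exp_of_mem_strip {ζ : ℂ} (hζ : ζ ∈ strip) : log (exp ζ) = ζ := by
  have h := mem_strip_iff.mp hζ
  have := Real.pi_pos
  exact log_exp (by linarith [h.1]) (by linarith [h.2])

theorem image_exp_strip : exp '' strip = rightHalfPlane := by
  refine Set.Subset.antisymm ?_ fun v hv => ?_
  · rintro _ ⟨ζ, hζ, rfl⟩
    exact exp_mem_rightHalfPlane hζ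
  · refine ⟨log v, ?_, exp_log (ne_zero_of_mem hv)⟩
    change |(log v).im| < _
    rw [log_im]
    exact abs_arg_lt_pi_div_two_iff.mpr (Or.inl hv)

theorem injOn_exp_strip : Set.InjOn exp strip := fun ζ hζ ξ hξ h => by
  rw [← log_exp_of_mem_strip hζ, h, log_exp_of_mem_strip hξ]

theorem abs_det_exp (ζ : ℂ) :
    |((ContinuousLinearMap.toSpanSingleton ℂ (exp ζ)).restrictScalars ℝ).det| = ‖exp ζ‖ ^ 2 := by
  have : ((ContinuousLinearMap.toSpanSingleton ℂ (exp ζ)).restrictScalars ℝ).det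
      = ‖exp ζ‖ ^ 2 := by
    rw [ContinuousLinearMap.det, ContinuousLinearMap.coe_restrictScalars,
      LinearMap.det_restrictScalars]
    have : LinearMap.det ((ContinuousLinearMap.toSpanSingleton ℂ (exp ζ) : ℂ →L[ℂ] ℂ) : ℂ →ₗ[ℂ] ℂ)
        = exp ζ := by
      rw [LinearMap.det_ring]
      simp
    rw [this, Algebra.norm_complex_eq]
    exact normSq_eq_norm_sq _
  rw [this, abs_of_nonneg (by positivity)]

theorem hasFDerivWithinAt_exp_strip (ζ : ℂ) : HasFDerivWithinAt exp
    ((ContinuousLinearMap.toSpanSingleton ℂ (exp ζ)).restrictScalars ℝ) strip ζ :=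
  ((hasDerivAt_exp ζ).hasFDerivAt.restrictScalars ℝ).hasFDerivWithinAt

theorem integrableOn_rightHalfPlane_iff (φ : ℂ → ℂ) : IntegrableOn φ rightHalfPlane ↔
    IntegrableOn (fun ζ => ‖exp ζ‖ ^ 2 • φ (exp ζ)) strip := by
  rw [← image_exp_strip, integrableOn_image_iff_integrableOn_abs_det_fderiv_smul volume
    isOpen_strip.measurableSet (fun ζ _ => hasFDerivWithinAt_exp_strip ζ) injOn_exp_strip]
  simp only [abs_det_exp]

theorem setIntegral_rightHalfPlane_eq (φ : ℂ → ℂ) : ∫ v in rightHalfPlane, φ v =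
    ∫ ζ in strip, ‖exp ζ‖ ^ 2 • φ (exp ζ) := by
  rw [← image_exp_strip, integral_image_eq_integral_abs_det_fderiv_smul volume
    isOpen_strip.measurableSet (fun ζ _ => hasFDerivWithinAt_exp_strip ζ) injOn_exp_strip]
  simp only [abs_det_exp]

theorem integrable_exp_neg_mul_abs {s : ℝ} (hs : 0 < s) :
    Integrable fun x : ℝ => Real.exp (-(s * |x|)) := by
  rw [← integrableOn_univ, ← Set.Iic_union_Ioi (a := (0 : ℝ))]
  refine IntegrableOn.union ?_ ?_
  · refine (integrableOn_exp_mul_Iic hs 0).congr_fun (fun x hx => ?_) measurableSet_Iic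
    simp only [abs_of_nonpos (show x ≤ 0 from hx), mul_neg, neg_neg]
  · refine (integrableOn_exp_mul_Ioi (neg_lt_zero.mpr hs) 0).congr_fun (fun x hx => ?_)
      measurableSet_Ioi
    simp only [abs_of_pos (show 0 < x from hx), neg_mul]

theorem measurableEquivRealProd_symm_eq (x y : ℝ) :
    measurableEquivRealProd.symm (x, y) = x + y * I := by
  apply Complex.ext <;> simp

theorem integrableOn_strip {f : ℂ → ℂ} {s B : ℝ} (hs : 0 < s) (hf : ContinuousOn f strip)
    (hB : ∀ ζ ∈ strip, ‖f ζ‖ ≤ B * Real.exp (-(s * |ζ.re|))) : IntegrableOn f strip := by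
  have h1 : IntegrableOn (fun ζ : ℂ => B * Real.exp (-(s * |ζ.re|))) strip := by
    rw [← integrable_indicator_iff isOpen_strip.measurableSet]
    have hmp := volume_preserving_equiv_real_prod
    have h2 : Integrable (fun q : ℝ × ℝ => (B * Real.exp (-(s * |q.1|))) *
        (Set.Ioo (-(Real.pi / 2)) (Real.pi / 2)).indicator (fun _ => (1 : ℝ)) q.2) :=
      Integrable.mul_prod ((integrable_exp_neg_mul_abs hs).const_mul B)
        ((integrable_indicator_iff measurableSet_Ioo).mpr (by simp))
    refine (hmp.integrable_comp_of_integrable h2).congr (Eventually.of_forall fun ζ => ?_)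
    simp only [Function.comp_apply, measurableEquivRealProd_apply]
    by_cases hζ : ζ ∈ strip
    · rw [Set.indicator_of_mem hζ, Set.indicator_of_mem (mem_strip_iff.mp hζ), mul_one]
    · rw [Set.indicator_of_notMem hζ, Set.indicator_of_notMem (fun h => hζ (mem_strip_iff.mpr h)),
        mul_zero]
  exact Integrable.mono' h1 (hf.aestronglyMeasurable isOpen_strip.measurableSet)
    ((ae_restrict_iff' isOpen_strip.measurableSet).mpr (Eventually.of_forall hB))

/-- Holomorphic functions on `Π` that decay like `|1 + v|^{-s}`, with a corresponding bound for
`v G'(v)`. For `s = 2β` this class is invariant under the spin flip. -/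
def Tame (s : ℝ) (G : ℂ → ℂ) : Prop :=
  DifferentiableOn ℂ G rightHalfPlane ∧ ∃ C, ∀ v ∈ rightHalfPlane,
    ‖G v‖ ≤ C * ‖1 + v‖ ^ (-s) ∧ ‖v‖ * ‖deriv G v‖ ≤ C * ‖1 + v‖ ^ (-s)

theorem Tame.hasDerivAt {s : ℝ} {G : ℂ → ℂ} (hG : Tame s G) {v : ℂ} (hv : v ∈ rightHalfPlane) :
    HasDerivAt G (deriv G v) v :=
  ((hG.1 v hv).differentiableAt (isOpen_rightHalfPlane.mem_nhds hv)).hasDerivAt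

theorem Tame.add {s : ℝ} {G H : ℂ → ℂ} (hG : Tame s G) (hH : Tame s H) :
    Tame s (fun v => G v + H v) := by
  obtain ⟨C, hC⟩ := hG.2
  obtain ⟨C', hC'⟩ := hH.2
  refine ⟨hG.1.add hH.1, C + C', fun v hv => ⟨?_, ?_⟩⟩
  · rw [add_mul]
    exact (norm_add_le _ _).trans (add_le_add (hC v hv).1 (hC' v hv).1)
  · rw [((hG.hasDerivAt hv).fun_add (hH.hasDerivAt hv)).deriv, add_mul]
    calc _ ≤ ‖v‖ * (‖deriv G v‖ + ‖deriv H v‖) := by gcongr; exact norm_add_le _ _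
      _ ≤ _ := by rw [mul_add]; exact add_le_add (hC v hv).2 (hC' v hv).2

theorem Tame.congr {s : ℝ} {G H : ℂ → ℂ} (hG : Tame s G) (h : ∀ v ∈ rightHalfPlane, G v = H v) :
    Tame s H := by
  obtain ⟨C, hC⟩ := hG.2
  refine ⟨hG.1.congr fun v hv => (h v hv).symm, C, fun v hv => ?_⟩
  rw [← h v hv, ← deriv_congr_of_mem h hv]
  exact hC v hv

theorem Tame.norm_mul_deriv_le {s : ℝ} (hs : 0 ≤ s) {G : ℂ → ℂ} (hG : Tame s G) :
    ∃ C, ∀ v ∈ rightHalfPlane, ‖v‖ * ‖deriv G v‖ ≤ C := by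
  obtain ⟨C, hC⟩ := hG.2
  have hC0 : 0 ≤ C := by
    have h1 := (norm_nonneg _).trans (hC 1 one_mem_rightHalfPlane).1
    have h2 : 0 < ‖(1 : ℂ) + 1‖ ^ (-s) := Real.rpow_pos_of_pos (by norm_num) _
    exact nonneg_of_mul_nonneg_left h1 h2
  refine ⟨C, fun v hv => (hC v hv).2.trans ?_⟩
  exact mul_le_of_le_one_right hC0
    (Real.rpow_le_one_of_one_le_of_nonpos (one_le_norm_one_add hv) (by linarith))

theorem hasDerivAt_spinFlip (β : ℝ≥0) {G : ℂ → ℂ} {v d : ℂ} (hv : v ∈ rightHalfPlane)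
    (hG : HasDerivAt G d (1 / v)) : HasDerivAt (spinFlip β G)
      (-(1 / v ^ ((2 * (β : ℝ) : ℝ) : ℂ)) * (1 / v) *
        (((2 * (β : ℝ) : ℝ) : ℂ) * G (1 / v) + 1 / v * d)) v := by
  have hv0 := ne_zero_of_mem hv
  set s : ℂ := ((2 * (β : ℝ) : ℝ) : ℂ) with hs
  have h1 : HasDerivAt (fun w : ℂ => 1 / w) (-(1 / v) * (1 / v)) v := by
    have := (hasDerivAt_id v).fun_inv hv0
    simp only [id, ← one_div] at this
    refine this.congr_deriv ?_
    field_simp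
  have h2 : HasDerivAt (fun w : ℂ => w ^ (-s)) (-s * v ^ (-s - 1) * 1) v :=
    (hasDerivAt_id v).cpow_const (mem_slitPlane_of_mem hv)
  have h3 : HasDerivAt (fun w : ℂ => G (1 / w)) (d * (-(1 / v) * (1 / v))) v := by
    exact HasDerivAt.comp (h₂ := G) (h := fun w : ℂ => 1 / w) v hG h1
  have h4 : spinFlip β G = fun w => w ^ (-s) * G (1 / w) := by
    funext w
    rw [spinFlip, Complex.cpow_neg, one_div, hs]
  rw [h4]
  refine (h2.mul h3).congr_deriv ?_
  rw [Complex.cpow_sub _ _ hv0, Complex.cpow_one, Complex.cpow_neg]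
  field_simp
  ring

theorem norm_cpow_mul_norm_one_add (β : ℝ≥0) {v : ℂ} (hv : v ∈ rightHalfPlane) :
    ‖1 / v ^ ((2 * (β : ℝ) : ℝ) : ℂ)‖ * ‖1 + 1 / v‖ ^ (-(2 * (β : ℝ)))
      = ‖1 + v‖ ^ (-(2 * (β : ℝ))) := by
  have hv0 := ne_zero_of_mem hv
  rw [norm_div, norm_one, norm_cpow_real, one_div, ← Real.rpow_neg (norm_nonneg _),
    ← Real.mul_rpow (norm_nonneg _) (norm_nonneg _), ← norm_mul]
  congr 2
  field_simp
  ring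

theorem Tame.spinFlip {β : ℝ≥0} {G : ℂ → ℂ} (hG : Tame (2 * β) G) :
    Tame (2 * β) (spinFlip β G) := by
  obtain ⟨C, hC⟩ := hG.2
  have hd : ∀ v ∈ rightHalfPlane, _ := fun v hv =>
    hasDerivAt_spinFlip β hv (hG.hasDerivAt (inv_mem hv))
  have hs : (0 : ℝ) ≤ 2 * (β : ℝ) := by positivity
  have hC0 : ∀ v ∈ rightHalfPlane, 0 ≤ C * ‖1 + v‖ ^ (-(2 * (β : ℝ))) := fun v hv =>
    (norm_nonneg _).trans (hC v hv).1
  refine ⟨fun v hv => (hd v hv).differentiableAt.differentiableWithinAt,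
    (2 * (β : ℝ) + 1) * C, fun v hv => ?_⟩
  have hv0 := ne_zero_of_mem hv
  have h1 := hC _ (inv_mem hv)
  have h2 := norm_cpow_mul_norm_one_add β hv
  have hA := norm_nonneg (1 / v ^ ((2 * (β : ℝ) : ℝ) : ℂ))
  constructor
  · rw [FareyChain.spinFlip, norm_mul]
    calc _ ≤ ‖1 / v ^ ((2 * (β : ℝ) : ℝ) : ℂ)‖ * (C * ‖1 + 1 / v‖ ^ (-(2 * (β : ℝ)))) := by
          gcongr; exact h1.1
      _ = C * ‖1 + v‖ ^ (-(2 * (β : ℝ))) := by rw [← h2]; ring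
      _ ≤ _ := by nlinarith [hC0 v hv]
  · rw [(hd v hv).deriv, norm_mul, norm_mul, norm_neg]
    have h3 : ‖v‖ * ‖1 / v‖ = 1 := by
      rw [← norm_mul, mul_one_div_cancel hv0, norm_one]
    have h4 : ‖((2 * (β : ℝ) : ℝ) : ℂ) * G (1 / v) + 1 / v * deriv G (1 / v)‖
        ≤ (2 * (β : ℝ) + 1) * (C * ‖1 + 1 / v‖ ^ (-(2 * (β : ℝ)))) := by
      refine (norm_add_le _ _).trans ?_
      rw [norm_mul, norm_mul, norm_real, Real.norm_of_nonneg hs, add_mul, one_mul]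
      exact add_le_add (mul_le_mul_of_nonneg_left h1.1 hs) h1.2
    calc _ = (‖v‖ * ‖1 / v‖) * (‖1 / v ^ ((2 * (β : ℝ) : ℝ) : ℂ)‖ *
          ‖((2 * (β : ℝ) : ℝ) : ℂ) * G (1 / v) + 1 / v * deriv G (1 / v)‖) := by ring
      _ ≤ 1 * (‖1 / v ^ ((2 * (β : ℝ) : ℝ) : ℂ)‖ *
          ((2 * (β : ℝ) + 1) * (C * ‖1 + 1 / v‖ ^ (-(2 * (β : ℝ)))))) := by
          rw [h3]; gcongr
      _ = _ := by rw [← h2]; ring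

theorem spinFlip_spinFlip (β : ℝ≥0) (G : ℂ → ℂ) {v : ℂ} (hv : v ∈ rightHalfPlane) :
    spinFlip β (spinFlip β G) v = G v := by
  rw [spinFlip, spinFlip, one_div_one_div, inv_cpow_of_mem hv]
  field_simp [cpow_ne_zero_of_mem hv]

/-- The function `e^{sζ/2} G(e^ζ)` on the strip. For `s = 2β`, the spin flip of `G` corresponds to
the reflection `ζ ↦ -ζ`. -/
def logLift (s : ℝ) (G : ℂ → ℂ) (ζ : ℂ) : ℂ := exp ((s / 2 : ℝ) * ζ) * G (exp ζ)

/-- The derivative of `logLift s G`. -/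
def logLiftDeriv (s : ℝ) (G : ℂ → ℂ) (ζ : ℂ) : ℂ :=
  exp ((s / 2 : ℝ) * ζ) * ((s / 2 : ℝ) * G (exp ζ) + exp ζ * deriv G (exp ζ))

theorem Tame.hasDerivAt_logLift {s : ℝ} {G : ℂ → ℂ} (hG : Tame s G) {ζ : ℂ} (hζ : ζ ∈ strip) :
    HasDerivAt (logLift s G) (logLiftDeriv s G ζ) ζ := by
  have h1 : HasDerivAt (fun ζ => exp ((s / 2 : ℝ) * ζ)) (exp ((s / 2 : ℝ) * ζ) * (s / 2 : ℝ)) ζ := by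
    simpa using ((hasDerivAt_id ζ).const_mul ((s / 2 : ℝ) : ℂ)).cexp
  have h2 : HasDerivAt (fun ζ => G (exp ζ)) (deriv G (exp ζ) * exp ζ) ζ :=
    HasDerivAt.comp (h₂ := G) (h := exp) ζ (hG.hasDerivAt (exp_mem_rightHalfPlane hζ))
      (hasDerivAt_exp ζ)
  refine (h1.mul h2).congr_deriv ?_
  rw [logLiftDeriv]
  ring

theorem continuousOn_logLift {s : ℝ} {G : ℂ → ℂ} (hG : Tame s G) :
    ContinuousOn (logLift s G) strip := fun _ hζ =>
  (hG.hasDerivAt_logLift hζ).continuousAt.continuousWithinAt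

theorem continuousOn_logLiftDeriv {s : ℝ} {G : ℂ → ℂ} (hG : Tame s G) :
    ContinuousOn (logLiftDeriv s G) strip := by
  have hm : Set.MapsTo exp strip rightHalfPlane := fun ζ hζ => exp_mem_rightHalfPlane hζ
  have h1 : ContinuousOn (fun ζ => G (exp ζ)) strip :=
    hG.1.continuousOn.comp continuous_exp.continuousOn hm
  have h2 : ContinuousOn (fun ζ => deriv G (exp ζ)) strip :=
    (hG.1.deriv isOpen_rightHalfPlane).continuousOn.comp continuous_exp.continuousOn hm
  have h3 : ContinuousOn (fun ζ : ℂ => exp ((s / 2 : ℝ) * ζ)) strip := by fun_prop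
  exact h3.mul ((continuousOn_const.mul h1).add (continuous_exp.continuousOn.mul h2))

theorem exp_mul_norm_rpow_le {s : ℝ} (hs : 0 ≤ s) {ζ : ℂ} (hζ : ζ ∈ strip) :
    ‖exp ((s / 2 : ℝ) * ζ)‖ * ‖1 + exp ζ‖ ^ (-s) ≤ Real.exp (-(s / 2 * |ζ.re|)) := by
  have hv := exp_mem_rightHalfPlane hζ
  rw [norm_exp, re_ofReal_mul]
  have h1 := one_le_norm_one_add hv
  have h2 : Real.exp ζ.re ≤ ‖1 + exp ζ‖ := by
    rw [← norm_exp, add_comm]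
    have := norm_le_norm_add_ofReal (le_of_lt hv) zero_le_one
    simpa using this
  rcases le_total 0 ζ.re with h | h
  · have h3 : ‖1 + exp ζ‖ ^ (-s) ≤ Real.exp ζ.re ^ (-s) :=
      Real.rpow_le_rpow_of_nonpos (Real.exp_pos _) h2 (by linarith)
    rw [← Real.exp_mul] at h3
    calc _ ≤ Real.exp (s / 2 * ζ.re) * Real.exp (ζ.re * -s) := by gcongr
      _ = _ := by rw [← Real.exp_add, abs_of_nonneg h]; congr 1; ring
  · have h3 : ‖1 + exp ζ‖ ^ (-s) ≤ 1 :=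
      Real.rpow_le_one_of_one_le_of_nonpos h1 (by linarith)
    calc _ ≤ Real.exp (s / 2 * ζ.re) * 1 := by gcongr
      _ = _ := by rw [mul_one, abs_of_nonpos h]; congr 1; ring

theorem Tame.exists_norm_logLift_le {s : ℝ} (hs : 0 ≤ s) {G : ℂ → ℂ} (hG : Tame s G) :
    ∃ B, 0 ≤ B ∧ ∀ ζ ∈ strip, ‖logLift s G ζ‖ ≤ B * Real.exp (-(s / 2 * |ζ.re|)) ∧
      ‖logLiftDeriv s G ζ‖ ≤ B * Real.exp (-(s / 2 * |ζ.re|)) := by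
  obtain ⟨C, hC⟩ := hG.2
  have hC0 : 0 ≤ C := by
    have h1 := (norm_nonneg _).trans (hC 1 one_mem_rightHalfPlane).1
    have h2 : 0 < ‖(1 : ℂ) + 1‖ ^ (-s) := Real.rpow_pos_of_pos (by norm_num) _
    exact nonneg_of_mul_nonneg_left h1 h2
  refine ⟨(s / 2 + 1) * C, by positivity, fun ζ hζ => ?_⟩
  have h1 := hC _ (exp_mem_rightHalfPlane hζ)
  have h2 := exp_mul_norm_rpow_le hs hζ
  have hE := Real.exp_pos (-(s / 2 * |ζ.re|))
  constructor
  · rw [logLift, norm_mul]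
    calc _ ≤ ‖exp ((s / 2 : ℝ) * ζ)‖ * (C * ‖1 + exp ζ‖ ^ (-s)) := by gcongr; exact h1.1
      _ = C * (‖exp ((s / 2 : ℝ) * ζ)‖ * ‖1 + exp ζ‖ ^ (-s)) := by ring
      _ ≤ C * Real.exp (-(s / 2 * |ζ.re|)) := by gcongr
      _ ≤ (s / 2 + 1) * C * Real.exp (-(s / 2 * |ζ.re|)) := by
          gcongr
          nlinarith
  · have h3 : ‖((s / 2 : ℝ) : ℂ) * G (exp ζ) + exp ζ * deriv G (exp ζ)‖
        ≤ (s / 2 + 1) * (C * ‖1 + exp ζ‖ ^ (-s)) := by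
      refine (norm_add_le _ _).trans ?_
      rw [norm_mul, norm_mul, norm_real, Real.norm_of_nonneg (by positivity), add_mul, one_mul]
      exact add_le_add (mul_le_mul_of_nonneg_left h1.1 (by positivity)) h1.2
    rw [logLiftDeriv, norm_mul]
    calc _ ≤ ‖exp ((s / 2 : ℝ) * ζ)‖ * ((s / 2 + 1) * (C * ‖1 + exp ζ‖ ^ (-s))) := by gcongr
      _ = (s / 2 + 1) * C * (‖exp ((s / 2 : ℝ) * ζ)‖ * ‖1 + exp ζ‖ ^ (-s)) := by ring
      _ ≤ _ := by gcongr

theorem logLift_spinFlip (β : ℝ≥0) (G : ℂ → ℂ) {ζ : ℂ} (hζ : ζ ∈ strip) :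
    logLift (2 * β) (spinFlip β G) ζ = logLift (2 * β) G (-ζ) := by
  rw [logLift, logLift, spinFlip, cpow_def_of_ne_zero (exp_ne_zero ζ), log_exp_of_mem_strip hζ,
    one_div, one_div, ← exp_neg, ← exp_neg, ← mul_assoc, ← exp_add]
  congr 2
  push_cast
  ring

theorem Tame.logLiftDeriv_spinFlip {β : ℝ≥0} {G : ℂ → ℂ} (hG : Tame (2 * β) G) {ζ : ℂ}
    (hζ : ζ ∈ strip) :
    logLiftDeriv (2 * β) (FareyChain.spinFlip β G) ζ = -logLiftDeriv (2 * β) G (-ζ) := by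
  have h1 := hG.spinFlip.hasDerivAt_logLift hζ
  have h2 : HasDerivAt (fun ξ => logLift (2 * β) G (-ξ)) (logLiftDeriv (2 * β) G (-ζ) * -1) ζ :=
    HasDerivAt.comp (h₂ := logLift (2 * β) G) (h := fun ξ : ℂ => -ξ) ζ
      (hG.hasDerivAt_logLift (neg_mem_strip hζ)) (hasDerivAt_neg ζ)
  have h3 : logLift (2 * β) (FareyChain.spinFlip β G) =ᶠ[𝓝 ζ] fun ξ => logLift (2 * β) G (-ξ) :=
    Filter.eventually_of_mem (isOpen_strip.mem_nhds hζ) fun ξ hξ => logLift_spinFlip β G hξ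
  rw [h1.unique (h2.congr_of_eventuallyEq h3), mul_neg_one]

/-- For `κ = -s/2` this is the energy density of `G` and `H` in the coordinate `ζ = log v`; for
`κ = s/2` and `s = 2β` it is the reflection of the energy density of the spin flips. -/
def logDensity (s κ : ℝ) (G H : ℂ → ℂ) (ζ : ℂ) : ℂ :=
  (logLiftDeriv s G ζ + κ * logLift s G ζ) * conj (logLiftDeriv s H ζ + κ * logLift s H ζ) *
    ((Real.cos ζ.im ^ s : ℝ) : ℂ)

theorem smul_energyDensity_exp {s : ℝ} (G H : ℂ → ℂ) {ζ : ℂ} (hζ : ζ ∈ strip) :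
    ‖exp ζ‖ ^ 2 • energyDensity s G H (exp ζ) = logDensity s (-(s / 2)) G H ζ := by
  have hl : ∀ G : ℂ → ℂ, logLiftDeriv s G ζ + ((-(s / 2) : ℝ) : ℂ) * logLift s G ζ
      = exp ((s / 2 : ℝ) * ζ) * (exp ζ * deriv G (exp ζ)) := fun G => by
    rw [logLiftDeriv, logLift]; push_cast; ring
  have hcos : 0 < Real.cos ζ.im := Real.cos_pos_of_mem_Ioo (mem_strip_iff.mp hζ)
  have hexp : (exp ζ).re ^ s = ‖exp ((s / 2 : ℝ) * ζ)‖ ^ 2 * Real.cos ζ.im ^ s := by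
    rw [exp_re, Real.mul_rpow (Real.exp_pos _).le hcos.le, norm_exp, re_ofReal_mul,
      ← Real.exp_mul, ← Real.exp_nat_mul]
    congr 2
    push_cast
    ring
  rw [logDensity, hl, hl, energyDensity, hexp, real_smul, map_mul, map_mul]
  have e1 := mul_conj' (exp ζ)
  have e2 := mul_conj' (exp ((s / 2 : ℝ) * ζ))
  rw [ofReal_mul, ofReal_pow, ofReal_pow, ← e1, ← e2]
  ring

theorem integrableOn_logDensity {s : ℝ} (hs : 0 < s) (κ : ℝ) {G H : ℂ → ℂ} (hG : Tame s G)
    (hH : Tame s H) : IntegrableOn (logDensity s κ G H) strip := by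
  obtain ⟨B, hB0, hB⟩ := hG.exists_norm_logLift_le hs.le
  obtain ⟨B', hB0', hB'⟩ := hH.exists_norm_logLift_le hs.le
  have hcos : ∀ ζ ∈ strip, 0 < Real.cos ζ.im := fun ζ hζ =>
    Real.cos_pos_of_mem_Ioo (mem_strip_iff.mp hζ)
  refine integrableOn_strip (B := ((1 + |κ|) * B) * ((1 + |κ|) * B')) hs ?_ fun ζ hζ => ?_
  · have h1 : ContinuousOn (fun ζ : ℂ => ((Real.cos ζ.im ^ s : ℝ) : ℂ)) strip :=
      continuous_ofReal.comp_continuousOn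
        ((Real.continuous_cos.comp continuous_im).continuousOn.rpow_const
          fun ζ hζ => Or.inl (hcos ζ hζ).ne')
    have h2 : ∀ {G : ℂ → ℂ}, Tame s G →
        ContinuousOn (fun ζ => logLiftDeriv s G ζ + κ * logLift s G ζ) strip := fun hG =>
      (continuousOn_logLiftDeriv hG).add (continuousOn_const.mul (continuousOn_logLift hG))
    exact ((h2 hG).mul (continuous_conj.comp_continuousOn (h2 hH))).mul h1
  · have hE := Real.exp_pos (-(s / 2 * |ζ.re|))
    have h1 : ∀ {G : ℂ → ℂ} {B : ℝ}, ‖logLift s G ζ‖ ≤ B * Real.exp (-(s / 2 * |ζ.re|)) →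
        ‖logLiftDeriv s G ζ‖ ≤ B * Real.exp (-(s / 2 * |ζ.re|)) →
        ‖logLiftDeriv s G ζ + κ * logLift s G ζ‖
          ≤ (1 + |κ|) * B * Real.exp (-(s / 2 * |ζ.re|)) := by
      intro G B a1 a2
      refine (norm_add_le _ _).trans ?_
      rw [norm_mul, norm_real, Real.norm_eq_abs]
      nlinarith [mul_le_mul_of_nonneg_left a1 (abs_nonneg κ)]
    have h2 : ‖((Real.cos ζ.im ^ s : ℝ) : ℂ)‖ ≤ 1 := by
      rw [norm_real, Real.norm_of_nonneg (Real.rpow_nonneg (hcos ζ hζ).le _)]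
      exact Real.rpow_le_one (hcos ζ hζ).le (Real.cos_le_one _) hs.le
    rw [logDensity, norm_mul, norm_mul, RCLike.norm_conj]
    calc _ ≤ ((1 + |κ|) * B * Real.exp (-(s / 2 * |ζ.re|))) *
          ((1 + |κ|) * B' * Real.exp (-(s / 2 * |ζ.re|))) * 1 := by
          gcongr
          · exact h1 (hB ζ hζ).1 (hB ζ hζ).2
          · exact h1 (hB' ζ hζ).1 (hB' ζ hζ).2
      _ = ((1 + |κ|) * B) * ((1 + |κ|) * B') *
          (Real.exp (-(s / 2 * |ζ.re|)) * Real.exp (-(s / 2 * |ζ.re|))) := by ring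
      _ = _ := by rw [← Real.exp_add]; congr 2; ring

theorem integrableOn_energyDensity {s : ℝ} (hs : 0 < s) {G H : ℂ → ℂ} (hG : Tame s G)
    (hH : Tame s H) : IntegrableOn (energyDensity s G H) rightHalfPlane := by
  rw [integrableOn_rightHalfPlane_iff]
  exact (integrableOn_logDensity hs (-(s / 2)) hG hH).congr_fun
    (fun ζ hζ => (smul_energyDensity_exp G H hζ).symm) isOpen_strip.measurableSet

theorem energy_eq_integral_logDensity (s : ℝ) (G H : ℂ → ℂ) :
    energy s G H = ∫ ζ in strip, logDensity s (-(s / 2)) G H ζ := by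
  rw [energy, setIntegral_rightHalfPlane_eq]
  exact setIntegral_congr_fun isOpen_strip.measurableSet fun ζ hζ => smul_energyDensity_exp G H hζ

theorem energy_spinFlip_eq_integral_logDensity {β : ℝ≥0} {G H : ℂ → ℂ} (hG : Tame (2 * β) G)
    (hH : Tame (2 * β) H) : energy (2 * β) (spinFlip β G) (spinFlip β H)
      = ∫ ζ in strip, logDensity (2 * β) (2 * β / 2) G H ζ := by
  rw [energy_eq_integral_logDensity, ← integral_indicator isOpen_strip.measurableSet,
    ← integral_indicator isOpen_strip.measurableSet, ← integral_neg_eq_self]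
  refine integral_congr_ae (Eventually.of_forall fun ζ => ?_)
  by_cases hζ : ζ ∈ strip
  · have hζ' := neg_mem_strip hζ
    simp only [Set.indicator_of_mem hζ, Set.indicator_of_mem hζ', logDensity,
      logLift_spinFlip β _ hζ', hG.logLiftDeriv_spinFlip hζ', hH.logLiftDeriv_spinFlip hζ', neg_neg,
      neg_im, Real.cos_neg]
    push_cast
    simp only [map_add, map_neg, map_mul]
    ring
  · have hζ' : -ζ ∉ strip := fun h => hζ (by simpa using neg_mem_strip h)
    simp only [Set.indicator_of_notMem hζ, Set.indicator_of_notMem hζ']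

/-- The difference of the two densities is a derivative in the direction of the real axis. -/
theorem integral_logDensity_sub_eq_zero {s : ℝ} (hs : 0 < s) {G H : ℂ → ℂ} (hG : Tame s G)
    (hH : Tame s H) : ∫ ζ in strip,
      (logDensity s (s / 2) G H ζ - logDensity s (-(s / 2)) G H ζ) = 0 := by
  have hint : IntegrableOn (fun ζ => logDensity s (s / 2) G H ζ - logDensity s (-(s / 2)) G H ζ)
      strip := (integrableOn_logDensity hs _ hG hH).sub (integrableOn_logDensity hs _ hG hH)
  obtain ⟨B, hB0, hB⟩ := hG.exists_norm_logLift_le hs.le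
  obtain ⟨B', hB0', hB'⟩ := hH.exists_norm_logLift_le hs.le
  let φ : ℂ → ℂ := strip.indicator
    fun ζ => logDensity s (s / 2) G H ζ - logDensity s (-(s / 2)) G H ζ
  have hφ : Integrable φ := (integrable_indicator_iff isOpen_strip.measurableSet).mpr hint
  have hmp := volume_preserving_equiv_real_prod.symm
  have hφ2 : Integrable fun q : ℝ × ℝ => φ (measurableEquivRealProd.symm q) :=
    hmp.integrable_comp_of_integrable hφ
  rw [← integral_indicator isOpen_strip.measurableSet]
  change ∫ ζ, φ ζ = 0
  rw [← hmp.integral_comp measurableEquivRealProd.symm.measurableEmbedding φ,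
    Measure.volume_eq_prod, integral_prod_symm _ hφ2]
  refine integral_eq_zero_of_ae (Eventually.of_forall fun θ => ?_)
  change ∫ u : ℝ, φ (measurableEquivRealProd.symm (u, θ)) = 0
  simp only [measurableEquivRealProd_symm_eq]
  have him : ∀ u : ℝ, ((u : ℂ) + θ * I).im = θ := fun u => by simp
  have hre : ∀ u : ℝ, ((u : ℂ) + θ * I).re = u := fun u => by simp
  by_cases hθ : |θ| < Real.pi / 2
  swap
  · have : ∀ u : ℝ, φ (u + θ * I) = 0 := fun u =>
      Set.indicator_of_notMem (fun h => hθ (by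
        have : |((u : ℂ) + θ * I).im| < Real.pi / 2 := h
        rwa [him] at this)) _
    simp only [this, integral_zero]
  have hmem : ∀ u : ℝ, (u : ℂ) + θ * I ∈ strip := fun u => by
    change |((u : ℂ) + θ * I).im| < Real.pi / 2
    rwa [him]
  let P : ℝ → ℂ := fun u => logLift s G (u + θ * I) * conj (logLift s H (u + θ * I))
  let P' : ℝ → ℂ := fun u => logLiftDeriv s G (u + θ * I) * conj (logLift s H (u + θ * I)) +
    logLift s G (u + θ * I) * conj (logLiftDeriv s H (u + θ * I))
  have hφP : ∀ u : ℝ, φ (u + θ * I) = P' u * (s * ((Real.cos θ ^ s : ℝ) : ℂ)) := by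
    intro u
    simp only [φ, P', Set.indicator_of_mem (hmem u), logDensity, him, map_add, map_mul, conj_ofReal]
    push_cast
    ring
  have hline : ∀ {G : ℂ → ℂ}, Tame s G → ∀ u : ℝ,
      HasDerivAt (fun u : ℝ => logLift s G (u + θ * I)) (logLiftDeriv s G (u + θ * I)) u := by
    intro G hG u
    have h1 : HasDerivAt (fun ξ : ℂ => logLift s G (ξ + θ * I))
        (logLiftDeriv s G (u + θ * I)) (u : ℂ) :=
      HasDerivAt.comp_add_const (u : ℂ) (θ * I) (hG.hasDerivAt_logLift (hmem u))
    exact h1.comp_ofReal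
  have hP : ∀ u, HasDerivAt P (P' u) u := fun u => (hline hG u).mul (hline hH u).star
  have hcont : ∀ f : ℂ → ℂ, ContinuousOn f strip → Continuous fun u : ℝ => f (u + θ * I) :=
    fun f hf => hf.comp_continuous (by fun_prop) hmem
  have hprod : ∀ (x y : ℂ) (u : ℝ), ‖x‖ ≤ B * Real.exp (-(s / 2 * |u|)) →
      ‖y‖ ≤ B' * Real.exp (-(s / 2 * |u|)) → ‖x * conj y‖ ≤ B * B' * Real.exp (-(s * |u|)) := by
    intro x y u hx hy
    rw [norm_mul, RCLike.norm_conj]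
    calc _ ≤ (B * Real.exp (-(s / 2 * |u|))) * (B' * Real.exp (-(s / 2 * |u|))) :=
          mul_le_mul hx hy (norm_nonneg _) (by positivity)
      _ = B * B' * (Real.exp (-(s / 2 * |u|)) * Real.exp (-(s / 2 * |u|))) := by ring
      _ = _ := by rw [← Real.exp_add]; congr 2; ring
  have cG := hcont _ (continuousOn_logLift hG)
  have cH := hcont _ (continuousOn_logLift hH)
  have cG' := hcont _ (continuousOn_logLiftDeriv hG)
  have cH' := hcont _ (continuousOn_logLiftDeriv hH)
  have hbG : ∀ u : ℝ, _ := fun u => hB _ (hmem u)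
  have hbH : ∀ u : ℝ, _ := fun u => hB' _ (hmem u)
  simp only [hre] at hbG hbH
  have hI := (integrable_exp_neg_mul_abs hs).const_mul (B * B')
  have hPi : Integrable P := hI.mono' (by fun_prop)
    (Eventually.of_forall fun u => hprod _ _ u (hbG u).1 (hbH u).1)
  have hP1 : Integrable fun u : ℝ =>
      logLiftDeriv s G (u + θ * I) * conj (logLift s H (u + θ * I)) :=
    hI.mono' (by fun_prop) (Eventually.of_forall fun u => hprod _ _ u (hbG u).2 (hbH u).1)
  have hP2 : Integrable fun u : ℝ =>
      logLift s G (u + θ * I) * conj (logLiftDeriv s H (u + θ * I)) :=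
    hI.mono' (by fun_prop) (Eventually.of_forall fun u => hprod _ _ u (hbG u).1 (hbH u).2)
  simp only [hφP]
  rw [integral_mul_const, integral_eq_zero_of_hasDerivAt_of_integrable hP (hP1.add hP2) hPi,
    zero_mul]

/-- The spin flip is an isometry for the energy form. -/
theorem energy_spinFlip {β : ℝ≥0} (hβ : 0 < β) {G H : ℂ → ℂ} (hG : Tame (2 * β) G)
    (hH : Tame (2 * β) H) :
    energy (2 * β) (spinFlip β G) (spinFlip β H) = energy (2 * β) G H := by
  have hs : (0 : ℝ) < 2 * β := by positivity
  have h := integral_logDensity_sub_eq_zero hs hG hH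
  rw [integral_sub (integrableOn_logDensity hs _ hG hH) (integrableOn_logDensity hs _ hG hH),
    sub_eq_zero] at h
  rw [energy_spinFlip_eq_integral_logDensity hG hH, energy_eq_integral_logDensity, h]

theorem energy_add_left {s : ℝ} (hs : 0 < s) {G G' H : ℂ → ℂ} (hG : Tame s G) (hG' : Tame s G')
    (hH : Tame s H) : energy s (fun v => G v + G' v) H = energy s G H + energy s G' H := by
  rw [energy, energy, energy, ← integral_add (integrableOn_energyDensity hs hG hH)
    (integrableOn_energyDensity hs hG' hH)]
  refine setIntegral_congr_fun isOpen_rightHalfPlane.measurableSet fun v hv => ?_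
  simp only [energyDensity]
  rw [((hG.hasDerivAt hv).fun_add (hG'.hasDerivAt hv)).deriv]
  ring

theorem energy_const_mul_left (s : ℝ) (c : ℂ) (G H : ℂ → ℂ) :
    energy s (fun v => c * G v) H = c * energy s G H := by
  rw [energy, energy, ← integral_const_mul]
  refine integral_congr_ae (Eventually.of_forall fun v => ?_)
  simp only [energyDensity, deriv_const_mul_field]
  ring

theorem deriv_eq_zero_of_energy_eq_zero {s : ℝ} (hs : 0 < s) {G : ℂ → ℂ} (hG : Tame s G)
    (h : energy s G G = 0) {v : ℂ} (hv : v ∈ rightHalfPlane) : deriv G v = 0 := by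
  have hcont : ContinuousOn (fun v : ℂ => ‖deriv G v‖ ^ 2 * v.re ^ s) rightHalfPlane :=
    ((hG.1.deriv isOpen_rightHalfPlane).continuousOn.norm.pow 2).mul
      (continuous_re.continuousOn.rpow_const fun v hv => Or.inl (ne_of_gt hv))
  have hint : IntegrableOn (fun v : ℂ => ‖deriv G v‖ ^ 2 * v.re ^ s) rightHalfPlane := by
    have h1 : IntegrableOn (fun v => ‖energyDensity s G G v‖) rightHalfPlane :=
      (integrableOn_energyDensity hs hG hG).norm
    refine h1.congr_fun (fun v hv => ?_)
      isOpen_rightHalfPlane.measurableSet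
    have hv' : 0 < v.re := hv
    simp only [energyDensity]
    rw [norm_mul, norm_mul, RCLike.norm_conj, norm_real,
      Real.norm_of_nonneg (Real.rpow_nonneg hv'.le _), sq]
  rw [energy_self_eq_ofReal, ofReal_eq_zero, setIntegral_eq_zero_iff_of_nonneg_ae ?_ hint] at h
  · have h2 : Set.EqOn (fun v : ℂ => ‖deriv G v‖ ^ 2 * v.re ^ s) (fun _ => 0) rightHalfPlane :=
      Measure.eqOn_open_of_ae_eq h isOpen_rightHalfPlane hcont continuousOn_const
    have h3 := h2 hv
    have hv' : 0 < v.re := hv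
    have h4 := (mul_eq_zero.mp h3).resolve_right (Real.rpow_pos_of_pos hv' _).ne'
    exact norm_eq_zero.mp (pow_eq_zero_iff (two_ne_zero) |>.mp h4)
  · refine (ae_restrict_iff' isOpen_rightHalfPlane.measurableSet).mpr
      (Eventually.of_forall fun v hv => ?_)
    have hv' : 0 < v.re := hv
    change 0 ≤ ‖deriv G v‖ ^ 2 * v.re ^ s
    positivity

end LogCoordinates

/-! ### Coupled pairs and eigenfunctions -/

section Pairs

open Filter Topology Metric
open scoped ComplexConjugate

theorem IsClusterPair.symm {β : ℝ≥0} {τ₁ τ₂ : ℂ} {f g : HInf} (h : IsClusterPair β τ₁ τ₂ f g) :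
    IsClusterPair β τ₂ τ₁ g f := ⟨h.2, h.1⟩

theorem IsClusterPair.ev_eq {β : ℝ≥0} {τ₁ τ₂ : ℂ} {f g : HInf} (h : IsClusterPair β τ₁ τ₂ f g)
    {v : ℂ} (hv : v ∈ rightHalfPlane) :
    ev f v = τ₁ * (ev f (1 + v) + spinFlip β (ev g) (1 + v)) := by
  conv_lhs => rw [h.1]
  exact ev_smul_add β τ₁ f g hv

theorem spinFlip_congr (β : ℝ≥0) {G H : ℂ → ℂ} (h : ∀ v ∈ rightHalfPlane, G v = H v) {v : ℂ}
    (hv : v ∈ rightHalfPlane) : spinFlip β G v = spinFlip β H v := by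
  rw [spinFlip, spinFlip, h _ (inv_mem hv)]

theorem spinFlip_add (β : ℝ≥0) (G H : ℂ → ℂ) (v : ℂ) :
    spinFlip β (fun v => G v + H v) v = spinFlip β G v + spinFlip β H v := by
  rw [spinFlip, spinFlip, spinFlip, mul_add]

theorem hasDerivAt_ev (f : HInf) {v : ℂ} (hv : v ∈ rightHalfPlane) :
    HasDerivAt (ev f) (deriv (ev f) v) v :=
  ((ev_differentiableOn f v hv).differentiableAt (isOpen_rightHalfPlane.mem_nhds hv)).hasDerivAt

theorem differentiableOn_spinFlip (β : ℝ≥0) (f : HInf) :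
    DifferentiableOn ℂ (spinFlip β (ev f)) rightHalfPlane := fun _ hv =>
  (hasDerivAt_spinFlip β hv (hasDerivAt_ev f (inv_mem hv))).differentiableAt.differentiableWithinAt

theorem IsClusterPair.exists_norm_le {β : ℝ≥0} {τ₁ τ₂ : ℂ} {f g : HInf}
    (h : IsClusterPair β τ₁ τ₂ f g) (h₁ : IsUnit (1 - τ₁ • Ldown)) :
    ∃ C, 0 ≤ C ∧ ∀ v ∈ rightHalfPlane, ‖ev f v‖ ≤ C * ‖1 + v‖ ^ (-(2 * (β : ℝ))) := by
  obtain ⟨N, hN0, hN⟩ : ∃ N, 0 ≤ N ∧ ∀ v, ‖ev g v‖ ≤ N := ⟨_, norm_nonneg g, norm_ev_le g⟩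
  refine exists_norm_le_rpow h₁ (by positivity) (C := ‖τ₁‖ * N) fun v hv => ?_
  rw [ev_sub, ev_smul, ev_Ldown f hv, h.ev_eq hv, spinFlip]
  have e : τ₁ * (ev f (1 + v) + 1 / (1 + v) ^ ((2 * (β : ℝ) : ℝ) : ℂ) * ev g (1 / (1 + v)))
      - τ₁ * ev f (1 + v)
      = τ₁ * (1 / (1 + v) ^ ((2 * (β : ℝ) : ℝ) : ℂ) * ev g (1 / (1 + v))) := by ring
  rw [e, norm_mul, norm_mul, norm_div, norm_one, Complex.norm_cpow_real, one_div,
    ← Real.rpow_neg (norm_nonneg _)]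
  calc _ ≤ ‖τ₁‖ * (‖1 + v‖ ^ (-(2 * (β : ℝ))) * N) := by
        gcongr
        exact hN _
    _ = _ := by ring

/-- The function `f + S g` is bounded and solves `f = τ₁ L↓(f + S g)`. -/
theorem IsClusterPair.exists_add_spinFlip {β : ℝ≥0} {τ₁ τ₂ : ℂ} {f g : HInf}
    (h : IsClusterPair β τ₁ τ₂ f g) (h₂ : IsUnit (1 - τ₂ • Ldown)) :
    ∃ F : HInf, (∀ v ∈ rightHalfPlane, ev F v = ev f v + spinFlip β (ev g) v) ∧
      f = τ₁ • Ldown F := by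
  obtain ⟨C, hC0, hC⟩ := h.symm.exists_norm_le h₂
  obtain ⟨N, hN0, hN⟩ : ∃ N, 0 ≤ N ∧ ∀ v, ‖ev f v‖ ≤ N := ⟨_, norm_nonneg f, norm_ev_le f⟩
  let F : HInf := HInf.mk (fun v => ev f v + spinFlip β (ev g) v)
    ((ev_differentiableOn f).add (differentiableOn_spinFlip β g)) (N + C) fun v hv => by
      refine (norm_add_le _ _).trans (add_le_add (hN v) ?_)
      rw [spinFlip, norm_mul]
      calc _ ≤ ‖1 / v ^ ((2 * (β : ℝ) : ℝ) : ℂ)‖ * (C * ‖1 + 1 / v‖ ^ (-(2 * (β : ℝ)))) := by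
            gcongr
            exact hC _ (inv_mem hv)
        _ = C * ‖1 + v‖ ^ (-(2 * (β : ℝ))) := by
            rw [← norm_cpow_mul_norm_one_add β hv]; ring
        _ ≤ C := mul_le_of_le_one_right hC0 (Real.rpow_le_one_of_one_le_of_nonpos
            (one_le_norm_one_add hv) (by linarith [show (0 : ℝ) ≤ 2 * β by positivity]))
  have hF : ∀ v ∈ rightHalfPlane, ev F v = ev f v + spinFlip β (ev g) v := fun v hv => ev_mk hv
  refine ⟨F, hF, ev_ext fun v hv => ?_⟩
  rw [h.ev_eq hv, ev_smul, ev_Ldown F hv, hF _ (one_add_mem hv)]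

/-- The function `f + S g` is an eigenfunction of `aL↑ + bL↓`. -/
theorem IsClusterPair.exists_eigenfunction {β : ℝ≥0} {a b z : ℂ} {f g : HInf}
    (h : IsClusterPair β (z * b) (z * a) f g) (hf0 : f ≠ 0)
    (h₂ : IsUnit (1 - (z * a) • Ldown)) :
    ∃ F : HInf, F ≠ 0 ∧ F = z • (a • Lup β F + b • Ldown F) := by
  obtain ⟨F, hF, hfF⟩ := h.exists_add_spinFlip h₂
  refine ⟨F, fun h0 => hf0 (by rw [hfF, h0, map_zero, smul_zero]), ev_ext fun v hv => ?_⟩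
  have hd : z * b * ev F (1 + v) = ev f v := by
    conv_rhs => rw [hfF]
    rw [ev_smul, ev_Ldown F hv]
  have hi := inv_mem hv
  have h1 := one_add_mem hv
  have h1i := one_add_mem hi
  have hg := h.symm.ev_eq hi
  rw [spinFlip] at hg
  rw [ev_smul, ev_add, ev_smul, ev_smul, ev_Lup β F hv, ev_Ldown F hv, hF _ (upMap_mem hv), hF v hv,
    spinFlip, spinFlip, hg, ← hd]
  have hv0 := ne_zero_of_mem hv
  have e1 : v / (1 + v) = 1 / (1 + 1 / v) := by
    rw [div_eq_div_iff (ne_zero_of_mem h1) (ne_zero_of_mem h1i)]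
    field_simp
    ring
  have e2 : 1 / (v / (1 + v)) = 1 + 1 / v := by
    rw [e1, one_div_one_div]
  obtain ⟨s, hs⟩ : ∃ s : ℂ, s = ((2 * (β : ℝ) : ℝ) : ℂ) := ⟨_, rfl⟩
  have e3 : (v / (1 + v)) ^ s = 1 / (1 + 1 / v) ^ s := by
    rw [e1, inv_cpow_of_mem h1i]
  have e4 : (1 + v) ^ s = v ^ s * (1 + 1 / v) ^ s := by
    rw [← mul_cpow_of_mem hv h1i]
    congr 1
    field_simp
    ring
  rw [← hs, e2, e3, e4, e1]
  have n1 := cpow_ne_zero_of_mem hv s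
  have n2 := cpow_ne_zero_of_mem h1i s
  generalize (1 + 1 / v) ^ s = y at n2 ⊢
  generalize ev g (1 + 1 / v) = g₁
  generalize ev f (1 / (1 + 1 / v)) = f₁
  field_simp
  ring

theorem IsClusterPair.exists_norm_deriv_le {β : ℝ≥0} {τ₁ τ₂ : ℂ} {f g : HInf}
    (h : IsClusterPair β τ₁ τ₂ f g) (h₂ : IsUnit (1 - τ₂ • Ldown)) :
    ∃ C, 0 ≤ C ∧ ∀ v ∈ rightHalfPlane, ‖deriv (ev f) v‖ ≤ C := by
  obtain ⟨F, hF, hfF⟩ := h.exists_add_spinFlip h₂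
  obtain ⟨N, hN0, hN⟩ : ∃ N, 0 ≤ N ∧ ∀ v, ‖ev F v‖ ≤ N := ⟨_, norm_nonneg F, norm_ev_le F⟩
  refine ⟨‖τ₁‖ * (N / (1 / 2)), by positivity, fun v hv => ?_⟩
  have hv' : 0 < v.re := hv
  have e1 : deriv (ev f) v = τ₁ * deriv (ev F) (1 + v) := by
    have : ∀ w ∈ rightHalfPlane, ev f w = τ₁ * ev F (1 + w) := fun w hw => by
      conv_lhs => rw [hfF]
      rw [ev_smul, ev_Ldown F hw]
    rw [deriv_congr_of_mem this hv, deriv_const_mul_field, deriv_comp_const_add]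
  have hsub : closedBall (1 + v) (1 / 2) ⊆ rightHalfPlane := by
    intro w hw
    rw [mem_closedBall, dist_eq_norm] at hw
    have h3 := (abs_le.mp ((Complex.abs_re_le_norm _).trans hw)).1
    change 0 < w.re
    simp only [Complex.sub_re, Complex.add_re, Complex.one_re] at h3
    linarith
  rw [e1, norm_mul]
  gcongr
  refine Complex.norm_deriv_le_of_forall_mem_sphere_norm_le (by norm_num) ?_ fun w _ => hN w
  exact ((ev_differentiableOn F).mono (by
    rw [closure_ball _ (by norm_num)]; exact hsub)).diffContOnCl

/-- The derivative of the first equation of a coupled pair. -/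
theorem IsClusterPair.deriv_eq {β : ℝ≥0} {τ₁ τ₂ : ℂ} {f g : HInf}
    (h : IsClusterPair β τ₁ τ₂ f g) {v : ℂ} (hv : v ∈ rightHalfPlane) :
    deriv (ev f) v = τ₁ * (deriv (ev f) (1 + v) +
      -(1 / (1 + v) ^ ((2 * (β : ℝ) : ℝ) : ℂ)) * (1 / (1 + v)) *
        (((2 * (β : ℝ) : ℝ) : ℂ) * ev g (1 / (1 + v)) +
          1 / (1 + v) * deriv (ev g) (1 / (1 + v)))) := by
  have h1 := one_add_mem hv
  rw [deriv_congr_of_mem (fun w hw => h.ev_eq hw) hv]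
  have h2 := (hasDerivAt_ev f h1).comp_const_add 1 v
  have h3 := (hasDerivAt_spinFlip β h1 (hasDerivAt_ev g (inv_mem h1))).comp_const_add 1 v
  exact ((h2.add h3).const_mul τ₁).deriv

theorem IsClusterPair.tame {β : ℝ≥0} {τ₁ τ₂ : ℂ} {f g : HInf} (h : IsClusterPair β τ₁ τ₂ f g)
    (h₁ : IsUnit (1 - τ₁ • Ldown)) (h₂ : IsUnit (1 - τ₂ • Ldown)) : Tame (2 * β) (ev f) := by
  obtain ⟨C, hC0, hC⟩ := h.exists_norm_le h₁
  obtain ⟨B, hB0, hB⟩ := h.exists_norm_deriv_le h₂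
  obtain ⟨B', hB0', hB'⟩ := h.symm.exists_norm_deriv_le h₁
  obtain ⟨N, hN0, hN⟩ : ∃ N, 0 ≤ N ∧ ∀ v, ‖ev g v‖ ≤ N := ⟨_, norm_nonneg g, norm_ev_le g⟩
  have hs : (0 : ℝ) ≤ 2 * (β : ℝ) := by positivity
  let f' : HInf := HInf.mk (deriv (ev f))
    ((ev_differentiableOn f).deriv isOpen_rightHalfPlane) B hB
  have hf' : ∀ v ∈ rightHalfPlane, ev f' v = deriv (ev f) v := fun v hv => ev_mk hv
  obtain ⟨C', hC0', hC'⟩ := exists_norm_le_rpow h₁ (s := 2 * (β : ℝ) + 1) (by positivity) (k := f')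
    (C := ‖τ₁‖ * (2 * (β : ℝ) * N + B')) fun v hv => by
      have h1 := one_add_mem hv
      have hn1 := one_le_norm_one_add hv
      have hinv : ‖1 / (1 + v)‖ ≤ 1 := by
        rw [norm_div, norm_one]
        exact div_le_one_of_le₀ hn1 (norm_nonneg _)
      have e : ‖1 + v‖ ^ (-(2 * (β : ℝ) + 1))
          = ‖1 / (1 + v) ^ ((2 * (β : ℝ) : ℝ) : ℂ)‖ * ‖1 / (1 + v)‖ := by
        rw [neg_add, Real.rpow_add (by linarith), Real.rpow_neg_one, norm_div, norm_div, norm_one,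
          Complex.norm_cpow_real, one_div, one_div, Real.rpow_neg (norm_nonneg _)]
      rw [ev_sub, ev_smul, ev_Ldown f' hv, hf' v hv, hf' _ h1, h.deriv_eq hv, ← mul_sub,
        add_sub_cancel_left, norm_mul, norm_mul, norm_mul, norm_neg, e]
      have h3 : ‖((2 * (β : ℝ) : ℝ) : ℂ) * ev g (1 / (1 + v)) +
          1 / (1 + v) * deriv (ev g) (1 / (1 + v))‖ ≤ 2 * (β : ℝ) * N + B' := by
        refine (norm_add_le _ _).trans ?_
        rw [norm_mul, norm_mul, Complex.norm_real, Real.norm_of_nonneg hs]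
        refine add_le_add (mul_le_mul_of_nonneg_left (hN _) hs) ?_
        calc _ ≤ 1 * B' := mul_le_mul hinv (hB' _ (inv_mem h1)) (norm_nonneg _) zero_le_one
          _ = B' := one_mul _
      calc _ ≤ ‖τ₁‖ * (‖1 / (1 + v) ^ ((2 * (β : ℝ) : ℝ) : ℂ)‖ * ‖1 / (1 + v)‖ *
            (2 * (β : ℝ) * N + B')) := by gcongr
        _ = _ := by ring
  refine ⟨ev_differentiableOn f, C + C', fun v hv => ?_⟩
  have hn1 := one_le_norm_one_add hv
  have hp : 0 ≤ ‖1 + v‖ ^ (-(2 * (β : ℝ))) := Real.rpow_nonneg (norm_nonneg _) _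
  constructor
  · refine (hC v hv).trans ?_
    gcongr
    linarith
  · have h1 := hC' v hv
    rw [hf' v hv] at h1
    have h2 : ‖v‖ ≤ ‖1 + v‖ := by
      have := norm_le_norm_add_ofReal (le_of_lt hv) zero_le_one
      rw [add_comm]
      simpa using this
    calc _ ≤ ‖1 + v‖ * (C' * ‖1 + v‖ ^ (-(2 * (β : ℝ) + 1))) := by gcongr
      _ = C' * ‖1 + v‖ ^ (-(2 * (β : ℝ))) := by
          rw [neg_add, Real.rpow_add (by linarith), Real.rpow_neg_one]
          field_simp
      _ ≤ _ := by gcongr; linarith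

end Pairs

/-! ### Coupled pairs off the positive axis vanish -/

section Vanishing

open Filter Topology Metric

theorem ev_eq_ev_one_of_deriv_eq_zero {f : HInf} (h : ∀ v ∈ rightHalfPlane, deriv (ev f) v = 0)
    {v : ℂ} (hv : v ∈ rightHalfPlane) : ev f v = ev f 1 := by
  have hconv : Convex ℝ rightHalfPlane := convex_halfSpace_re_gt 0
  refine hconv.is_const_of_fderivWithin_eq_zero (𝕜 := ℂ) (ev_differentiableOn f) (fun w hw => ?_) hv
    one_mem_rightHalfPlane
  rw [fderivWithin_of_isOpen isOpen_rightHalfPlane hw]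
  have := (hasDerivAt_ev f hw).hasFDerivAt.fderiv
  rw [this, h w hw]
  ext
  simp

theorem eq_zero_of_tame_of_deriv_eq_zero {s : ℝ} (hs : 0 < s) {f : HInf} (hf : Tame s (ev f))
    (h : ∀ v ∈ rightHalfPlane, deriv (ev f) v = 0) : f = 0 := by
  obtain ⟨C, hC⟩ := hf.2
  have hlim : Tendsto (fun x : ℝ => C * (1 + x) ^ (-s)) atTop (𝓝 (C * 0)) :=
    ((tendsto_rpow_neg_atTop hs).comp (tendsto_atTop_add_const_left _ _ tendsto_id)).const_mul C
  rw [mul_zero] at hlim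
  have h1 : ‖ev f 1‖ ≤ 0 := by
    refine ge_of_tendsto hlim ?_
    filter_upwards [eventually_gt_atTop 0] with x hx
    have h2 := (hC x (ofReal_mem hx)).1
    rw [ev_eq_ev_one_of_deriv_eq_zero h (ofReal_mem hx)] at h2
    have h3 : ‖(1 : ℂ) + x‖ = 1 + x := by
      rw [← Complex.ofReal_one, ← Complex.ofReal_add, Complex.norm_real,
        Real.norm_of_nonneg (by linarith)]
    rwa [h3] at h2
  refine ev_ext fun v hv => ?_
  rw [ev_eq_ev_one_of_deriv_eq_zero h hv, norm_le_zero_iff.mp h1, ev_zero]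

/-- If `f = zbL↓F` and `S g = zaL↑F`, where `F = f + S g`, then the energy of `F` is
`⟨F, F⟩ = z(b⟨L↓F, F⟩ + a⟨L↓SF, SF⟩)`, and all three brackets are nonnegative. -/
theorem IsClusterPair.eq_zero_of_pos {β : ℝ≥0} (hβ : 0 < β) {a b : ℝ} (ha : 0 ≤ a) (hb : 0 ≤ b)
    {z : ℂ} (hz : ∀ x : ℝ, 0 ≤ x → z ≠ x) (h₁ : IsUnit (1 - (z * b) • Ldown))
    (h₂ : IsUnit (1 - (z * a) • Ldown)) {f g : HInf}
    (h : IsClusterPair β (z * b) (z * a) f g) : f = 0 := by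
  have hs : (0 : ℝ) < 2 * β := by positivity
  obtain ⟨F, hF, hfF⟩ := h.exists_add_spinFlip h₂
  obtain ⟨G, hG, hgG⟩ := h.symm.exists_add_spinFlip h₁
  have tf := h.tame h₁ h₂
  have tg := h.symm.tame h₂ h₁
  have tF : Tame (2 * β) (ev F) := (tf.add tg.spinFlip).congr fun v hv => (hF v hv).symm
  have tG : Tame (2 * β) (ev G) := (tg.add tf.spinFlip).congr fun v hv => (hG v hv).symm
  have hFG : ∀ v ∈ rightHalfPlane, ev F v = spinFlip β (ev G) v := by
    intro v hv
    rw [hF v hv, spinFlip_congr β hG hv, spinFlip_add, spinFlip_spinFlip β _ hv, add_comm]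
  have hfF' : ∀ v ∈ rightHalfPlane, ev f v = z * b * ev F (1 + v) := fun v hv => by
    conv_lhs => rw [hfF]
    rw [ev_smul, ev_Ldown F hv]
  have hgG' : ∀ v ∈ rightHalfPlane, ev g v = z * a * ev G (1 + v) := fun v hv => by
    conv_lhs => rw [hgG]
    rw [ev_smul, ev_Ldown G hv]
  obtain ⟨CF, hCF⟩ := tF.norm_mul_deriv_le hs.le
  obtain ⟨CG, hCG⟩ := tG.norm_mul_deriv_le hs.le
  obtain ⟨P, hP, hPe⟩ := exists_energy_shift_eq (s := 2 * β) (ev_differentiableOn F) hCF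
  obtain ⟨Q, hQ, hQe⟩ := exists_energy_shift_eq (s := 2 * β) (ev_differentiableOn G) hCG
  have e1 : energy (2 * β) (ev F) (ev F) = z * ((b * P + a * Q : ℝ) : ℂ) := by
    calc energy (2 * β) (ev F) (ev F)
        = energy (2 * β) (fun v => ev f v + spinFlip β (ev g) v) (ev F) :=
          energy_congr hF fun _ _ => rfl
      _ = energy (2 * β) (ev f) (ev F) + energy (2 * β) (spinFlip β (ev g)) (ev F) :=
          energy_add_left hs tf tg.spinFlip tF
      _ = energy (2 * β) (ev f) (ev F) + energy (2 * β) (spinFlip β (ev g)) (spinFlip β (ev G)) := by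
          rw [energy_congr (G := spinFlip β (ev g)) (H := ev F) (fun _ _ => rfl) hFG]
      _ = energy (2 * β) (ev f) (ev F) + energy (2 * β) (ev g) (ev G) := by
          rw [energy_spinFlip hβ tg tG]
      _ = z * b * P + z * a * Q := by
          rw [energy_congr hfF' fun _ _ => rfl, energy_congr hgG' fun _ _ => rfl,
            energy_const_mul_left, energy_const_mul_left, hPe, hQe]
      _ = _ := by push_cast; ring
  obtain ⟨R, hR, hRe⟩ : ∃ R : ℝ, 0 ≤ R ∧ energy (2 * β) (ev F) (ev F) = R :=
    ⟨_, MeasureTheory.setIntegral_nonneg isOpen_rightHalfPlane.measurableSet fun v hv =>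
      mul_nonneg (by positivity) (Real.rpow_nonneg (le_of_lt hv) _), energy_self_eq_ofReal _ _⟩
  have hzero : energy (2 * β) (ev F) (ev F) = 0 := by
    by_cases hPQ : b * P + a * Q = 0
    · rw [e1, hPQ, Complex.ofReal_zero, mul_zero]
    · refine absurd ?_ (hz (R / (b * P + a * Q)) (by positivity))
      rw [Complex.ofReal_div, eq_div_iff (Complex.ofReal_ne_zero.mpr hPQ), ← e1, hRe]
  have hF0 : F = 0 := eq_zero_of_tame_of_deriv_eq_zero hs tF fun v hv =>
    deriv_eq_zero_of_energy_eq_zero hs tF hzero hv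
  rw [hfF, hF0, map_zero, smul_zero]

/-- For `β = 0`, the pair `(f', -g')` solves the coupled equations for `β = 1`. -/
theorem IsClusterPair.deriv_eq_zero {z : ℂ} (hz : ∀ x : ℝ, 0 ≤ x → z ≠ x)
    (h₁ : IsUnit (1 - z • Ldown)) {f g : HInf} (h : IsClusterPair 0 z z f g) :
    ∀ v ∈ rightHalfPlane, deriv (ev f) v = 0 := by
  obtain ⟨B, hB0, hB⟩ := h.exists_norm_deriv_le h₁
  obtain ⟨B', hB0', hB'⟩ := h.symm.exists_norm_deriv_le h₁
  let p : HInf := HInf.mk (deriv (ev f)) ((ev_differentiableOn f).deriv isOpen_rightHalfPlane) B hB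
  let q : HInf := HInf.mk (fun v => -deriv (ev g) v)
    ((ev_differentiableOn g).deriv isOpen_rightHalfPlane).neg B' fun v hv => by
      rw [norm_neg]; exact hB' v hv
  have hp : ∀ v ∈ rightHalfPlane, ev p v = deriv (ev f) v := fun v hv => ev_mk hv
  have hq : ∀ v ∈ rightHalfPlane, ev q v = -deriv (ev g) v := fun v hv => ev_mk hv
  have hsq : ∀ w : ℂ, w ^ ((2 * ((1 : ℝ≥0) : ℝ) : ℝ) : ℂ) = w ^ 2 := fun w => by
    rw [NNReal.coe_one, mul_one, Complex.ofReal_ofNat, ← Complex.cpow_ofNat]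
  have hone : ∀ w : ℂ, w ^ ((2 * ((0 : ℝ≥0) : ℝ) : ℝ) : ℂ) = 1 := fun w => by simp
  have hzero : ((2 * ((0 : ℝ≥0) : ℝ) : ℝ) : ℂ) = 0 := by simp
  have hpair : IsClusterPair 1 (z * (1 : ℝ)) (z * (1 : ℝ)) p q := by
    rw [Complex.ofReal_one, mul_one]
    constructor
    · refine ev_ext fun v hv => ?_
      have h1 := one_add_mem hv
      rw [ev_smul_add _ _ _ _ hv, hsq, hp v hv, hp _ h1, hq _ (inv_mem h1), h.deriv_eq hv, hone,
        hzero]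
      generalize 1 + v = w
      ring
    · refine ev_ext fun v hv => ?_
      have h1 := one_add_mem hv
      rw [ev_smul_add _ _ _ _ hv, hsq, hq v hv, hq _ h1, hp _ (inv_mem h1), h.symm.deriv_eq hv,
        hone, hzero]
      generalize 1 + v = w
      ring
  have h₁' : IsUnit (1 - (z * (1 : ℝ)) • Ldown) := by rwa [Complex.ofReal_one, mul_one]
  have hp0 := hpair.eq_zero_of_pos one_pos zero_le_one zero_le_one hz h₁' h₁'
  intro v hv
  rw [← hp v hv, hp0, ev_zero]

theorem IsClusterPair.eq_zero_of_beta_eq_zero {z : ℂ} (hz : ∀ x : ℝ, 0 ≤ x → z ≠ x)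
    (h₁ : IsUnit (1 - z • Ldown)) {f g : HInf} (h : IsClusterPair 0 z z f g) : f = 0 := by
  have hf := fun v hv => ev_eq_ev_one_of_deriv_eq_zero (h.deriv_eq_zero hz h₁) (v := v) hv
  have hg := fun v hv => ev_eq_ev_one_of_deriv_eq_zero (h.symm.deriv_eq_zero hz h₁) (v := v) hv
  have h1 := one_add_mem one_mem_rightHalfPlane
  have e1 := h.ev_eq one_mem_rightHalfPlane
  have e2 := h.symm.ev_eq one_mem_rightHalfPlane
  rw [spinFlip, hf _ h1, hg _ (inv_mem h1)] at e1
  rw [spinFlip, hg _ h1, hf _ (inv_mem h1)] at e2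
  simp only [NNReal.coe_zero, mul_zero, Complex.ofReal_zero, Complex.cpow_zero, div_one,
    one_mul] at e1 e2
  have e3 : ev g 1 = ev f 1 := by linear_combination e2 - e1
  have e4 : ev f 1 * (1 - 2 * z) = 0 := by
    rw [e3] at e1
    linear_combination e1
  have hz2 : 1 - 2 * z ≠ 0 := by
    intro h0
    refine hz (1 / 2) (by norm_num) ?_
    push_cast
    linear_combination -(1 / 2) * h0
  refine ev_ext fun v hv => ?_
  rw [hf v hv, (mul_eq_zero.mp e4).resolve_right hz2, ev_zero]

theorem IsClusterPair.eq_zero {β : ℝ≥0} {h : ℝ} {z : ℂ} (hz : ∀ x : ℝ, 0 ≤ x → z ≠ x)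
    (h₁ : IsUnit (1 - (z * (Real.exp (β * h) : ℂ)) • Ldown))
    (h₂ : IsUnit (1 - (z * (Real.exp (-(β * h)) : ℂ)) • Ldown)) {f g : HInf}
    (hp : IsClusterPair β (z * (Real.exp (β * h) : ℂ)) (z * (Real.exp (-(β * h)) : ℂ)) f g) :
    f = 0 := by
  rcases eq_or_ne β 0 with rfl | hβ
  · simp only [NNReal.coe_zero, zero_mul, neg_zero, Real.exp_zero, Complex.ofReal_one, mul_one]
      at h₁ hp
    exact hp.eq_zero_of_beta_eq_zero hz h₁
  · exact hp.eq_zero_of_pos (pos_iff_ne_zero.mpr hβ) (Real.exp_pos _).le (Real.exp_pos _).le hz h₁ h₂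

end Vanishing

/-! ### The spectrum outside the disc of radius `e^{|βh|}` -/

section Conclusion

theorem exp_le_exp_abs (x : ℝ) : Real.exp x ≤ Real.exp |x| ∧ Real.exp (-x) ≤ Real.exp |x| :=
  ⟨Real.exp_le_exp.mpr (le_abs_self x), Real.exp_le_exp.mpr (neg_le_abs x)⟩

theorem norm_exp_smul_le {X : Type*} [NormedAddCommGroup X] [NormedSpace ℂ X] {T : X →L[ℂ] X}
    (hT : ‖T‖ ≤ 1) {y r : ℝ} (hy : Real.exp y ≤ r) : ‖(Real.exp y : ℂ) • T‖ ≤ r := by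
  rw [norm_smul, Complex.norm_real, Real.norm_of_nonneg (Real.exp_pos _).le]
  calc _ ≤ r * 1 := mul_le_mul hy hT (norm_nonneg _) ((Real.exp_pos _).le.trans hy)
    _ = r := mul_one r

theorem FiniteRankApproximable.smul_mul_smul {X : Type*} [NormedAddCommGroup X] [NormedSpace ℂ X]
    {A B : X →L[ℂ] X} (h : FiniteRankApproximable (A * B)) (a b : ℂ) :
    FiniteRankApproximable ((a • A) * (b • B)) := by
  have := (h.mul_left (a • 1)).mul_right (b • 1)
  convert this using 1
  simp only [smul_mul_assoc, mul_smul_comm, one_mul, mul_one]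

theorem notMem_essSpectrum_and_isolated {X : Type*} [NormedAddCommGroup X] [NormedSpace ℂ X]
    [CompleteSpace X] {A B : X →L[ℂ] X} {ρ : ℝ} (hA : ‖A‖ ≤ ρ) (hB : ‖B‖ ≤ ρ)
    (hAB : FiniteRankApproximable (A * B)) {μ : ℂ} (hμ : ρ < ‖μ‖) :
    μ ∉ essSpectrum (A + B) ∧
      (μ ∈ spectrum ℂ (A + B) → IsIsolatedEigenvalueOfFiniteMultiplicity (A + B) μ) :=
  (isIsolatedEigenvalue_of_mem_spectrum hA hB hAB hμ).imp_left not_not_intro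

theorem L_notMem_essSpectrum_and_isolated (β : ℝ≥0) (h : ℝ) {μ : ℂ}
    (hμ : Real.exp |β * h| < ‖μ‖) : μ ∉ essSpectrum (L β h) ∧
      (μ ∈ spectrum ℂ (L β h) → IsIsolatedEigenvalueOfFiniteMultiplicity (L β h) μ) :=
  notMem_essSpectrum_and_isolated
    (norm_exp_smul_le (norm_Lup_le β) (exp_le_exp_abs (β * h)).2)
    (norm_exp_smul_le norm_Ldown_le (exp_le_exp_abs (β * h)).1)
    ((finiteRankApproximable_Lup_mul_Ldown β).smul_mul_smul _ _) hμ

theorem essSpectralRadius_L_le (β : ℝ≥0) (h : ℝ) :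
    essSpectralRadius (L β h) ≤ ENNReal.ofReal (Real.exp |β * h|) := by
  refine iSup₂_le fun μ hμ => ?_
  by_contra hlt
  refine (L_notMem_essSpectrum_and_isolated β h ?_).1 hμ
  rw [not_le, ← enorm_eq_nnnorm, ← ofReal_norm] at hlt
  exact (ENNReal.ofReal_lt_ofReal_iff_of_nonneg (Real.exp_pos _).le).mp hlt

theorem notMem_spectrum_of_norm_lt {X : Type*} [NormedAddCommGroup X] [NormedSpace ℂ X]
    [CompleteSpace X] {T : X →L[ℂ] X} {r : ℝ} (hr : 0 ≤ r) (hT : ‖T‖ ≤ r) {μ : ℂ} (hμ : r < ‖μ‖) :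
    μ ∉ spectrum ℂ T := by
  have hμ0 : 0 < ‖μ‖ := hr.trans_lt hμ
  refine (isUnit_one_sub_inv_smul_iff (norm_pos_iff.mp hμ0)).mp (isUnit_one_sub_smul hT ?_)
  rw [norm_inv, inv_mul_lt_iff₀ hμ0, mul_one]
  exact hμ

theorem spectrum_L_inter_subset_Omega (β : ℝ≥0) (h : ℝ) {μ : ℂ} (hμ : Real.exp |β * h| < ‖μ‖)
    (hσ : μ ∈ spectrum ℂ (L β h)) : μ ∈ Omega β h := by
  have hμ0 : μ ≠ 0 := norm_pos_iff.mp ((Real.exp_pos _).trans hμ)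
  obtain ⟨F, hF0, hF⟩ := isEigenvalue_iff.mp ((L_notMem_essSpectrum_and_isolated β h hμ).2 hσ).isEigenvalue
  have hF' : F = μ⁻¹ • ((Real.exp (-(β * h)) : ℂ) • Lup β F + (Real.exp (β * h) : ℂ) • Ldown F) := by
    have : (Real.exp (-(β * h)) : ℂ) • Lup β F + (Real.exp (β * h) : ℂ) • Ldown F = μ • F := hF
    rw [this, smul_smul, inv_mul_cancel₀ hμ0, one_smul]
  have hne : (Real.exp (β * h) : ℂ) ≠ 0 := Complex.ofReal_ne_zero.mpr (Real.exp_pos _).ne'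
  obtain ⟨f, g, hf0, hp⟩ :=
    exists_isClusterPair_of_eigenfunction (inv_ne_zero hμ0) hne hF0 hF'
  have hunit : ∀ y : ℝ, Real.exp y ≤ Real.exp |β * h| →
      IsUnit (1 - (μ⁻¹ * (Real.exp y : ℂ)) • Ldown) := by
    intro y hy
    refine isUnit_one_sub_smul norm_Ldown_le ?_
    rw [mul_one, norm_mul, norm_inv, Complex.norm_real, Real.norm_of_nonneg (Real.exp_pos _).le,
      inv_mul_lt_iff₀ (norm_pos_iff.mpr hμ0), mul_one]
    exact hy.trans_lt hμ
  have hE := exp_le_exp_abs (β * h)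
  refine ⟨μ⁻¹, inv_ne_zero hμ0, by rw [one_div, inv_inv], ?_, ?_, ?_⟩
  · rw [one_div, inv_inv]
    exact notMem_spectrum_of_norm_lt (Real.exp_pos _).le
      (norm_exp_smul_le (norm_Lup_le β) hE.2) hμ
  · rw [one_div, inv_inv]
    exact notMem_spectrum_of_norm_lt (Real.exp_pos _).le (norm_exp_smul_le norm_Ldown_le hE.1) hμ
  · exact one_mem_spectrum_M_mul_M (hunit _ hE.1) (hunit _ hE.2) hf0 hp

theorem Omega_subset (β : ℝ≥0) (h : ℝ) {μ : ℂ} (hμ : μ ∈ Omega β h) :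
    μ ∈ spectrum ℂ (L β h) ∧ Real.exp |β * h| < ‖μ‖ := by
  obtain ⟨z, hz0, rfl, hup, hdown, hM⟩ := hμ
  obtain ⟨h₁, h₂, f, g, hf0, hp⟩ := exists_isClusterPair hM
  constructor
  · obtain ⟨F, hF0, hF⟩ := hp.exists_eigenfunction hf0 h₂
    refine mem_spectrum_of_apply_eq hF0 ?_
    change (Real.exp (-(β * h)) : ℂ) • Lup β F + (Real.exp (β * h) : ℂ) • Ldown F = _
    conv_rhs => rw [hF]
    rw [smul_smul, one_div_mul_cancel hz0, one_smul]
  · by_contra hle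
    rw [not_lt] at hle
    by_cases hz : ∀ x : ℝ, 0 ≤ x → z ≠ x
    · exact hf0 (hp.eq_zero hz h₁ h₂)
    · push Not at hz
      obtain ⟨x, hx0, rfl⟩ := hz
      have hx : 0 < x := lt_of_le_of_ne hx0 fun h => hz0 (by rw [← h, Complex.ofReal_zero])
      have e : (1 : ℂ) / x = ((1 / x : ℝ) : ℂ) := by push_cast; rfl
      rw [e] at hup hdown hle
      rw [Complex.norm_real, Real.norm_of_nonneg (by positivity)] at hle
      rcases ofReal_mem_spectrum_or β h (by positivity) hle with h | h
      · exact hup h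
      · exact hdown h

end Conclusion

end FareyChain

end

theorem theorem1 (β : NNReal) (h : ℝ) :
    -- the bounds `r_ess ≤ e^{|βh|} ≤ r`
    (FareyChain.essSpectralRadius (FareyChain.L β h) ≤ ENNReal.ofReal (Real.exp |β * h|) ∧
      ENNReal.ofReal (Real.exp |β * h|) ≤ spectralRadius ℂ (FareyChain.L β h)) ∧
    -- the spectrum outside the closed disc of radius `e^{|βh|}`
    spectrum ℂ (FareyChain.L β h) ∩ {μ : ℂ | Real.exp |β * h| < ‖μ‖} = FareyChain.Omega β h ∧
    (∀ μ ∈ spectrum ℂ (FareyChain.L β h), Real.exp |β * h| < ‖μ‖ →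
      FareyChain.IsIsolatedEigenvalueOfFiniteMultiplicity (FareyChain.L β h) μ) ∧
    -- the spectral radius as an eigenvalue
    (FareyChain.essSpectralRadius (FareyChain.L β h) < spectralRadius ℂ (FareyChain.L β h) →
      FareyChain.IsEigenvalue (FareyChain.L β h)
        ((spectralRadius ℂ (FareyChain.L β h)).toReal : ℂ)) := by
  refine ⟨⟨FareyChain.essSpectralRadius_L_le β h, FareyChain.exp_abs_le_spectralRadius β h⟩, ?_,
    fun μ hσ hμ => (FareyChain.L_notMem_essSpectrum_and_isolated β h hμ).2 hσ,
    FareyChain.isEigenvalue_spectralRadius_L β h⟩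
  exact Set.Subset.antisymm
    (fun μ hμ => FareyChain.spectrum_L_inter_subset_Omega β h hμ.2 hμ.1)
    (fun μ hμ => FareyChain.Omega_subset β h hμ)
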